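/- Let $[5]=\{1,\dots,5\}$. Let $L=E(5,10)$ be the Lie superalgebra whose even part consists of the divergence-free vector fields $\sum_i f_i\partial_i$, $f_i\in\mathbb C[[x_1,\dots,x_5]]$, and whose odd part consists of the closed two-forms in $x_1,\dots,x_5$ with coefficients in $\mathbb C[[x_1,\dots,x_5]]$. Even elements have the usual bracket, they act on forms by Lie derivative, and with $d_{ij}=dx_i\wedge dx_j$ one has $[f d_{ij},g d_{kl}]=\varepsilon_{ijkl}\,fg\,\partial_{t}$, where, if $i,j,k,l$ are distinct, $t=t_{ijkl}$ is the fifth index and $\varepsilon_{ijkl}=\varepsilon_{ijklt}$ is the sign of the permutation $(i,j,k,l,t)$, and $\varepsilon_{ijkl}=0$ otherwise. Grade $L$ by $\deg x_i=2$, $\deg\partial_i=-2$, $\deg d_{ij}=-1$; thus $L_{-2}=\langle\partial_i\rangle$, $L_{-1}=\langle d_{ij}\rangle$, $L_0=\{\sum a_{ij}x_i\partial_j:\sum a_{ii}=0\}\cong\mathfrak{sl}_5$, $L_-=L_{-2}\oplus L_{-1}$, $L_{\ge 0}$ is the subalgebra of all vector fields and forms vanishing at the origin, and $L_+\subset L_{\ge0}$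 is the ideal of elements with zero component in $L_0$. Let $U=U(L)$ and $U_-=U(L_-)\subset U$. For an $L_0$-module $V$, on which $L_+$ acts by zero, let $M(V)=U\otimes_{U(L_{\ge0})}V\;(\cong U_-\otimes V)$. For $d\ge 0$ let $\mathcal I_d$ be the set of sequences $I=(I_1,\dots,I_d)$ of pairs $I_l=(i_l,j_l)\in[5]^2$. The group $B_d$ of signed permutations acts on $\mathcal I_d$ by permuting the pairs and reversing some of them; $\ell$ is its Coxeter length. Put $d_I=d_{I_1}\cdots d_{I_d}\in U_-$ and $$\omega_I=\sum_{S}(-1)^{c(S)}\Big(\prod_{\{k,l\}\in S}\tfrac12(-1)^{k+l}\varepsilon_{I_k,I_l}\,\partial_{t_{I_k,I_l}}\Big)d_{C_S(I)},$$ where $S$ runs over the sets of pairwise disjoint two-element subsets of $\{1,\dots,d\}$, $c(S)$ is the number of crossing pairs in $S$, and $C_S(I)$ is obtained from $I$ by deleting the entries whose positions are covered by $S$. (So $\omega_I=d_I$ for $d=1$, while for $d=3$ the set $S$ is empty or a single pair.) Let $V,W$ be $L_0$-modules (in particular, $V=F(\lambda)$ and $W=F(\mu)$ may be the finite-dimensional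 irreducible $\mathfrak{sl}_5$-modules of highest weights $\lambda$ and $\mu$). Let $\theta_I$ ($I\in\mathcal I_3$) and $\theta^t_I$ ($t\in[5]$, $I\in\mathcal I_1$) be linear maps $V\to W$ with $\theta_{g(I)}=(-1)^{\ell(g)}\theta_I$ for $g\in B_3$ and $\theta^t_{g(I)}=(-1)^{\ell(g)}\theta^t_I$ for $g\in B_1$, let $$\Phi=\sum_{I\in\mathcal I_3/B_3}\omega_I\otimes\theta_I+\sum_{t\in[5]}\sum_{I\in\mathcal I_1/B_1}\partial_t\omega_I\otimes\theta^t_I\in U_-\otimes\mathrm{Hom}(V,W),$$ and let $\varphi:M(V)\to M(W)$ be the associated linear map of degree 3, $\varphi(u\otimes v)=u\,\Phi(v)$ for $u\in U_-$, $v\in V$, where $\Phi(v)=\sum_i u_i\otimes\theta_i(v)$ if $\Phi=\sum_i u_i\otimes\theta_i$. Here $x\in L_0$ acts on $U_-$ by the commutator and on $\theta\in\mathrm{Hom}(V,W)$ by $(x.\theta)(v)=x.(\theta(v))-\theta(x.v)$. For distinct $p,q\in[5]$ and $P\in\mathcal I_1$ put $\chi_{pq}(P)=1$ if $P=(p,q)$,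 $\chi_{pq}(P)=-1$ if $P=(q,p)$, and $\chi_{pq}(P)=0$ otherwise. Let $C(a,b,c)=\{(a,b,c),(b,c,a),(c,a,b)\}$. **Theorem.** Assume that $x.\Phi=0$ for every $x\in L_0$. Then $\varphi$ is a morphism of $L$-modules if and only if for all $H,L\in\mathcal I_1$ (here $L$ denotes a pair of indices, not the superalgebra), every permutation $(p,q,a,b,c)$ of $[5]$ and every $v\in V$ the following four equations hold: \begin{align*} &\chi_{pq}(L)\,\theta^p_H(v)-\chi_{pq}(H)\,\theta^p_L(v)+\tfrac12\varepsilon_{pqabc}\sum_{(\alpha,\beta,\gamma)\in C(a,b,c)}\big(-(x_p\partial_\gamma.\theta_{\alpha\beta,H,L})(v)+2\,x_p\partial_\gamma.(\theta_{\alpha\beta,H,L}(v))\big)=0,\\ &\tfrac14\theta_{ab,bc,cq}(v)+\tfrac14\theta_{ac,cb,bq}(v)+\tfrac12\varepsilon_{pqabc}\sum_{(\alpha,\beta,\gamma)\in C(a,b,c)}\big(-(x_p\partial_\gamma.\theta^a_{\alpha\beta})(v)+2\,x_p\partial_\gamma.(\theta^a_{\alpha\beta}(v))\big)=0,\\ &\sum_{(\alpha,\beta,\gamma)\in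 C(a,b,c)}x_p\partial_\gamma.(\theta^p_{\alpha\beta}(v))=0,\\ &\varepsilon_{pqabc}\sum_{(\alpha,\beta,\gamma)\in C(a,b,c)}x_p\partial_\gamma.(\theta^q_{\alpha\beta}(v))-\tfrac12\theta_{ab,bc,ca}(v)=0. \end{align*} -/

import Mathlib

/-!  # The Lie superalgebra E(5,10), its generalized Verma modules, and the elements `ω_I`

Indices `1, …, 5` are represented by `Fin 5`. -/

open scoped TensorProduct

namespace E510

noncomputable section

/-! ## Power series, vector fields and two-forms in five variables -/

/-- `ℂ[[x₁, …, x₅]]`. -/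
abbrev PS : Type := MvPowerSeries (Fin 5) ℂ

/-- The partial derivative `∂/∂x_i` on power series. -/
abbrev pd (i : Fin 5) : Derivation ℂ PS PS := MvPowerSeries.pderiv ℂ i

/-- `ε_w`: the sign of `w` if the sequence `w` is a permutation of the five indices, and `0` if
`w` has a repetition. -/
def eps (w : Fin 5 → Fin 5) : ℤ :=
  ∏ i : Fin 5, ∏ j ∈ Finset.Ioi i, Int.sign ((w j : ℤ) - (w i : ℤ))

/-- Divergence of the vector field `∑ X_i ∂_i`, represented by its coefficients. -/
def divergence : (Fin 5 → PS) →ₗ[ℂ] PS :=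
  ∑ i : Fin 5, (pd i).toLinearMap ∘ₗ LinearMap.proj i

/-- The even part `S₅`: vector fields `∑ X_i ∂_i` with zero divergence. -/
def EvenPart : Submodule ℂ (Fin 5 → PS) := LinearMap.ker divergence

/-- The odd part: closed two-forms. The form `∑_{i<j} f_{ij} dx_i ∧ dx_j` is represented by the
antisymmetric matrix `(f_{ij})`. -/
def OddPart : Submodule ℂ (Fin 5 → Fin 5 → PS) where
  carrier := {f | (∀ i j, f i j = -f j i) ∧
    ∀ i j k, pd i (f j k) + pd j (f k i) + pd k (f i j) = 0}
  zero_mem' := by simp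
  add_mem' := by
    rintro f g ⟨hf, hf'⟩ ⟨hg, hg'⟩
    refine ⟨fun i j => ?_, fun i j k => ?_⟩
    · simp only [Pi.add_apply]
      rw [hf i j, hg i j]; ring
    · simp only [Pi.add_apply, map_add]
      linear_combination hf' i j k + hg' i j k
  smul_mem' := by
    rintro c f ⟨hf, hf'⟩
    refine ⟨fun i j => ?_, fun i j k => ?_⟩
    · simp only [Pi.smul_apply]
      rw [hf i j, smul_neg]
    · simp only [Pi.smul_apply, Derivation.map_smul]
      rw [← smul_add, ← smul_add, hf' i j k, smul_zero]

/-- Coefficients of the bracket of two vector fields. -/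
def vfBracket (X Y : Fin 5 → PS) : Fin 5 → PS :=
  fun i => ∑ j, (X j * pd j (Y i) - Y j * pd j (X i))

/-- Coefficients of the Lie derivative of a two-form along a vector field. -/
def lieDer (X : Fin 5 → PS) (f : Fin 5 → Fin 5 → PS) : Fin 5 → Fin 5 → PS :=
  fun i j => ∑ k, (X k * pd k (f i j) + pd i (X k) * f k j + pd j (X k) * f i k)

/-- Coefficients of the bracket of two two-forms, i.e. the bilinear extension of
`[f dx_i ∧ dx_j, g dx_k ∧ dx_l] = ε_{ijkl} f g ∂_t`, with `{i,j,k,l,t} = {1,…,5}`. The factor `1/4`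
is there because each of `∑_{i<j}`, `∑_{k<l}` is replaced by a sum over all pairs. -/
def formBracket (f g : Fin 5 → Fin 5 → PS) : Fin 5 → PS :=
  fun t => (1 / 4 : ℂ) • ∑ i, ∑ j, ∑ k, ∑ l, eps ![i, j, k, l, t] • (f i j * g k l)

theorem pd_comm (i j : Fin 5) (f : PS) : pd i (pd j f) = pd j (pd i f) := by
  ext n
  simp only [MvPowerSeries.coeff_pderiv]
  rw [add_right_comm]
  by_cases h : i = j
  · subst h; rfl
  · simp [h, Ne.symm h]
    ring

theorem divergence_apply (X : Fin 5 → PS) : divergence X = ∑ i, pd i (X i) := by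
  simp [divergence]

theorem mem_evenPart {X : Fin 5 → PS} : X ∈ EvenPart ↔ ∑ i, pd i (X i) = 0 := by
  rw [EvenPart, LinearMap.mem_ker, divergence_apply]

theorem vfBracket_mem {X Y : Fin 5 → PS} (hX : X ∈ EvenPart) (hY : Y ∈ EvenPart) :
    vfBracket X Y ∈ EvenPart := by
  rw [mem_evenPart] at *
  have key : ∀ A B : Fin 5 → PS, ∑ i, pd i (B i) = 0 →
      ∑ i, ∑ j, A j * pd i (pd j (B i)) = 0 := by
    intro A B hB
    rw [Finset.sum_comm]
    refine Finset.sum_eq_zero fun j _ => ?_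
    rw [← Finset.mul_sum]
    simp only [fun i => pd_comm i j (B i)]
    rw [← map_sum, hB, map_zero, mul_zero]
  have h1 := key X Y hY
  have h2 := key Y X hX
  have h3 : ∑ i, ∑ j, pd i (X j) * pd j (Y i) = ∑ i, ∑ j, pd i (Y j) * pd j (X i) := by
    rw [Finset.sum_comm]
    exact Finset.sum_congr rfl fun i _ => Finset.sum_congr rfl fun j _ => mul_comm _ _
  have : ∑ i, pd i (vfBracket X Y i) =
      (∑ i, ∑ j, X j * pd i (pd j (Y i))) + (∑ i, ∑ j, pd i (X j) * pd j (Y i))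
      - (∑ i, ∑ j, Y j * pd i (pd j (X i))) - (∑ i, ∑ j, pd i (Y j) * pd j (X i)) := by
    simp only [← Finset.sum_add_distrib, ← Finset.sum_sub_distrib]
    refine Finset.sum_congr rfl fun i _ => ?_
    rw [vfBracket, map_sum]
    refine Finset.sum_congr rfl fun j _ => ?_
    rw [map_sub, Derivation.leibniz, Derivation.leibniz]
    simp only [smul_eq_mul]
    ring
  rw [this, h1, h2, h3]
  ring

theorem lieDer_mem {X : Fin 5 → PS} {f : Fin 5 → Fin 5 → PS} (hf : f ∈ OddPart) :
    lieDer X f ∈ OddPart := by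
  obtain ⟨ha, hc⟩ := hf
  have cartan : ∀ i j, lieDer X f i j =
      pd i (∑ k, X k * f k j) - pd j (∑ k, X k * f k i) := by
    intro i j
    rw [lieDer, map_sum, map_sum, ← Finset.sum_sub_distrib]
    refine Finset.sum_congr rfl fun k _ => ?_
    rw [Derivation.leibniz, Derivation.leibniz]
    simp only [smul_eq_mul]
    have h1 := hc i j k
    have h2 : pd j (f k i) = - pd j (f i k) := by rw [ha k i, map_neg]
    have h3 : pd i (f k j) = - pd i (f j k) := by rw [ha k j, map_neg]
    rw [ha i k, h3]
    linear_combination X k * h1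
  refine ⟨fun i j => ?_, fun i j k => ?_⟩
  · rw [cartan i j, cartan j i]; ring
  · simp only [cartan, map_sub]
    rw [pd_comm i j, pd_comm j k, pd_comm k i]
    ring

theorem eps_eq (a b c d e : Fin 5) : eps ![a, b, c, d, e] =
    Int.sign ((b : ℤ) - a) * Int.sign ((c : ℤ) - a) * Int.sign ((d : ℤ) - a) *
    Int.sign ((e : ℤ) - a) * Int.sign ((c : ℤ) - b) * Int.sign ((d : ℤ) - b) *
    Int.sign ((e : ℤ) - b) * Int.sign ((d : ℤ) - c) * Int.sign ((e : ℤ) - c) *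
    Int.sign ((e : ℤ) - d) := by
  have h0 : Finset.Ioi (0 : Fin 5) = {1, 2, 3, 4} := by decide
  have h1 : Finset.Ioi (1 : Fin 5) = {2, 3, 4} := by decide
  have h2 : Finset.Ioi (2 : Fin 5) = {3, 4} := by decide
  have h3 : Finset.Ioi (3 : Fin 5) = {4} := by decide
  have h4 : Finset.Ioi (4 : Fin 5) = ∅ := by decide
  rw [eps, Fin.prod_univ_five, h0, h1, h2, h3, h4]
  simp [-mul_eq_mul_left_iff, -mul_eq_mul_right_iff]
  ring

theorem eps_rotate (i j k l t : Fin 5) : eps ![j, t, k, l, i] = eps ![i, j, k, l, t] := by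
  have n : ∀ a b : ℤ, Int.sign (a - b) = - Int.sign (b - a) := by
    intro a b; rw [← Int.sign_neg, neg_sub]
  rw [eps_eq, eps_eq, n i j, n i t, n k t, n l t, n i k, n i l]
  ring

theorem eps_swap (i j k l t : Fin 5) : eps ![k, l, i, j, t] = eps ![i, j, k, l, t] := by
  have n : ∀ a b : ℤ, Int.sign (a - b) = - Int.sign (b - a) := by
    intro a b; rw [← Int.sign_neg, neg_sub]
  rw [eps_eq, eps_eq, n i k, n j k, n i l, n j l]
  ring

theorem sum_cyclic_eq_zero (e : Fin 5 → Fin 5 → Fin 5 → ℤ) (D : Fin 5 → Fin 5 → Fin 5 → PS)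
    (he : ∀ i j t, e j t i = e i j t) (hD : ∀ i j t, D i j t + D j t i + D t i j = 0) :
    ∑ i, ∑ j, ∑ t, e i j t • D i j t = 0 := by
  have rot : ∀ F : Fin 5 → Fin 5 → Fin 5 → PS,
      ∑ i, ∑ j, ∑ t, F i j t = ∑ i, ∑ j, ∑ t, F j t i := by
    intro F
    calc ∑ i, ∑ j, ∑ t, F i j t = ∑ i, ∑ t, ∑ j, F i j t :=
          Finset.sum_congr rfl fun j _ => Finset.sum_comm
      _ = ∑ t, ∑ i, ∑ j, F i j t := Finset.sum_comm
  have h1 := rot fun i j t => e i j t • D i j t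
  have h2 := rot fun i j t => e j t i • D j t i
  have h3 : (3 : ℂ) • ∑ i, ∑ j, ∑ t, e i j t • D i j t = 0 := by
    have : ∑ i, ∑ j, ∑ t, (e i j t • D i j t + e j t i • D j t i + e t i j • D t i j) = 0 := by
      refine Finset.sum_eq_zero fun i _ => Finset.sum_eq_zero fun j _ =>
        Finset.sum_eq_zero fun t _ => ?_
      rw [← he t i j, ← he i j t, he i j t, ← smul_add, ← smul_add, hD, smul_zero]
    simp only [Finset.sum_add_distrib] at this
    rw [← h2, ← h1] at this
    rw [← this]
    module
  exact (smul_eq_zero.mp h3).resolve_left (by norm_num)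

theorem sum_pairs_comm (F : Fin 5 → Fin 5 → Fin 5 → Fin 5 → PS) :
    ∑ i, ∑ j, ∑ k, ∑ l, F i j k l = ∑ k, ∑ l, ∑ i, ∑ j, F i j k l := by
  have h := Finset.sum_comm (s := Finset.univ) (t := Finset.univ)
    (f := fun (p q : Fin 5 × Fin 5) => F p.1 p.2 q.1 q.2)
  simpa only [Fintype.sum_prod_type] using h

theorem sum_eps_eq_zero {f : Fin 5 → Fin 5 → PS} (hf : f ∈ OddPart) (g : Fin 5 → Fin 5 → PS) :
    ∑ t, ∑ i, ∑ j, ∑ k, ∑ l, eps ![i, j, k, l, t] • (pd t (f i j) * g k l) = 0 := by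
  have h : ∀ k l, ∑ i, ∑ j, ∑ t, eps ![i, j, k, l, t] • (pd t (f i j) * g k l) = 0 := by
    intro k l
    refine sum_cyclic_eq_zero (fun i j t => eps ![i, j, k, l, t])
      (fun i j t => pd t (f i j) * g k l) (fun i j t => eps_rotate i j k l t) fun i j t => ?_
    rw [← add_mul, ← add_mul]
    have := hf.2 i j t
    rw [show pd t (f i j) + pd i (f j t) + pd j (f t i) = 0 by linear_combination this, zero_mul]
  calc _ = ∑ i, ∑ j, ∑ k, ∑ l, ∑ t, eps ![i, j, k, l, t] • (pd t (f i j) * g k l) := by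
        rw [Finset.sum_comm]
        refine Finset.sum_congr rfl fun i _ => ?_
        rw [Finset.sum_comm]
        refine Finset.sum_congr rfl fun j _ => ?_
        rw [Finset.sum_comm]
        refine Finset.sum_congr rfl fun k _ => ?_
        rw [Finset.sum_comm]
    _ = ∑ k, ∑ l, ∑ i, ∑ j, ∑ t, eps ![i, j, k, l, t] • (pd t (f i j) * g k l) := by
        exact sum_pairs_comm fun i j k l =>
          ∑ t, eps ![i, j, k, l, t] • (pd t (f i j) * g k l)
    _ = 0 := by simp only [h, Finset.sum_const_zero]

theorem formBracket_mem {f g : Fin 5 → Fin 5 → PS} (hf : f ∈ OddPart) (hg : g ∈ OddPart) :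
    formBracket f g ∈ EvenPart := by
  rw [mem_evenPart]
  have h1 := sum_eps_eq_zero hf g
  have h2 := sum_eps_eq_zero hg f
  have h3 : ∑ t, ∑ i, ∑ j, ∑ k, ∑ l, eps ![i, j, k, l, t] • (f i j * pd t (g k l)) = 0 := by
    rw [← h2]
    refine Finset.sum_congr rfl fun t _ => ?_
    rw [sum_pairs_comm]
    refine Finset.sum_congr rfl fun i _ => Finset.sum_congr rfl fun j _ =>
      Finset.sum_congr rfl fun k _ => Finset.sum_congr rfl fun l _ => ?_
    rw [eps_swap, mul_comm]
  have : ∑ t, pd t (formBracket f g t) = (1 / 4 : ℂ) •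
      ((∑ t, ∑ i, ∑ j, ∑ k, ∑ l, eps ![i, j, k, l, t] • (pd t (f i j) * g k l)) +
      ∑ t, ∑ i, ∑ j, ∑ k, ∑ l, eps ![i, j, k, l, t] • (f i j * pd t (g k l))) := by
    simp only [← Finset.sum_add_distrib]
    rw [Finset.smul_sum]
    refine Finset.sum_congr rfl fun t _ => ?_
    rw [formBracket, Derivation.map_smul]
    congr 1
    simp only [map_sum, map_zsmul]
    refine Finset.sum_congr rfl fun i _ => Finset.sum_congr rfl fun j _ =>
      Finset.sum_congr rfl fun k _ => Finset.sum_congr rfl fun l _ => ?_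
    rw [← smul_add, Derivation.leibniz]
    simp only [smul_eq_mul]
    rw [mul_comm (g k l), add_comm]
  rw [this, h1, h3, add_zero, smul_zero]

/-! ## The Lie superalgebra `E(5,10)` and its universal enveloping algebra -/

/-- `[X, Y]` for two even elements. -/
def evenEven (X Y : EvenPart) : EvenPart := ⟨vfBracket X Y, vfBracket_mem X.2 Y.2⟩

/-- `[X, f]` for `X` even and `f` odd. -/
def evenOdd (X : EvenPart) (f : OddPart) : OddPart := ⟨lieDer X f, lieDer_mem f.2⟩

/-- `[f, g]` for two odd elements. -/
def oddOdd (f g : OddPart) : EvenPart := ⟨formBracket f g, formBracket_mem f.2 g.2⟩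

/-- The underlying vector space of `L = E(5,10)`. -/
abbrev L : Type := EvenPart × OddPart

/-- An even element of `L`. -/
abbrev ev (X : EvenPart) : L := (X, 0)

/-- An odd element of `L`. -/
abbrev od (f : OddPart) : L := (0, f)

/-- The defining relations `a b - (-1)^{|a||b|} b a = [a, b]` of the universal enveloping algebra,
for homogeneous `a`, `b`. -/
inductive Rel : TensorAlgebra ℂ L → TensorAlgebra ℂ L → Prop
  | even_even (X Y : EvenPart) :
      Rel (TensorAlgebra.ι ℂ (ev X) * TensorAlgebra.ι ℂ (ev Y))
        (TensorAlgebra.ι ℂ (ev Y) * TensorAlgebra.ι ℂ (ev X)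
          + TensorAlgebra.ι ℂ (ev (evenEven X Y)))
  | even_odd (X : EvenPart) (f : OddPart) :
      Rel (TensorAlgebra.ι ℂ (ev X) * TensorAlgebra.ι ℂ (od f))
        (TensorAlgebra.ι ℂ (od f) * TensorAlgebra.ι ℂ (ev X)
          + TensorAlgebra.ι ℂ (od (evenOdd X f)))
  | odd_odd (f g : OddPart) :
      Rel (TensorAlgebra.ι ℂ (od f) * TensorAlgebra.ι ℂ (od g)
          + TensorAlgebra.ι ℂ (od g) * TensorAlgebra.ι ℂ (od f))
        (TensorAlgebra.ι ℂ (ev (oddOdd f g)))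

/-- The universal enveloping algebra `U = U(L)`. -/
def U : Type := RingQuot Rel

instance : Ring U := inferInstanceAs (Ring (RingQuot Rel))

instance : Algebra ℂ U := inferInstanceAs (Algebra ℂ (RingQuot Rel))

/-- The quotient map from the tensor algebra. -/
def mkU : TensorAlgebra ℂ L →ₐ[ℂ] U := RingQuot.mkAlgHom ℂ Rel

/-- The canonical map `L → U`. -/
def ι : L →ₗ[ℂ] U := mkU.toLinearMap ∘ₗ TensorAlgebra.ι ℂ

/-! ## The subalgebras `L_-`, `L_0 ≅ 𝔰𝔩₅` and `L_{≥0}` -/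

/-- The constant vector field `∂_t` as an element of `L_{-2}`. -/
def delField (t : Fin 5) : EvenPart :=
  ⟨fun i => if i = t then 1 else 0, by
    rw [mem_evenPart]
    refine Finset.sum_eq_zero fun i _ => ?_
    split_ifs <;> simp⟩

/-- The constant two-form `d_{P} = dx_i ∧ dx_j`, `P = (i, j)`, as an element of `L_{-1}`. -/
def dForm (P : Fin 5 × Fin 5) : OddPart :=
  ⟨fun a b => (if (a, b) = P then 1 else 0) - (if (b, a) = P then 1 else 0), by
    refine ⟨fun a b => by ring, fun a b c => ?_⟩
    have h : ∀ (i : Fin 5) (p : Prop) [Decidable p], pd i (if p then 1 else 0) = 0 := by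
      intro i p _
      split_ifs <;> simp
    simp only [map_sub, h, sub_zero, add_zero]⟩

/-- `∂_t ∈ U`. -/
def del (t : Fin 5) : U := ι (ev (delField t))

/-- `d_{ij} ∈ U`, for the pair `P = (i, j)`. -/
def dd (P : Fin 5 × Fin 5) : U := ι (od (dForm P))

/-- `U_- = U(L_-)`, as the subalgebra of `U` generated by `L_- = L_{-2} ⊕ L_{-1}`. -/
def Uminus : Subalgebra ℂ U := Algebra.adjoin ℂ (Set.range del ∪ Set.range dd)

/-- The Lie algebra `𝔰𝔩₅`. It is identified with `L_0` by letting the matrix `(A_{ij})` correspond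
to the linear vector field `∑ A_{ij} x_i ∂_j`. -/
abbrev sl5 := LieAlgebra.SpecialLinear.sl (Fin 5) ℂ

theorem sum_diag_eq_zero (A : sl5) : ∑ i, A.1 i i = 0 := by
  have h := A.2
  exact h

/-- The linear vector field `∑ A_{ij} x_i ∂_j` in `L_0`. -/
def slField (A : sl5) : EvenPart :=
  ⟨fun j => ∑ i, A.1 i j • (MvPowerSeries.X i : PS), by
    rw [mem_evenPart]
    have h : ∀ j, pd j (∑ i, A.1 i j • (MvPowerSeries.X i : PS)) = A.1 j j • (1 : PS) := by
      intro j
      rw [map_sum, Finset.sum_eq_single j]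
      · rw [Derivation.map_smul, MvPowerSeries.pderiv_X_self]
      · intro i _ hij
        rw [Derivation.map_smul, MvPowerSeries.pderiv_X_of_ne hij, smul_zero]
      · simp
    simp only [h]
    rw [← Finset.sum_smul, sum_diag_eq_zero, zero_smul]⟩

/-- The element `x_p ∂_q` of `L_0` for `p ≠ q` (only used in this case). -/
def xdel (p q : Fin 5) : sl5 :=
  if h : p ≠ q then LieAlgebra.SpecialLinear.single p q h 1 else 0

/-- The component in `L_0` of an even element: the matrix `(A_{ij})` where `A_{ij}` is the
coefficient of `x_i ∂_j`. -/
def linearPart (X : EvenPart) : sl5 :=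
  ⟨Matrix.of fun i j => MvPowerSeries.coeff (Finsupp.single i 1) (X.1 j), by
    have h := congrArg (MvPowerSeries.coeff 0) (mem_evenPart.mp X.2)
    simp only [map_sum, MvPowerSeries.coeff_pderiv] at h
    refine LinearMap.mem_ker.mpr ?_
    simpa [Matrix.trace] using h⟩

/-- The even elements of `L_{≥0}`: vector fields vanishing at the origin. -/
def EvenNonneg (X : EvenPart) : Prop := ∀ i, MvPowerSeries.constantCoeff (X.1 i) = 0

/-- The odd elements of `L_{≥0}` (hence of `L_+`): closed two-forms vanishing at the origin. -/
def OddNonneg (f : OddPart) : Prop := ∀ i j, MvPowerSeries.constantCoeff (f.1 i j) = 0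

/-! ## Generalized Verma modules -/

section Verma

variable (V : Type*) [AddCommGroup V] [Module ℂ V] [LieRingModule sl5 V] [LieModule ℂ sl5 V]

/-- The `U`-submodule of `U ⊗ V` generated by the elements `z ⊗ v - 1 ⊗ z.v`, `z ∈ L_{≥0}`. Here
`L_0 ≅ 𝔰𝔩₅` acts on `V` in the given way and `L_+` acts by zero. -/
def vermaRel : Submodule U (U ⊗[ℂ] V) :=
  Submodule.span U
    ({w | ∃ (X : EvenPart) (v : V), EvenNonneg X ∧
        w = ι (ev X) ⊗ₜ[ℂ] v - (1 : U) ⊗ₜ[ℂ] ⁅linearPart X, v⁆} ∪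
     {w | ∃ (f : OddPart) (v : V), OddNonneg f ∧ w = ι (od f) ⊗ₜ[ℂ] v})

/-- The generalized Verma module `M(V) = U ⊗_{U(L_{≥0})} V`, a left `U`-module. -/
abbrev Verma := (U ⊗[ℂ] V) ⧸ vermaRel V

variable {V}

/-- The class of `u ⊗ v` in `M(V)`. -/
def Verma.tmul (u : U) (v : V) : Verma V := (vermaRel V).mkQ (u ⊗ₜ[ℂ] v)

variable {W : Type*} [AddCommGroup W] [Module ℂ W] [LieRingModule sl5 W] [LieModule ℂ sl5 W]

/-- `Φ(v) = ∑ u_i ⊗ θ_i(v) ∈ M(W)` for `Φ = ∑ u_i ⊗ θ_i`. -/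
def applyPhi (Φ : U ⊗[ℂ] (V →ₗ[ℂ] W)) (v : V) : Verma W :=
  (vermaRel W).mkQ (LinearMap.lTensor U (LinearMap.applyₗ v) Φ)

/-- `φ : M(V) → M(W)` is the linear map associated with `Φ`: `φ(u ⊗ v) = u Φ(v)` for `u ∈ U_-`. -/
def IsAssociated (φ : Verma V →ₗ[ℂ] Verma W) (Φ : U ⊗[ℂ] (V →ₗ[ℂ] W)) : Prop :=
  ∀ u ∈ Uminus, ∀ v : V, φ (Verma.tmul u v) = u • applyPhi Φ v

/-- `φ` is a morphism of `L`-modules. -/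
def IsMorphism (φ : Verma V →ₗ[ℂ] Verma W) : Prop :=
  ∀ (z : L) (m : Verma V), φ (ι z • m) = ι z • φ m

/-- The action of `x ∈ L_0` on `U ⊗ Hom(V, W)`: `x.(u ⊗ θ) = [x, u] ⊗ θ + u ⊗ x.θ`, where
`(x.θ)(v) = x.(θ(v)) - θ(x.v)`. -/
def L0act (x : sl5) : U ⊗[ℂ] (V →ₗ[ℂ] W) →ₗ[ℂ] U ⊗[ℂ] (V →ₗ[ℂ] W) :=
  TensorProduct.map
    (LinearMap.mulLeft ℂ (ι (ev (slField x))) - LinearMap.mulRight ℂ (ι (ev (slField x))))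
    LinearMap.id +
  TensorProduct.map LinearMap.id (LieModule.toEnd ℂ sl5 (V →ₗ[ℂ] W) x)

end Verma

/-! ## The elements `ω_I` -/

/-- `𝓘_d`: sequences of `d` ordered pairs of indices. -/
abbrev Idx (d : ℕ) : Type := Fin d → Fin 5 × Fin 5

/-- The two-element subsets `{k, l}` of the `d` positions, written as `(k, l)` with `k < l`. -/
def pairsOf (d : ℕ) : Finset (Fin d × Fin d) := Finset.univ.filter fun s => s.1 < s.2

/-- `SIF_d`: sets of pairwise disjoint two-element subsets. -/
def SIF (d : ℕ) : Finset (Finset (Fin d × Fin d)) :=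
  (pairsOf d).powerset.filter fun S => ∀ s ∈ S, ∀ s' ∈ S, s ≠ s' →
    s.1 ≠ s'.1 ∧ s.1 ≠ s'.2 ∧ s.2 ≠ s'.1 ∧ s.2 ≠ s'.2

/-- The crossing number `c(S)`; each crossing pair `k < h < l < m` is counted once. -/
def crossing {d : ℕ} (S : Finset (Fin d × Fin d)) : ℕ :=
  ((S ×ˢ S).filter fun p => p.1.1 < p.2.1 ∧ p.2.1 < p.1.2 ∧ p.1.2 < p.2.2).card

/-- `D_{\{k,l\}}(I) = ½ (-1)^{k+l} ε_{I_k,I_l} ∂_{t_{I_k,I_l}}`. At most one summand is nonzero. -/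
def DPair {d : ℕ} (I : Idx d) (s : Fin d × Fin d) : U :=
  ((1 / 2 : ℂ) * (-1) ^ ((s.1 : ℕ) + (s.2 : ℕ))) •
    ∑ t, eps ![(I s.1).1, (I s.1).2, (I s.2).1, (I s.2).2, t] • del t

/-- `D_S(I)`, the product of the commuting elements `D_s(I)`, `s ∈ S`. -/
def DSet {d : ℕ} (I : Idx d) (S : Finset (Fin d × Fin d)) : U :=
  (S.toList.map (DPair I)).prod

/-- `d_{C_S(I)}`: the ordered product of the `d_{I_j}` over the `j` not covered by `S`. -/
def dRest {d : ℕ} (I : Idx d) (S : Finset (Fin d × Fin d)) : U :=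
  (((List.finRange d).filter fun j => ∀ s ∈ S, j ≠ s.1 ∧ j ≠ s.2).map fun j => dd (I j)).prod

/-- `ω_I = ∑_{S ∈ SIF_d} (-1)^{c(S)} D_S(I) d_{C_S(I)}`. -/
def omega {d : ℕ} (I : Idx d) : U :=
  ∑ S ∈ SIF d, (-1 : ℂ) ^ crossing S • (DSet I S * dRest I S)

/-- The action of the signed permutation `(η, σ) ∈ B_d` on `𝓘_d`. -/
def signedPerm {d : ℕ} (η : Fin d → ℤˣ) (σ : Equiv.Perm (Fin d)) (I : Idx d) : Idx d :=
  fun j => if η j = 1 then I (σ j) else (I (σ j)).swap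

/-- `θ_{g(I)} = (-1)^{ℓ(g)} θ_I` for all `g = (η, σ) ∈ B_d`. The character `(-1)^ℓ`, which is `-1`
on each Coxeter generator, is `sign σ · ∏ η_j`. -/
def IsAlternating {d : ℕ} {A : Type*} [AddCommGroup A] (θ : Idx d → A) : Prop :=
  ∀ (η : Fin d → ℤˣ) (σ : Equiv.Perm (Fin d)) (I : Idx d),
    θ (signedPerm η σ I) = ((Equiv.Perm.sign σ * ∏ j, η j : ℤˣ) : ℤ) • θ I

/-- Representatives of the `B_d`-orbits on `𝓘_d`: strictly increasing sequences of pairs `(i, j)`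
with `i < j`. The orbits without such a representative are those of the `I` that contain a pair
`(i, i)` or two pairs equal up to reversal; on these, alternating families vanish. -/
def orbitReps (d : ℕ) : Finset (Idx d) :=
  Finset.univ.filter fun I =>
    (∀ l, (I l).1 < (I l).2) ∧ ∀ l m, l < m → toLex (I l) < toLex (I m)

section Degree3

variable {V : Type*} [AddCommGroup V] [Module ℂ V]
variable {W : Type*} [AddCommGroup W] [Module ℂ W]

/-- `Φ = ∑_{I ∈ 𝓘_3/B_3} ω_I ⊗ θ_I + ∑_t ∑_{I ∈ 𝓘_1/B_1} ∂_t ω_I ⊗ θ^t_I`. -/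
def Phi3 (θ : Idx 3 → (V →ₗ[ℂ] W)) (θ' : Fin 5 → Idx 1 → (V →ₗ[ℂ] W)) :
    U ⊗[ℂ] (V →ₗ[ℂ] W) :=
  ∑ I ∈ orbitReps 3, omega I ⊗ₜ[ℂ] θ I +
    ∑ t, ∑ I ∈ orbitReps 1, (del t * omega I) ⊗ₜ[ℂ] θ' t I

end Degree3

/-- The signed indicator of `P ∈ B_1 Q`: `1` if `P = Q`, `-1` if `P` is the reversal of `Q`, and `0`
otherwise (for `Q = (p, q)` with `p ≠ q`). -/
def chi (Q P : Fin 5 × Fin 5) : ℂ := if P = Q then 1 else if P = Q.swap then -1 else 0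

/-- `C(a, b, c)`: the cyclic permutations of the triple. -/
def cyc (a b c : Fin 5) : Finset (Fin 5 × Fin 5 × Fin 5) := {(a, b, c), (b, c, a), (c, a, b)}

end

end E510

set_option maxSynthPendingDepth 3
set_option linter.unusedSectionVars false

open scoped TensorProduct

namespace E510

noncomputable section

/-! ## Symmetries of `ε` -/

/-! By Frobenius reciprocity, `φ` is a morphism exactly when `L_{≥0}` acts on the vectors `Φ(v)` as
it acts on `v`: `L_0` through its action on `V`, and `L_+` by zero (`isMorphism_iff`). The
`L_0`-part of this is the invariance of `Φ`, so what remains is that `L_+` kills every `Φ(v)`.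

This in turn only has to be tested on the forms `x_p d_{pq}` (`Lplus_smul_applyPhi`). The
annihilator of the family `Φ(v)` in `L` is stable under brackets and under `L_0`. Applying `x_a ∂_p`
to the forms `x_p d_{pq}` yields all closed forms with linear coefficients; brackets of these give
the quadratic divergence-free fields, and a further bracket gives the closed forms with quadratic
coefficients. Fields and forms vanishing to order three have degree at least 4, hence kill `Φ(v)`,
which sits in degree -3 of a module with no positive degrees.

The action of `z = x_p d_{pq}` on `Φ(v)` is computed after rewriting the vector as a sum over all
sequences of pairs: `ω_I` is the antisymmetrization of `d_I`, so 48 = |B_3| times `Φ(v)` is a plain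
alternating sum (`phiSum_eq`). Moving `z` to the right, each bracket `[z, d_P]` is a combination of
the fields `x_p ∂_γ` in `L_0`, and `[z, ∂_p]` is `-d_{pq}`. The result is a combination of `d_Q d_R`
and of `∂_t`. Since `d_Q d_R + d_R d_Q` lies in the span of the `∂_t`, the coefficients become
unique only after antisymmetrization in `Q, R`. The antisymmetric coefficient is 6 times the first
equation (`zCoefTwo_antisymm`); the coefficient of `∂_t` is a nonzero multiple of the third equation
for `t = p`, the fourth for `t = q`, and the second for the three other values of `t`
(`zCoefOne_fst`, `zCoefOne_snd`, `zCoefOne_ne`). Invariance of `Φ`, written on coefficients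
(`invariance`), brings these to the stated form.

Comparing coefficients requires linear independence in `M(W)`. For this an action of `L` on `U(L_-)
⊗ W` is constructed by hand. Requiring that `L_-` act by left multiplication and `L_{≥0}` act on `1
⊗ W` as prescribed forces how each element passes a generator, and `commRel` checks the commutation
relations by induction from the Jacobi identities. This gives a map from `M(W)` to `U(L_-) ⊗ W`.
Next, `U(L_-)` maps to a Clifford algebra over `ℂ[∂_1, …, ∂_5]`, where contractions with coordinate
functions read off the coefficients (`cl_indep_two`, `cl_indep_three`). -/

theorem sign_sub_swap (a b : ℤ) : Int.sign (a - b) = - Int.sign (b - a) := by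
  rw [← Int.sign_neg, neg_sub]

theorem eps_swap01 (a b c d e : Fin 5) : eps ![b, a, c, d, e] = - eps ![a, b, c, d, e] := by
  rw [eps_eq, eps_eq, sign_sub_swap a b]; ring

theorem eps_swap12 (a b c d e : Fin 5) : eps ![a, c, b, d, e] = - eps ![a, b, c, d, e] := by
  rw [eps_eq, eps_eq, sign_sub_swap b c]; ring

theorem eps_swap23 (a b c d e : Fin 5) : eps ![a, b, d, c, e] = - eps ![a, b, c, d, e] := by
  rw [eps_eq, eps_eq, sign_sub_swap c d]; ring

theorem eps_swap34 (a b c d e : Fin 5) : eps ![a, b, c, e, d] = - eps ![a, b, c, d, e] := by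
  rw [eps_eq, eps_eq, sign_sub_swap d e]; ring

theorem eps_swap02 (a b c d e : Fin 5) : eps ![c, b, a, d, e] = - eps ![a, b, c, d, e] := by
  rw [eps_swap01, eps_swap12, eps_swap01]; ring

theorem eps_swap13 (a b c d e : Fin 5) : eps ![a, d, c, b, e] = - eps ![a, b, c, d, e] := by
  rw [eps_swap12, eps_swap23, eps_swap12]; ring

theorem eps_swap24 (a b c d e : Fin 5) : eps ![a, b, e, d, c] = - eps ![a, b, c, d, e] := by
  rw [eps_swap23, eps_swap34, eps_swap23]; ring

theorem eps_swap03 (a b c d e : Fin 5) : eps ![d, b, c, a, e] = - eps ![a, b, c, d, e] := by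
  rw [eps_swap01, eps_swap13, eps_swap01]; ring

theorem eps_swap14 (a b c d e : Fin 5) : eps ![a, e, c, d, b] = - eps ![a, b, c, d, e] := by
  rw [eps_swap12, eps_swap24, eps_swap12]; ring

theorem eps_swap04 (a b c d e : Fin 5) : eps ![e, b, c, d, a] = - eps ![a, b, c, d, e] := by
  rw [eps_swap01, eps_swap14, eps_swap01]; ring

@[simp] theorem eps_eq01 (a c d e : Fin 5) : eps ![a, a, c, d, e] = 0 := by rw [eps_eq]; simp
@[simp] theorem eps_eq02 (a b d e : Fin 5) : eps ![a, b, a, d, e] = 0 := by rw [eps_eq]; simp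
@[simp] theorem eps_eq03 (a b c e : Fin 5) : eps ![a, b, c, a, e] = 0 := by rw [eps_eq]; simp
@[simp] theorem eps_eq04 (a b c d : Fin 5) : eps ![a, b, c, d, a] = 0 := by rw [eps_eq]; simp
@[simp] theorem eps_eq12 (a b d e : Fin 5) : eps ![a, b, b, d, e] = 0 := by rw [eps_eq]; simp
@[simp] theorem eps_eq13 (a b c e : Fin 5) : eps ![a, b, c, b, e] = 0 := by rw [eps_eq]; simp
@[simp] theorem eps_eq14 (a b c d : Fin 5) : eps ![a, b, c, d, b] = 0 := by rw [eps_eq]; simp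
@[simp] theorem eps_eq23 (a b c e : Fin 5) : eps ![a, b, c, c, e] = 0 := by rw [eps_eq]; simp
@[simp] theorem eps_eq24 (a b c d : Fin 5) : eps ![a, b, c, d, c] = 0 := by rw [eps_eq]; simp
@[simp] theorem eps_eq34 (a b c d : Fin 5) : eps ![a, b, c, d, d] = 0 := by rw [eps_eq]; simp

/-- A sum over the five indices, listed in an arbitrary order. -/
theorem sum_of_nodup {M : Type*} [AddCommMonoid M] {p q a b c : Fin 5}
    (h : [p, q, a, b, c].Nodup) (f : Fin 5 → M) : ∑ x, f x = f p + f q + f a + f b + f c := by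
  have hu : [p, q, a, b, c].toFinset = Finset.univ := by
    apply Finset.eq_univ_of_card
    rw [List.toFinset_card_of_nodup h]
    rfl
  rw [← hu, List.sum_toFinset f h]
  simp [add_assoc]

/-- The derivation of the determinant form induced by a matrix `A` is multiplication by the
trace of `A`. -/
theorem eps_trace {R : Type*} [CommRing R] (A : Fin 5 → Fin 5 → R) (i j k l t : Fin 5) :
    ∑ m, (A i m * (eps ![m, j, k, l, t] : R) + A j m * (eps ![i, m, k, l, t] : R)
      + A k m * (eps ![i, j, m, l, t] : R) + A l m * (eps ![i, j, k, m, t] : R)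
      + A t m * (eps ![i, j, k, l, m] : R)) = (∑ m, A m m) * (eps ![i, j, k, l, t] : R) := by
  -- For distinct indices only the replacement of an index by itself survives, which gives the
  -- trace. If two indices coincide the right side is zero, and on the left the two replacements at
  -- the equal positions cancel because they differ by a transposition.
  by_cases h : [i, j, k, l, t].Nodup
  · rw [sum_of_nodup h, sum_of_nodup h]
    simp
    ring
  · have h' : i = j ∨ i = k ∨ i = l ∨ i = t ∨ j = k ∨ j = l ∨ j = t ∨ k = l ∨ k = t ∨ l = t := by
      simp at h; tauto
    have key : ∀ x y : ℤ, ∀ r : R, y = -x → r * (x : R) + r * (y : R) = 0 := by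
      rintro x y r rfl; push_cast; ring
    rcases h' with rfl | rfl | rfl | rfl | rfl | rfl | rfl | rfl | rfl | rfl <;> simp <;>
      refine Finset.sum_eq_zero fun m _ => key _ _ _ ?_
    · exact eps_swap01 _ _ _ _ _
    · exact eps_swap02 _ _ _ _ _
    · exact eps_swap03 _ _ _ _ _
    · exact eps_swap04 _ _ _ _ _
    · exact eps_swap12 _ _ _ _ _
    · exact eps_swap13 _ _ _ _ _
    · exact eps_swap14 _ _ _ _ _
    · exact eps_swap23 _ _ _ _ _
    · exact eps_swap24 _ _ _ _ _
    · exact eps_swap34 _ _ _ _ _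

/-! ## The Jacobi identities -/

theorem lieDer_vfBracket (X Y : Fin 5 → PS) (f : Fin 5 → Fin 5 → PS) :
    lieDer (vfBracket X Y) f = lieDer X (lieDer Y f) - lieDer Y (lieDer X f) := by
  funext i j
  simp only [lieDer, vfBracket, Pi.sub_apply, map_add, map_sub, Derivation.leibniz,
    smul_eq_mul, Fin.sum_univ_five, pd_comm i, pd_comm j]
  simp only [pd_comm]
  ring


/-! ### Relabelling of fivefold sums -/

section SumSwap

variable {M : Type*} [AddCommMonoid M] (F : Fin 5 → Fin 5 → Fin 5 → Fin 5 → Fin 5 → M)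

theorem sum_swap04 : ∑ i, ∑ j, ∑ k, ∑ l, ∑ m, F i j k l m =
    ∑ i, ∑ j, ∑ k, ∑ l, ∑ m, F m j k l i := by
  have h := Fintype.sum_equiv
    (⟨fun x => (x.2.2.2.2, x.2.1, x.2.2.1, x.2.2.2.1, x.1),
      fun x => (x.2.2.2.2, x.2.1, x.2.2.1, x.2.2.2.1, x.1), fun _ => rfl, fun _ => rfl⟩ :
      Fin 5 × Fin 5 × Fin 5 × Fin 5 × Fin 5 ≃ Fin 5 × Fin 5 × Fin 5 × Fin 5 × Fin 5)
    (fun x => F x.1 x.2.1 x.2.2.1 x.2.2.2.1 x.2.2.2.2)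
    (fun x => F x.2.2.2.2 x.2.1 x.2.2.1 x.2.2.2.1 x.1) (fun _ => rfl)
  simpa only [Fintype.sum_prod_type] using h

theorem sum_swap14 : ∑ i, ∑ j, ∑ k, ∑ l, ∑ m, F i j k l m =
    ∑ i, ∑ j, ∑ k, ∑ l, ∑ m, F i m k l j := by
  have h := Fintype.sum_equiv
    (⟨fun x => (x.1, x.2.2.2.2, x.2.2.1, x.2.2.2.1, x.2.1),
      fun x => (x.1, x.2.2.2.2, x.2.2.1, x.2.2.2.1, x.2.1), fun _ => rfl, fun _ => rfl⟩ :
      Fin 5 × Fin 5 × Fin 5 × Fin 5 × Fin 5 ≃ Fin 5 × Fin 5 × Fin 5 × Fin 5 × Fin 5)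
    (fun x => F x.1 x.2.1 x.2.2.1 x.2.2.2.1 x.2.2.2.2)
    (fun x => F x.1 x.2.2.2.2 x.2.2.1 x.2.2.2.1 x.2.1) (fun _ => rfl)
  simpa only [Fintype.sum_prod_type] using h

theorem sum_swap24 : ∑ i, ∑ j, ∑ k, ∑ l, ∑ m, F i j k l m = ∑ i, ∑ j, ∑ k, ∑ l, ∑ m, F i j m l k :=
  Finset.sum_congr rfl fun i _ => Finset.sum_congr rfl fun j _ => by
    rw [Finset.sum_comm]
    conv_rhs => rw [Finset.sum_comm]
    exact Finset.sum_congr rfl fun l _ => Finset.sum_comm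

theorem sum_swap34 : ∑ i, ∑ j, ∑ k, ∑ l, ∑ m, F i j k l m = ∑ i, ∑ j, ∑ k, ∑ l, ∑ m, F i j k m l :=
  Finset.sum_congr rfl fun _ _ => Finset.sum_congr rfl fun _ _ => Finset.sum_congr rfl fun _ _ =>
    Finset.sum_comm

end SumSwap

theorem formBracket_apply (f g : Fin 5 → Fin 5 → PS) (t : Fin 5) : formBracket f g t =
    (1 / 4 : ℂ) • ∑ i, ∑ j, ∑ k, ∑ l, (eps ![i, j, k, l, t] : PS) * (f i j * g k l) := by
  simp only [formBracket, zsmul_eq_mul]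

theorem formBracket_comm (f g : Fin 5 → Fin 5 → PS) : formBracket f g = formBracket g f := by
  funext t
  rw [formBracket_apply, formBracket_apply, sum_pairs_comm]
  simp only [mul_comm (f _ _), eps_swap]

theorem pd_intCast (i : Fin 5) (n : ℤ) : pd i (n : PS) = 0 := by
  exact Derivation.map_intCast _ n

theorem vfBracket_formBracket (X : Fin 5 → PS) (f g : Fin 5 → Fin 5 → PS) (t : Fin 5) :
    vfBracket X (formBracket f g) t = (1 / 4 : ℂ) • (∑ i, ∑ j, ∑ k, ∑ l, ∑ m,
      (X m * ((eps ![i, j, k, l, t] : PS) * (pd m (f i j) * g k l))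
      + X m * ((eps ![i, j, k, l, t] : PS) * (f i j * pd m (g k l)))
      - pd m (X t) * (eps ![i, j, k, l, m] : PS) * (f i j * g k l))) := by
  have : ∀ F : Fin 5 → Fin 5 → Fin 5 → Fin 5 → Fin 5 → PS, ∑ i, ∑ j, ∑ k, ∑ l, ∑ m, F i j k l m
      = ∑ m, ∑ i, ∑ j, ∑ k, ∑ l, F i j k l m := by
    intro F
    simp only [fun i j k => Finset.sum_comm (s := Finset.univ) (t := Finset.univ) (f := F i j k)]
    simp only [fun i j => Finset.sum_comm (s := Finset.univ) (t := Finset.univ)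
      (f := fun k m => ∑ l, F i j k l m)]
    simp only [fun i => Finset.sum_comm (s := Finset.univ) (t := Finset.univ)
      (f := fun j m => ∑ k, ∑ l, F i j k l m)]
    rw [Finset.sum_comm]
  rw [this, Finset.smul_sum, vfBracket]
  refine Finset.sum_congr rfl fun m _ => ?_
  simp only [formBracket_apply, Derivation.map_smul, map_sum, Derivation.leibniz, smul_eq_mul,
    pd_intCast, mul_zero, add_zero, mul_smul_comm, smul_mul_assoc, Finset.mul_sum, Finset.sum_mul,
    ← smul_sub, ← Finset.sum_sub_distrib]
  refine congrArg _ ?_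
  refine Finset.sum_congr rfl fun i _ => Finset.sum_congr rfl fun j _ =>
    Finset.sum_congr rfl fun k _ => Finset.sum_congr rfl fun l _ => ?_
  ring

theorem formBracket_lieDer_add (X : Fin 5 → PS) (f g : Fin 5 → Fin 5 → PS) (t : Fin 5) :
    formBracket (lieDer X f) g t + formBracket f (lieDer X g) t =
      (1 / 4 : ℂ) • (∑ i, ∑ j, ∑ k, ∑ l, ∑ m,
      (X m * ((eps ![i, j, k, l, t] : PS) * (pd m (f i j) * g k l))
      + X m * ((eps ![i, j, k, l, t] : PS) * (f i j * pd m (g k l)))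
      + pd i (X m) * (eps ![i, j, k, l, t] : PS) * (f m j * g k l)
      + pd j (X m) * (eps ![i, j, k, l, t] : PS) * (f i m * g k l)
      + pd k (X m) * (eps ![i, j, k, l, t] : PS) * (f i j * g m l)
      + pd l (X m) * (eps ![i, j, k, l, t] : PS) * (f i j * g k m))) := by
  rw [formBracket_apply, formBracket_apply, ← smul_add]
  refine congrArg _ ?_
  simp only [← Finset.sum_add_distrib]
  refine Finset.sum_congr rfl fun i _ => Finset.sum_congr rfl fun j _ =>
    Finset.sum_congr rfl fun k _ => Finset.sum_congr rfl fun l _ => ?_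
  simp only [lieDer, Finset.mul_sum, Finset.sum_mul, ← Finset.sum_add_distrib]
  refine Finset.sum_congr rfl fun m _ => ?_
  ring

/-- The bracket of forms is contraction with `ε`. The Jacobian of `X` acts on `ε` through its trace
by `eps_trace`, and the trace is the divergence of `X`, which is zero. So `ε` is invariant under
`X`, and the Leibniz rule is all that remains. -/
theorem formBracket_lieDer {X : Fin 5 → PS} (hX : X ∈ EvenPart) (f g : Fin 5 → Fin 5 → PS) :
    vfBracket X (formBracket f g) = formBracket (lieDer X f) g + formBracket f (lieDer X g) := by
  rw [mem_evenPart] at hX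
  funext t
  have key := fun i j k l => eps_trace (fun i m => pd m (X i)) i j k l t
  simp only [hX, zero_mul] at key
  have key' : ∑ i, ∑ j, ∑ k, ∑ l, ∑ m, (pd m (X i) * (eps ![m, j, k, l, t] : PS)
      + pd m (X j) * (eps ![i, m, k, l, t] : PS)
      + pd m (X k) * (eps ![i, j, m, l, t] : PS) + pd m (X l) * (eps ![i, j, k, m, t] : PS)
      + pd m (X t) * (eps ![i, j, k, l, m] : PS)) * (f i j * g k l) = 0 := by
    simp only [← Finset.sum_mul, key, zero_mul, Finset.sum_const_zero]
  simp only [add_mul, Finset.sum_add_distrib] at key'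
  rw [sum_swap04 fun i j k l m => pd m (X i) * (eps ![m, j, k, l, t] : PS) * (f i j * g k l),
    sum_swap14 fun i j k l m => pd m (X j) * (eps ![i, m, k, l, t] : PS) * (f i j * g k l),
    sum_swap24 fun i j k l m => pd m (X k) * (eps ![i, j, m, l, t] : PS) * (f i j * g k l),
    sum_swap34 fun i j k l m => pd m (X l) * (eps ![i, j, k, m, t] : PS) * (f i j * g k l)] at key'
  rw [Pi.add_apply, vfBracket_formBracket, formBracket_lieDer_add]
  refine congrArg _ ?_
  rw [← sub_eq_zero]
  simp only [Finset.sum_add_distrib, Finset.sum_sub_distrib] at key' ⊢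
  linear_combination -key'


/-- A Schouten identity: antisymmetrizing over six indices in dimension five gives zero. It comes
from `eps_trace`, and the antisymmetry of `f` and `g` merges the four resulting sums into two. -/
theorem eps_schouten {f g h : Fin 5 → Fin 5 → PS} (hf : ∀ i j, f i j = -f j i)
    (hg : ∀ i j, g i j = -g j i) (hh : ∀ i j, h i j = -h j i) (s : Fin 5) :
    ∑ i, ∑ j, ∑ k, ∑ l, ∑ t, (eps ![i, j, k, l, t] : PS) * (f i j * g k l) * h t s =
      (2 * ∑ i, ∑ j, ∑ k, ∑ l, ∑ t, (eps ![s, j, k, l, t] : PS) * (f i j * h t i * g k l)) +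
      2 * ∑ i, ∑ j, ∑ k, ∑ l, ∑ t, (eps ![s, j, k, l, t] : PS) * (g i j * h t i * f k l) := by
  have h0 : ∀ i, h i i = 0 := fun i => by
    have h2 : (2 : ℂ) • h i i = 0 := by
      rw [two_smul]; exact add_eq_zero_iff_eq_neg.mpr (hh i i)
    exact (smul_eq_zero.mp h2).resolve_left two_ne_zero
  have key : ∀ i j k l t, (eps ![i, j, k, l, t] : PS) * (f i j * g k l) * h t s =
      (eps ![s, j, k, l, t] : PS) * (f i j * h t i * g k l)
      + (eps ![i, s, k, l, t] : PS) * (f i j * h t j * g k l)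
      + (eps ![i, j, s, l, t] : PS) * (f i j * h t k * g k l)
      + (eps ![i, j, k, s, t] : PS) * (f i j * h t l * g k l) := by
    intro i j k l t
    -- This matrix has the single nonzero column `s`, filled with `h t x`. Its trace is `h t s`, and
    -- the replacement at the position of `t` contributes `h t t = 0`.
    have := eps_trace (fun x m => if m = s then h t x else 0) i j k l t
    simp only [ite_mul, zero_mul, Finset.sum_add_distrib, Finset.sum_ite_eq', Finset.mem_univ,
      if_true, h0] at this
    linear_combination (-(f i j * g k l)) * this
  simp only [key, Finset.sum_add_distrib]
  have e1 : ∑ i, ∑ j, ∑ k, ∑ l, ∑ t, (eps ![i, s, k, l, t] : PS) * (f i j * h t j * g k l) =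
      ∑ i, ∑ j, ∑ k, ∑ l, ∑ t, (eps ![s, j, k, l, t] : PS) * (f i j * h t i * g k l) := by
    rw [Finset.sum_comm]
    refine Finset.sum_congr rfl fun i _ => Finset.sum_congr rfl fun j _ =>
      Finset.sum_congr rfl fun k _ => Finset.sum_congr rfl fun l _ =>
      Finset.sum_congr rfl fun t _ => ?_
    rw [hf j i, eps_swap01]; push_cast; ring
  have e3 : ∑ i, ∑ j, ∑ k, ∑ l, ∑ t, (eps ![i, j, s, l, t] : PS) * (f i j * h t k * g k l) =
      ∑ i, ∑ j, ∑ k, ∑ l, ∑ t, (eps ![s, j, k, l, t] : PS) * (g i j * h t i * f k l) := by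
    rw [sum_pairs_comm fun i j k l => ∑ t, (eps ![i, j, s, l, t] : PS) * (f i j * h t k * g k l)]
    refine Finset.sum_congr rfl fun i _ => Finset.sum_congr rfl fun j _ =>
      Finset.sum_congr rfl fun k _ => Finset.sum_congr rfl fun l _ =>
      Finset.sum_congr rfl fun t _ => ?_
    rw [eps_swap]; ring
  have e4 : ∑ i, ∑ j, ∑ k, ∑ l, ∑ t, (eps ![i, j, k, s, t] : PS) * (f i j * h t l * g k l) =
      ∑ i, ∑ j, ∑ k, ∑ l, ∑ t, (eps ![i, j, s, l, t] : PS) * (f i j * h t k * g k l) := by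
    refine Finset.sum_congr rfl fun i _ => Finset.sum_congr rfl fun j _ => ?_
    rw [Finset.sum_comm]
    refine Finset.sum_congr rfl fun k _ => Finset.sum_congr rfl fun l _ =>
      Finset.sum_congr rfl fun t _ => ?_
    rw [hg l k, eps_swap23]; push_cast; ring
  rw [e4, e3, e1]
  ring

theorem sum_eps_antisymm {f h : Fin 5 → Fin 5 → PS} (hf : ∀ i j, f i j = -f j i)
    (hh : ∀ i j, h i j = -h j i) (g : Fin 5 → Fin 5 → PS) (s : Fin 5) :
    ∑ i, ∑ j, ∑ k, ∑ l, ∑ t, (eps ![s, j, k, l, t] : PS) * (h i j * f t i * g k l) =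
      -∑ i, ∑ j, ∑ k, ∑ l, ∑ t, (eps ![s, j, k, l, t] : PS) * (f i j * h t i * g k l) := by
  rw [sum_swap14]
  simp only [← Finset.sum_neg_distrib]
  refine Finset.sum_congr rfl fun i _ => Finset.sum_congr rfl fun j _ =>
    Finset.sum_congr rfl fun k _ => Finset.sum_congr rfl fun l _ =>
    Finset.sum_congr rfl fun t _ => ?_
  rw [hh i t, hf j i, eps_swap14]; push_cast; ring

/-- The contraction of `f ∧ g` with `h`, summed cyclically, vanishes. -/
theorem formBracket_contract {f g h : Fin 5 → Fin 5 → PS} (hf : ∀ i j, f i j = -f j i)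
    (hg : ∀ i j, g i j = -g j i) (hh : ∀ i j, h i j = -h j i) (s : Fin 5) :
    ∑ t, formBracket f g t * h t s + ∑ t, formBracket g h t * f t s
      + ∑ t, formBracket h f t * g t s = 0 := by
  have e : ∀ f g h : Fin 5 → Fin 5 → PS, ∑ t, formBracket f g t * h t s = (1 / 4 : ℂ) •
      ∑ i, ∑ j, ∑ k, ∑ l, ∑ t, (eps ![i, j, k, l, t] : PS) * (f i j * g k l) * h t s := by
    intro f g h
    simp only [formBracket_apply, smul_mul_assoc, ← Finset.smul_sum, Finset.sum_mul]
    refine congrArg _ ?_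
    rw [Finset.sum_comm]
    refine Finset.sum_congr rfl fun i _ => ?_
    rw [Finset.sum_comm]
    refine Finset.sum_congr rfl fun j _ => ?_
    rw [Finset.sum_comm]
    refine Finset.sum_congr rfl fun k _ => ?_
    rw [Finset.sum_comm]
  -- Each contraction splits into two sums in which two of the forms share an index. Those sums
  -- change sign when the two forms are exchanged, so the six of them cancel in pairs.
  rw [e, e, e, ← smul_add, ← smul_add, eps_schouten hf hg hh, eps_schouten hg hh hf,
    eps_schouten hh hf hg, sum_eps_antisymm hf hh, sum_eps_antisymm hg hf, sum_eps_antisymm hg hh]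
  simp only [smul_eq_zero]
  right
  ring

/-- Cartan's formula: on a closed form the Lie derivative is the differential of the contraction. -/
theorem lieDer_eq_contract {f : Fin 5 → Fin 5 → PS} (hf : f ∈ OddPart) (X : Fin 5 → PS)
    (i j : Fin 5) :
    lieDer X f i j = pd i (∑ k, X k * f k j) - pd j (∑ k, X k * f k i) := by
  obtain ⟨ha, hc⟩ := hf
  rw [lieDer, map_sum, map_sum, ← Finset.sum_sub_distrib]
  refine Finset.sum_congr rfl fun k _ => ?_
  rw [Derivation.leibniz, Derivation.leibniz]
  simp only [smul_eq_mul]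
  have h1 := hc i j k
  have h2 : pd i (f k j) = - pd i (f j k) := by rw [ha k j, map_neg]
  rw [ha i k, h2]
  linear_combination X k * h1

/-- The Jacobi identity for three odd elements. By Cartan's formula the left side is the
differential of the cyclic sum of contractions, which vanishes by `formBracket_contract`. -/
theorem lieDer_formBracket {f g h : Fin 5 → Fin 5 → PS} (hf : f ∈ OddPart) (hg : g ∈ OddPart)
    (hh : h ∈ OddPart) : lieDer (formBracket f g) h + lieDer (formBracket g h) f
      + lieDer (formBracket h f) g = 0 := by
  funext i j
  have h1 := congrArg (pd i) (formBracket_contract hf.1 hg.1 hh.1 j)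
  have h2 := congrArg (pd j) (formBracket_contract hf.1 hg.1 hh.1 i)
  rw [map_zero, map_add, map_add] at h1 h2
  rw [Pi.add_apply, Pi.add_apply, Pi.add_apply, Pi.add_apply, lieDer_eq_contract hf,
    lieDer_eq_contract hg, lieDer_eq_contract hh, Pi.zero_apply, Pi.zero_apply]
  linear_combination h1 - h2

/-! ## The bracket as bilinear maps -/

theorem lieDer_add_left (X Y : Fin 5 → PS) (f : Fin 5 → Fin 5 → PS) :
    lieDer (X + Y) f = lieDer X f + lieDer Y f := by
  funext i j
  simp only [lieDer, Pi.add_apply, map_add, ← Finset.sum_add_distrib]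
  exact Finset.sum_congr rfl fun k _ => by ring

theorem lieDer_smul_left (c : ℂ) (X : Fin 5 → PS) (f : Fin 5 → Fin 5 → PS) :
    lieDer (c • X) f = c • lieDer X f := by
  funext i j
  simp only [lieDer, Pi.smul_apply, Derivation.map_smul, Finset.smul_sum, smul_add, smul_mul_assoc]

theorem lieDer_add_right (X : Fin 5 → PS) (f g : Fin 5 → Fin 5 → PS) :
    lieDer X (f + g) = lieDer X f + lieDer X g := by
  funext i j
  simp only [lieDer, Pi.add_apply, map_add, ← Finset.sum_add_distrib]
  exact Finset.sum_congr rfl fun k _ => by ring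

theorem lieDer_smul_right (c : ℂ) (X : Fin 5 → PS) (f : Fin 5 → Fin 5 → PS) :
    lieDer X (c • f) = c • lieDer X f := by
  funext i j
  simp only [lieDer, Pi.smul_apply, Derivation.map_smul, Finset.smul_sum, smul_add, mul_smul_comm]

theorem vfBracket_add_left (X Y Z : Fin 5 → PS) :
    vfBracket (X + Y) Z = vfBracket X Z + vfBracket Y Z := by
  funext i
  simp only [vfBracket, Pi.add_apply, map_add, ← Finset.sum_add_distrib]
  exact Finset.sum_congr rfl fun k _ => by ring

theorem vfBracket_smul_left (c : ℂ) (X Y : Fin 5 → PS) :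
    vfBracket (c • X) Y = c • vfBracket X Y := by
  funext i
  simp only [vfBracket, Pi.smul_apply, Derivation.map_smul, Finset.smul_sum, smul_sub,
    mul_smul_comm, smul_mul_assoc]

theorem vfBracket_neg (X Y : Fin 5 → PS) : vfBracket X Y = -vfBracket Y X := by
  funext i
  simp only [vfBracket, Pi.neg_apply, ← Finset.sum_neg_distrib]
  exact Finset.sum_congr rfl fun k _ => by ring

theorem formBracket_add_left (f g h : Fin 5 → Fin 5 → PS) :
    formBracket (f + g) h = formBracket f h + formBracket g h := by
  funext t
  simp only [formBracket_apply, Pi.add_apply, add_mul, mul_add, Finset.sum_add_distrib, smul_add]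

theorem formBracket_smul_left (c : ℂ) (f h : Fin 5 → Fin 5 → PS) :
    formBracket (c • f) h = c • formBracket f h := by
  funext t
  simp only [formBracket_apply, Pi.smul_apply, smul_mul_assoc, mul_smul_comm, ← Finset.smul_sum]
  rw [smul_comm]

/-- The bracket `[X, Y]` of even elements, as a bilinear map. -/
def evenEvenL : EvenPart →ₗ[ℂ] EvenPart →ₗ[ℂ] EvenPart :=
  LinearMap.mk₂ ℂ evenEven
    (fun X Y Z => Subtype.ext (vfBracket_add_left X.1 Y.1 Z.1))
    (fun c X Y => Subtype.ext (vfBracket_smul_left c X.1 Y.1))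
    (fun X Y Z => Subtype.ext (by
      change vfBracket X.1 (Y.1 + Z.1) = vfBracket X.1 Y.1 + vfBracket X.1 Z.1
      rw [vfBracket_neg, vfBracket_add_left, vfBracket_neg X.1 Y.1, vfBracket_neg X.1 Z.1,
        neg_add]))
    (fun c X Y => Subtype.ext (by
      change vfBracket X.1 (c • Y.1) = c • vfBracket X.1 Y.1
      rw [vfBracket_neg, vfBracket_smul_left, vfBracket_neg X.1 Y.1, smul_neg]))

/-- The bracket `[X, f]` of an even and an odd element, as a bilinear map. -/
def evenOddL : EvenPart →ₗ[ℂ] OddPart →ₗ[ℂ] OddPart :=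
  LinearMap.mk₂ ℂ evenOdd
    (fun X Y f => Subtype.ext (lieDer_add_left X.1 Y.1 f.1))
    (fun c X f => Subtype.ext (lieDer_smul_left c X.1 f.1))
    (fun X f g => Subtype.ext (lieDer_add_right X.1 f.1 g.1))
    (fun c X f => Subtype.ext (lieDer_smul_right c X.1 f.1))

/-- The bracket `[f, g]` of odd elements, as a bilinear map. -/
def oddOddL : OddPart →ₗ[ℂ] OddPart →ₗ[ℂ] EvenPart :=
  LinearMap.mk₂ ℂ oddOdd
    (fun f g h => Subtype.ext (formBracket_add_left f.1 g.1 h.1))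
    (fun c f g => Subtype.ext (formBracket_smul_left c f.1 g.1))
    (fun f g h => Subtype.ext (by
      change formBracket f.1 (g.1 + h.1) = formBracket f.1 g.1 + formBracket f.1 h.1
      rw [formBracket_comm, formBracket_add_left, formBracket_comm f.1 g.1,
        formBracket_comm f.1 h.1]))
    (fun c f g => Subtype.ext (by
      change formBracket f.1 (c • g.1) = c • formBracket f.1 g.1
      rw [formBracket_comm, formBracket_smul_left, formBracket_comm f.1 g.1]))

theorem evenEvenL_apply (X Y : EvenPart) : evenEvenL X Y = evenEven X Y := rfl
theorem evenOddL_apply (X : EvenPart) (f : OddPart) : evenOddL X f = evenOdd X f := rfl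
theorem oddOddL_apply (f g : OddPart) : oddOddL f g = oddOdd f g := rfl

theorem evenEvenL_neg (X Y : EvenPart) : evenEvenL X Y = -evenEvenL Y X :=
  Subtype.ext (vfBracket_neg X.1 Y.1)

theorem oddOddL_comm (f g : OddPart) : oddOddL f g = oddOddL g f :=
  Subtype.ext (formBracket_comm f.1 g.1)

theorem evenOddL_evenEvenL (X Y : EvenPart) (f : OddPart) :
    evenOddL (evenEvenL X Y) f = evenOddL X (evenOddL Y f) - evenOddL Y (evenOddL X f) :=
  Subtype.ext (lieDer_vfBracket X.1 Y.1 f.1)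

theorem evenEvenL_oddOddL (X : EvenPart) (f g : OddPart) :
    evenEvenL X (oddOddL f g) = oddOddL (evenOddL X f) g + oddOddL f (evenOddL X g) :=
  Subtype.ext (formBracket_lieDer X.2 f.1 g.1)

theorem evenOddL_oddOddL (f g h : OddPart) :
    evenOddL (oddOddL f g) h + evenOddL (oddOddL g h) f + evenOddL (oddOddL h f) g = 0 :=
  Subtype.ext (lieDer_formBracket f.2 g.2 h.2)

theorem vfBracket_jacobi (X Y Z : Fin 5 → PS) :
    vfBracket (vfBracket X Y) Z = vfBracket X (vfBracket Y Z) - vfBracket Y (vfBracket X Z) := by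
  funext i
  simp only [vfBracket, Pi.sub_apply, map_add, map_sub, Derivation.leibniz,
    smul_eq_mul, Fin.sum_univ_five]
  simp only [pd_comm]
  ring

theorem evenEvenL_jacobi (X Y Z : EvenPart) :
    evenEvenL (evenEvenL X Y) Z = evenEvenL X (evenEvenL Y Z) - evenEvenL Y (evenEvenL X Z) :=
  Subtype.ext (vfBracket_jacobi X.1 Y.1 Z.1)

/-! ## Brackets of constant elements -/

theorem oddOddL_dForm (P Q : Fin 5 × Fin 5) : oddOddL (dForm P) (dForm Q) =
    ∑ t, (eps ![P.1, P.2, Q.1, Q.2, t] : ℂ) • delField t := by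
  refine Subtype.ext (funext fun s => ?_)
  have hR : (∑ t, (eps ![P.1, P.2, Q.1, Q.2, t] : ℂ) • delField t : EvenPart).1 s =
      (eps ![P.1, P.2, Q.1, Q.2, s] : ℂ) • (1 : PS) := by
    rw [Submodule.coe_sum, Finset.sum_apply]
    simp [delField]
  rw [hR]
  have hsum : ∀ (R : Fin 5 × Fin 5) (F : Fin 5 → Fin 5 → PS),
      ∑ i, ∑ j, (dForm R).1 i j * F i j = F R.1 R.2 - F R.2 R.1 := by
    intro R F
    obtain ⟨r, r'⟩ := R
    simp only [dForm, Prod.mk.injEq, sub_mul, ite_mul, one_mul, zero_mul, ite_and,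
      Finset.sum_sub_distrib, Finset.sum_ite_eq', Finset.sum_ite_irrel, Finset.sum_const_zero,
      Finset.mem_univ, if_true]
  have e1 : ∀ i j, ∑ k, ∑ l, (eps ![i, j, k, l, s] : PS) * ((dForm P).1 i j * (dForm Q).1 k l) =
      (dForm P).1 i j * (2 * (eps ![i, j, Q.1, Q.2, s] : PS)) := by
    intro i j
    have := hsum Q fun k l => (eps ![i, j, k, l, s] : PS)
    rw [eps_swap23 i j Q.1 Q.2 s] at this
    push_cast at this
    calc _ = (dForm P).1 i j * ∑ k, ∑ l, (dForm Q).1 k l * (eps ![i, j, k, l, s] : PS) := by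
          simp only [Finset.mul_sum]
          refine Finset.sum_congr rfl fun k _ => Finset.sum_congr rfl fun l _ => by ring
      _ = _ := by rw [this]; ring
  change formBracket (dForm P).1 (dForm Q).1 s = _
  rw [formBracket_apply]
  simp only [e1]
  rw [hsum P fun i j => 2 * (eps ![i, j, Q.1, Q.2, s] : PS), eps_swap01 P.1 P.2]
  -- The two orderings of each pair contribute equally, and the resulting factor 4 cancels the
  -- normalization `1/4` of the bracket.
  have h4 : 2 * (eps ![P.1, P.2, Q.1, Q.2, s] : PS)
      - 2 * ((-eps ![P.1, P.2, Q.1, Q.2, s] : ℤ) : PS) =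
      (4 : ℂ) • (eps ![P.1, P.2, Q.1, Q.2, s] : PS) := by
    rw [Algebra.smul_def, map_ofNat]; push_cast; ring
  rw [h4, smul_smul, Algebra.smul_def ((eps _ : ℤ) : ℂ), map_intCast, mul_one]
  norm_num

theorem evenOddL_delField (t : Fin 5) (f : OddPart) (i j : Fin 5) :
    (evenOddL (delField t) f).1 i j = pd t (f.1 i j) := by
  have h : ∀ i k, pd i ((delField t).1 k) = 0 := by
    intro i k
    simp only [delField]; split_ifs <;> simp
  change lieDer (delField t).1 f.1 i j = _
  simp only [lieDer, h, zero_mul, add_zero]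
  simp [delField]

theorem evenEvenL_delField (t : Fin 5) (X : EvenPart) (i : Fin 5) :
    (evenEvenL (delField t) X).1 i = pd t (X.1 i) := by
  have h : ∀ i k, pd i ((delField t).1 k) = 0 := by
    intro i k
    simp only [delField]; split_ifs <;> simp
  change vfBracket (delField t).1 X.1 i = _
  simp only [vfBracket, h, mul_zero, sub_zero]
  simp [delField]

theorem pd_dForm (t : Fin 5) (P : Fin 5 × Fin 5) (i j : Fin 5) : pd t ((dForm P).1 i j) = 0 := by
  simp only [dForm]; split_ifs <;> simp

theorem pd_delField (t s : Fin 5) (i : Fin 5) : pd t ((delField s).1 i) = 0 := by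
  simp only [delField]; split_ifs <;> simp

theorem evenOddL_delField_dForm (t : Fin 5) (P : Fin 5 × Fin 5) :
    evenOddL (delField t) (dForm P) = 0 :=
  Subtype.ext (funext fun i => funext fun j => by
    rw [evenOddL_delField, pd_dForm]; rfl)

theorem evenEvenL_delField_delField (t s : Fin 5) : evenEvenL (delField t) (delField s) = 0 :=
  Subtype.ext (funext fun i => by rw [evenEvenL_delField, pd_delField]; rfl)

theorem dForm_swap (P : Fin 5 × Fin 5) : dForm P.swap = -dForm P := by
  refine Subtype.ext (funext fun i => funext fun j => ?_)
  have h : ∀ i j : Fin 5, ((i, j) = P.swap) = ((j, i) = P) := by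
    intro i j
    obtain ⟨a, b⟩ := P
    simp only [Prod.swap_prod_mk, Prod.mk.injEq, and_comm]
  have : (-dForm P).1 i j = -((dForm P).1 i j) := rfl
  rw [this]
  simp only [dForm, h]
  ring

/-! ## The enveloping algebra of `L_-` by generators and relations -/

/-- The generators `∂_t` and `d_P` of `U(L_-)`. -/
abbrev NegGen : Type := Fin 5 ⊕ (Fin 5 × Fin 5)

/-- The free generator `∂_t`. -/
abbrev freeDel (t : Fin 5) : FreeAlgebra ℂ NegGen := FreeAlgebra.ι ℂ (Sum.inl t)

/-- The free generator `d_P`. -/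
abbrev freeDd (P : Fin 5 × Fin 5) : FreeAlgebra ℂ NegGen := FreeAlgebra.ι ℂ (Sum.inr P)

/-- The defining relations of `U(L_-)`. -/
inductive NegRel : FreeAlgebra ℂ NegGen → FreeAlgebra ℂ NegGen → Prop
  | del_del (s t : Fin 5) :
      NegRel (freeDel s * freeDel t) (freeDel t * freeDel s)
  | dd_del (P : Fin 5 × Fin 5) (t : Fin 5) :
      NegRel (freeDd P * freeDel t) (freeDel t * freeDd P)
  | dd_dd (P Q : Fin 5 × Fin 5) :
      NegRel (freeDd P * freeDd Q + freeDd Q * freeDd P)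
        (∑ t, (eps ![P.1, P.2, Q.1, Q.2, t] : ℂ) • freeDel t)
  | dd_swap (P : Fin 5 × Fin 5) : NegRel (freeDd P.swap) (-freeDd P)

/-- `U(L_-)`, presented by generators and relations. -/
def NegAlg : Type := RingQuot NegRel

instance : Ring NegAlg := inferInstanceAs (Ring (RingQuot NegRel))

instance : Algebra ℂ NegAlg := inferInstanceAs (Algebra ℂ (RingQuot NegRel))

namespace NegAlg

/-- The quotient map from the free algebra. -/
def mk : FreeAlgebra ℂ NegGen →ₐ[ℂ] NegAlg := RingQuot.mkAlgHom ℂ NegRel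

/-- The generator `∂_t`. -/
def del (t : Fin 5) : NegAlg := mk (freeDel t)

/-- The generator `d_P`. -/
def dd (P : Fin 5 × Fin 5) : NegAlg := mk (freeDd P)

theorem mk_rel {x y : FreeAlgebra ℂ NegGen} (h : NegRel x y) : mk x = mk y :=
  RingQuot.mkAlgHom_rel ℂ h

theorem del_mul_del (s t : Fin 5) : del s * del t = del t * del s := by
  simpa only [del, map_mul] using mk_rel (NegRel.del_del s t)

theorem dd_mul_del (P : Fin 5 × Fin 5) (t : Fin 5) : dd P * del t = del t * dd P := by
  simpa only [del, dd, map_mul] using mk_rel (NegRel.dd_del P t)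

theorem dd_mul_dd (P Q : Fin 5 × Fin 5) : dd P * dd Q + dd Q * dd P =
    ∑ t, (eps ![P.1, P.2, Q.1, Q.2, t] : ℂ) • del t := by
  simpa only [del, dd, map_mul, map_add, map_sum, map_smul] using mk_rel (NegRel.dd_dd P Q)

theorem dd_swap (P : Fin 5 × Fin 5) : dd P.swap = -dd P := by
  simpa only [dd, map_neg] using mk_rel (NegRel.dd_swap P)

/-- The universal property. -/
def lift {B : Type*} [Ring B] [Algebra ℂ B] (D : Fin 5 → B) (E : Fin 5 × Fin 5 → B)
    (hDD : ∀ s t, D s * D t = D t * D s) (hED : ∀ P t, E P * D t = D t * E P)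
    (hEE : ∀ P Q, E P * E Q + E Q * E P = ∑ t, (eps ![P.1, P.2, Q.1, Q.2, t] : ℂ) • D t)
    (hE : ∀ P, E P.swap = -E P) : NegAlg →ₐ[ℂ] B :=
  RingQuot.liftAlgHom ℂ ⟨FreeAlgebra.lift ℂ (Sum.elim D E), by
    intro x y h
    induction h with
    | del_del s t => simpa using hDD s t
    | dd_del P t => simpa using hED P t
    | dd_dd P Q => simpa using hEE P Q
    | dd_swap P => simpa using hE P⟩

section lift

variable {B : Type*} [Ring B] [Algebra ℂ B] (D : Fin 5 → B) (E : Fin 5 × Fin 5 → B)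
    (hDD : ∀ s t, D s * D t = D t * D s) (hED : ∀ P t, E P * D t = D t * E P)
    (hEE : ∀ P Q, E P * E Q + E Q * E P = ∑ t, (eps ![P.1, P.2, Q.1, Q.2, t] : ℂ) • D t)
    (hE : ∀ P, E P.swap = -E P)

theorem lift_del (t : Fin 5) : lift D E hDD hED hEE hE (del t) = D t := by
  exact (RingQuot.liftAlgHom_mkAlgHom_apply ℂ (FreeAlgebra.lift ℂ (Sum.elim D E)) _ _).trans
    (by simp)

theorem lift_dd (P : Fin 5 × Fin 5) : lift D E hDD hED hEE hE (dd P) = E P := by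
  exact (RingQuot.liftAlgHom_mkAlgHom_apply ℂ (FreeAlgebra.lift ℂ (Sum.elim D E)) _ _).trans
    (by simp)

end lift

/-- Words are built up by left multiplication with generators, which matches the way the action of
`L` on the induced module is defined. -/
theorem induction_left {p : NegAlg → Prop} (one : p 1)
    (add : ∀ a b, p a → p b → p (a + b)) (smul : ∀ (c : ℂ) a, p a → p (c • a))
    (del_mul : ∀ t a, p a → p (del t * a)) (dd_mul : ∀ P a, p a → p (dd P * a)) (a : NegAlg) :
    p a := by
  have key : ∀ b : FreeAlgebra ℂ NegGen, ∀ a, p a → p (mk b * a) := by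
    intro b
    induction b using FreeAlgebra.induction with
    | grade0 r =>
      intro a ha
      rw [AlgHom.commutes, ← Algebra.smul_def]
      exact smul r a ha
    | grade1 x =>
      intro a ha
      rcases x with t | P
      · exact del_mul t a ha
      · exact dd_mul P a ha
    | mul x y hx hy =>
      intro a ha
      rw [map_mul, mul_assoc]
      exact hx _ (hy _ ha)
    | add x y hx hy =>
      intro a ha
      rw [map_add, add_mul]
      exact add _ _ (hx _ ha) (hy _ ha)
  obtain ⟨b, rfl⟩ := RingQuot.mkAlgHom_surjective ℂ NegRel a
  have := key b 1 one
  rwa [mul_one] at this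

end NegAlg


/-! ## The action of `L` on `U(L_-) ⊗ W` -/

section Induced

variable (W : Type*) [AddCommGroup W] [Module ℂ W]

/-- The underlying space of the induced module. -/
abbrev Ind : Type _ := NegAlg ⊗[ℂ] W

/-- Pairs of linear maps `ψ : L → U(L_-) ⊗ W`. -/
abbrev Coad : Type _ := (EvenPart →ₗ[ℂ] Ind W) × (OddPart →ₗ[ℂ] Ind W)

variable {W}

/-- Left multiplication on the induced module. -/
abbrev lmul (a : NegAlg) : Ind W →ₗ[ℂ] Ind W := Algebra.lsmul ℂ ℂ (Ind W) a

/-- The action of `∂_t` on `Coad W`: `(∂_t ψ)(z) = ψ([z, ∂_t]) + ∂_t ψ(z)`. -/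
def coadDel (t : Fin 5) : Module.End ℂ (Coad W) where
  toFun ψ := (ψ.1 ∘ₗ evenEvenL.flip (delField t) + lmul (NegAlg.del t) ∘ₗ ψ.1,
    lmul (NegAlg.del t) ∘ₗ ψ.2 - ψ.2 ∘ₗ evenOddL (delField t))
  map_add' ψ ψ' := by
    ext z <;> simp <;> abel
  map_smul' c ψ := by
    ext z <;> simp [smul_sub, smul_comm c (NegAlg.del t)]

/-- The action of `d_P` on `Coad W`: `(d_P ψ)(z) = ψ([z, d_P]) + (-1)^{|z|} d_P ψ(z)`. -/
def coadDd (P : Fin 5 × Fin 5) : Module.End ℂ (Coad W) where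
  toFun ψ := (ψ.2 ∘ₗ evenOddL.flip (dForm P) + lmul (NegAlg.dd P) ∘ₗ ψ.1,
    ψ.1 ∘ₗ oddOddL.flip (dForm P) - lmul (NegAlg.dd P) ∘ₗ ψ.2)
  map_add' ψ ψ' := by
    ext z <;> simp <;> abel
  map_smul' c ψ := by
    ext z <;> simp [smul_sub, smul_comm c (NegAlg.dd P)]

theorem coadDel_fst (t : Fin 5) (ψ : Coad W) (X : EvenPart) : (coadDel t ψ).1 X =
    ψ.1 (evenEvenL X (delField t)) + NegAlg.del t • ψ.1 X := rfl

theorem coadDel_snd (t : Fin 5) (ψ : Coad W) (f : OddPart) : (coadDel t ψ).2 f =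
    NegAlg.del t • ψ.2 f - ψ.2 (evenOddL (delField t) f) := rfl

theorem coadDd_fst (P : Fin 5 × Fin 5) (ψ : Coad W) (X : EvenPart) : (coadDd P ψ).1 X =
    ψ.2 (evenOddL X (dForm P)) + NegAlg.dd P • ψ.1 X := rfl

theorem coadDd_snd (P : Fin 5 × Fin 5) (ψ : Coad W) (f : OddPart) : (coadDd P ψ).2 f =
    ψ.1 (oddOddL f (dForm P)) - NegAlg.dd P • ψ.2 f := rfl

theorem coad_ext {ψ ψ' : Coad W} (h1 : ∀ X, ψ.1 X = ψ'.1 X) (h2 : ∀ f, ψ.2 f = ψ'.2 f) :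
    ψ = ψ' := Prod.ext (LinearMap.ext h1) (LinearMap.ext h2)

/-- Each relation of `U(L_-)` on `Coad W` is the Jacobi identity for an arbitrary `z` and two
constant elements, together with the same relation for left multiplication. -/
theorem coadDel_mul_coadDel (s t : Fin 5) :
    (coadDel s * coadDel t : Module.End ℂ (Coad W)) = coadDel t * coadDel s := by
  refine LinearMap.ext fun ψ => coad_ext (fun X => ?_) fun f => ?_
  · simp only [Module.End.mul_apply, coadDel_fst, smul_add, smul_smul]
    have h := evenEvenL_jacobi X (delField s) (delField t)
    rw [evenEvenL_delField_delField, map_zero, zero_sub, evenEvenL_neg (delField s), neg_neg]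
      at h
    rw [h, NegAlg.del_mul_del s t]
    abel
  · simp only [Module.End.mul_apply, coadDel_snd, smul_sub, smul_smul]
    have h := evenOddL_evenEvenL (delField s) (delField t) f
    rw [evenEvenL_delField_delField, map_zero, LinearMap.zero_apply] at h
    rw [sub_eq_zero.mp h.symm, NegAlg.del_mul_del s t]
    abel

theorem coadDd_mul_coadDel (P : Fin 5 × Fin 5) (t : Fin 5) :
    (coadDd P * coadDel t : Module.End ℂ (Coad W)) = coadDel t * coadDd P := by
  refine LinearMap.ext fun ψ => coad_ext (fun X => ?_) fun f => ?_
  · simp only [Module.End.mul_apply, coadDel_fst, coadDd_fst, coadDel_snd, smul_add, smul_smul]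
    have h := evenOddL_evenEvenL X (delField t) (dForm P)
    rw [evenOddL_delField_dForm, map_zero, zero_sub] at h
    rw [h, map_neg, NegAlg.dd_mul_del P t]
    abel
  · simp only [Module.End.mul_apply, coadDel_fst, coadDd_snd, coadDel_snd, smul_sub, smul_smul]
    have h := evenEvenL_oddOddL (delField t) f (dForm P)
    rw [evenOddL_delField_dForm, map_zero, add_zero, evenEvenL_neg] at h
    rw [← h, map_neg, NegAlg.dd_mul_del P t]
    abel

/-- The terms in which one of `d_P`, `d_Q` is bracketed with `z` and the other multiplies from the
left occur twice with opposite signs, thanks to the sign `(-1)^{|z|}`. The Jacobi identity for `z,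
d_P, d_Q` and the relation between `d_P` and `d_Q` give the rest. -/
theorem coadDd_mul_coadDd (P Q : Fin 5 × Fin 5) :
    (coadDd P * coadDd Q + coadDd Q * coadDd P : Module.End ℂ (Coad W)) =
      ∑ t, (eps ![P.1, P.2, Q.1, Q.2, t] : ℂ) • coadDel t := by
  refine LinearMap.ext fun ψ => coad_ext (fun X => ?_) fun f => ?_
  · have h := evenEvenL_oddOddL X (dForm P) (dForm Q)
    rw [oddOddL_comm (dForm P) (evenOddL _ _), oddOddL_dForm, map_sum] at h
    have h' := congrArg ψ.1 h
    have h2 := congrArg (fun a => a • ψ.1 X) (NegAlg.dd_mul_dd P Q)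
    simp only [map_add, map_sum, map_smul, add_smul, Finset.sum_smul, smul_assoc] at h' h2
    simp only [LinearMap.add_apply, Module.End.mul_apply, coadDd_fst, coadDd_snd,
      LinearMap.sum_apply, LinearMap.smul_apply, Prod.fst_add, Prod.fst_sum, Prod.smul_fst,
      coadDel_fst, smul_add, smul_smul, Finset.sum_add_distrib]
    rw [h', ← h2]
    abel
  · have h := evenOddL_oddOddL (dForm P) (dForm Q) f
    rw [oddOddL_comm (dForm Q) f, oddOddL_dForm, map_sum, LinearMap.sum_apply] at h
    have h' := congrArg ψ.2 h
    have h2 := congrArg (fun a => a • ψ.2 f) (NegAlg.dd_mul_dd P Q)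
    simp only [map_add, map_sum, map_smul, add_smul, Finset.sum_smul, smul_assoc, map_zero,
      LinearMap.smul_apply] at h' h2
    simp only [LinearMap.add_apply, Module.End.mul_apply, coadDd_fst, coadDd_snd,
      LinearMap.sum_apply, LinearMap.smul_apply, Prod.snd_add, Prod.snd_sum, Prod.smul_snd,
      coadDel_snd, smul_sub, smul_smul, Finset.sum_sub_distrib]
    rw [← h2]
    rw [add_assoc] at h'
    rw [eq_neg_of_add_eq_zero_left h']
    abel

theorem coadDd_swap (P : Fin 5 × Fin 5) :
    coadDd (W := W) P.swap = -coadDd (W := W) P := by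
  refine LinearMap.ext fun ψ => coad_ext (fun X => ?_) fun f => ?_
  · rw [LinearMap.neg_apply, Prod.fst_neg, LinearMap.neg_apply, coadDd_fst, coadDd_fst,
      dForm_swap, NegAlg.dd_swap, map_neg, map_neg, neg_smul, neg_add]
  · rw [LinearMap.neg_apply, Prod.snd_neg, LinearMap.neg_apply, coadDd_snd, coadDd_snd,
      dForm_swap, NegAlg.dd_swap, map_neg, map_neg, neg_smul]
    abel

variable (W) in
/-- `Coad W` as a representation of `U(L_-)`. -/
def coad : NegAlg →ₐ[ℂ] Module.End ℂ (Coad W) :=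
  NegAlg.lift (coadDel (W := W)) (coadDd (W := W)) coadDel_mul_coadDel coadDd_mul_coadDel
    coadDd_mul_coadDd coadDd_swap

theorem coad_del (t : Fin 5) : coad W (NegAlg.del t) = coadDel t :=
  NegAlg.lift_del _ _ _ _ _ _ t

theorem coad_dd (P : Fin 5 × Fin 5) : coad W (NegAlg.dd P) = coadDd P :=
  NegAlg.lift_dd _ _ _ _ _ _ P



/-- The constant coefficients of a vector field. -/
def constPart (t : Fin 5) : EvenPart →ₗ[ℂ] ℂ where
  toFun X := MvPowerSeries.constantCoeff (X.1 t)
  map_add' X Y := by simp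
  map_smul' c X := by simp

/-- The constant coefficients of a two-form. -/
def constForm (P : Fin 5 × Fin 5) : OddPart →ₗ[ℂ] ℂ where
  toFun f := MvPowerSeries.constantCoeff (f.1 P.1 P.2)
  map_add' X Y := by simp
  map_smul' c X := by simp

/-- `linearPart` as a linear map. -/
def linearPartL : EvenPart →ₗ[ℂ] sl5 where
  toFun := linearPart
  map_add' X Y := by
    refine Subtype.ext (Matrix.ext fun i j => ?_)
    simp [linearPart]
  map_smul' c X := by
    refine Subtype.ext (Matrix.ext fun i j => ?_)
    simp [linearPart]

/-- The action of odd elements on the generating subspace `W`. -/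
def baseOdd (w : W) : OddPart →ₗ[ℂ] Ind W :=
  -- The factor `1/2` is there because the sum meets every form once as `P` and once as its
  -- reversal.
  ∑ P, (constForm P).smulRight ((1 / 2 : ℂ) • NegAlg.dd P ⊗ₜ[ℂ] w)

theorem baseOdd_apply (w : W) (f : OddPart) : baseOdd w f =
    ∑ P, constForm P f • (1 / 2 : ℂ) • (NegAlg.dd P ⊗ₜ[ℂ] w) := by
  simp [baseOdd]

variable [LieRingModule sl5 W] [LieModule ℂ sl5 W]

/-- The bracket with a fixed vector of `W`. -/
def bracketWith (w : W) : sl5 →ₗ[ℂ] W where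
  toFun x := ⁅x, w⁆
  map_add' x y := add_lie x y w
  map_smul' c x := smul_lie c x w

/-- The action of even elements on the generating subspace `W`. -/
def baseEven (w : W) : EvenPart →ₗ[ℂ] Ind W :=
  ∑ t, (constPart t).smulRight (NegAlg.del t ⊗ₜ[ℂ] w) +
    TensorProduct.mk ℂ NegAlg W 1 ∘ₗ bracketWith w ∘ₗ linearPartL

theorem baseEven_apply (w : W) (X : EvenPart) : baseEven w X =
    ∑ t, constPart t X • (NegAlg.del t ⊗ₜ[ℂ] w) + 1 ⊗ₜ[ℂ] ⁅linearPart X, w⁆ := by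
  simp [baseEven, linearPartL, bracketWith]

/-- The action of `L` on `W` as a map `W → Coad W`. -/
def base : W →ₗ[ℂ] Coad W where
  toFun w := (baseEven w, baseOdd w)
  map_add' w w' := by
    refine coad_ext (fun X => ?_) fun f => ?_
    · simp [baseEven_apply, TensorProduct.tmul_add, Finset.sum_add_distrib]
      abel
    · simp [baseOdd_apply, TensorProduct.tmul_add, Finset.sum_add_distrib]
  map_smul' c w := by
    refine coad_ext (fun X => ?_) fun f => ?_
    · simp [baseEven_apply, TensorProduct.tmul_smul, Finset.smul_sum, smul_comm c]
    · simp [baseOdd_apply, TensorProduct.tmul_smul, Finset.smul_sum, smul_comm c]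

variable (W) in
/-- The action map `m ↦ (z ↦ z m)`: the `U(L_-)`-linear extension of `base`. -/
def actMap : Ind W →ₗ[ℂ] Coad W :=
  TensorProduct.lift ((LinearMap.lcomp ℂ (Coad W) base) ∘ₗ (coad W).toLinearMap)

theorem actMap_tmul (a : NegAlg) (w : W) : actMap W (a ⊗ₜ[ℂ] w) = coad W a (base w) := by
  simp [actMap]

theorem actMap_smul (a : NegAlg) (m : Ind W) : actMap W (a • m) = coad W a (actMap W m) := by
  induction m using TensorProduct.induction_on with
  | zero => simp
  | add x y hx hy => rw [smul_add, map_add, map_add, hx, hy, map_add]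
  | tmul b w => rw [TensorProduct.smul_tmul', smul_eq_mul, actMap_tmul, actMap_tmul, map_mul]; rfl

/-- The action of an even element. -/
def actEven (X : EvenPart) (m : Ind W) : Ind W := (actMap W m).1 X

/-- The action of an odd element. -/
def actOdd (f : OddPart) (m : Ind W) : Ind W := (actMap W m).2 f

end Induced

section Induced

variable {W : Type*} [AddCommGroup W] [Module ℂ W] [LieRingModule sl5 W] [LieModule ℂ sl5 W]

/-- This rule and the three that follow are the commutation relations with the generators of `L_-`,
valid by construction of `coad`. All other relations will be deduced from them. -/
theorem actEven_dd (X : EvenPart) (P : Fin 5 × Fin 5) (m : Ind W) :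
    actEven X (NegAlg.dd P • m) =
      actOdd (evenOddL X (dForm P)) m + NegAlg.dd P • actEven X m := by
  rw [actEven, actMap_smul, coad_dd, coadDd_fst]; rfl

theorem actOdd_dd (f : OddPart) (P : Fin 5 × Fin 5) (m : Ind W) :
    actOdd f (NegAlg.dd P • m) =
      actEven (oddOddL f (dForm P)) m - NegAlg.dd P • actOdd f m := by
  rw [actOdd, actMap_smul, coad_dd, coadDd_snd]; rfl

theorem actEven_del (X : EvenPart) (t : Fin 5) (m : Ind W) :
    actEven X (NegAlg.del t • m) =
      actEven (evenEvenL X (delField t)) m + NegAlg.del t • actEven X m := by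
  rw [actEven, actMap_smul, coad_del, coadDel_fst]; rfl

theorem actOdd_del (f : OddPart) (t : Fin 5) (m : Ind W) :
    actOdd f (NegAlg.del t • m) =
      NegAlg.del t • actOdd f m - actOdd (evenOddL (delField t) f) m := by
  rw [actOdd, actMap_smul, coad_del, coadDel_snd]; rfl

/-- The action of `L` on the induced module, as a linear map. -/
def act : L →ₗ[ℂ] Module.End ℂ (Ind W) where
  toFun z :=
    { toFun m := actEven z.1 m + actOdd z.2 m
      map_add' m m' := by simp only [actEven, actOdd, map_add, Prod.fst_add, Prod.snd_add,
        LinearMap.add_apply]; abel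
      map_smul' c m := by simp only [actEven, actOdd, map_smul, Prod.smul_fst, Prod.smul_snd,
        LinearMap.smul_apply, smul_add, RingHom.id_apply] }
  map_add' z z' := by
    refine LinearMap.ext fun m => ?_
    simp only [actEven, actOdd, LinearMap.coe_mk, AddHom.coe_mk, Prod.fst_add, Prod.snd_add,
      map_add, LinearMap.add_apply]
    abel
  map_smul' c z := by
    refine LinearMap.ext fun m => ?_
    simp only [actEven, actOdd, LinearMap.coe_mk, AddHom.coe_mk, Prod.smul_fst, Prod.smul_snd,
      map_smul, LinearMap.smul_apply, RingHom.id_apply, smul_add]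

theorem act_ev (X : EvenPart) (m : Ind W) : act (ev X) m = actEven X m := by
  change actEven X m + actOdd 0 m = _
  rw [actOdd, map_zero, add_zero]

theorem act_od (f : OddPart) (m : Ind W) : act (od f) m = actOdd f m := by
  change actEven 0 m + actOdd f m = _
  rw [actEven, map_zero, zero_add]

theorem actEven_add (X : EvenPart) (m m' : Ind W) :
    actEven X (m + m') = actEven X m + actEven X m' := by
  simp only [← act_ev, map_add]

theorem actEven_sub (X : EvenPart) (m m' : Ind W) :
    actEven X (m - m') = actEven X m - actEven X m' := by
  simp only [← act_ev, map_sub]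

theorem actOdd_add (f : OddPart) (m m' : Ind W) :
    actOdd f (m + m') = actOdd f m + actOdd f m' := by
  simp only [← act_od, map_add]

theorem actOdd_sub (f : OddPart) (m m' : Ind W) :
    actOdd f (m - m') = actOdd f m - actOdd f m' := by
  simp only [← act_od, map_sub]

theorem actEven_add_left (X Y : EvenPart) (m : Ind W) :
    actEven (X + Y) m = actEven X m + actEven Y m := map_add _ _ _

theorem actEven_sub_left (X Y : EvenPart) (m : Ind W) :
    actEven (X - Y) m = actEven X m - actEven Y m := map_sub _ _ _

theorem actEven_neg_left (X : EvenPart) (m : Ind W) :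
    actEven (-X) m = -actEven X m := map_neg _ _

theorem actEven_sum_smul_left {ι : Type*} (s : Finset ι) (c : ι → ℂ) (X : ι → EvenPart)
    (m : Ind W) : actEven (∑ i ∈ s, c i • X i) m = ∑ i ∈ s, c i • actEven (X i) m := by
  simp only [actEven, map_sum, map_smul]

theorem actOdd_add_left (f g : OddPart) (m : Ind W) :
    actOdd (f + g) m = actOdd f m + actOdd g m := map_add _ _ _

theorem actOdd_sub_left (f g : OddPart) (m : Ind W) :
    actOdd (f - g) m = actOdd f m - actOdd g m := map_sub _ _ _

theorem actOdd_neg_left (f : OddPart) (m : Ind W) :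
    actOdd (-f) m = -actOdd f m := map_neg _ _

theorem actOdd_zero_left (m : Ind W) : actOdd (0 : OddPart) m = 0 := map_zero _

theorem actEven_zero_left (m : Ind W) : actEven (0 : EvenPart) m = 0 := map_zero _

omit [LieRingModule sl5 W] [LieModule ℂ sl5 W] in
theorem ind_induction {p : Ind W → Prop} (one : ∀ w : W, p (1 ⊗ₜ w))
    (add : ∀ m m', p m → p m' → p (m + m')) (smul : ∀ (c : ℂ) m, p m → p (c • m))
    (del : ∀ t m, p m → p (NegAlg.del t • m)) (dd : ∀ P m, p m → p (NegAlg.dd P • m))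
    (m : Ind W) : p m := by
  have h : ∀ (w : W) (a : NegAlg), p (a ⊗ₜ w) := by
    intro w a
    induction a using NegAlg.induction_left with
    | one => exact one w
    | add a b ha hb => rw [TensorProduct.add_tmul]; exact add _ _ ha hb
    | smul c a ha => rw [← TensorProduct.smul_tmul']; exact smul _ _ ha
    | del_mul t a ha => exact del t _ ha
    | dd_mul P a ha => exact dd P _ ha
  induction m using TensorProduct.induction_on with
  | zero => rw [← TensorProduct.zero_tmul NegAlg (0 : W)]; exact h _ _
  | add m m' hm hm' => exact add _ _ hm hm'
  | tmul a w => exact h w a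

theorem actEven_one (X : EvenPart) (w : W) : actEven X (1 ⊗ₜ[ℂ] w) =
    ∑ t, constPart t X • (NegAlg.del t ⊗ₜ[ℂ] w) + 1 ⊗ₜ[ℂ] ⁅linearPart X, w⁆ := by
  rw [actEven, actMap_tmul, map_one, ← baseEven_apply]; rfl

theorem actOdd_one (f : OddPart) (w : W) : actOdd f (1 ⊗ₜ[ℂ] w) =
    ∑ P, constForm P f • (1 / 2 : ℂ) • (NegAlg.dd P ⊗ₜ[ℂ] w) := by
  rw [actOdd, actMap_tmul, map_one, ← baseOdd_apply]; rfl

omit [LieRingModule sl5 W] [LieModule ℂ sl5 W] in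
theorem del_smul_one (t : Fin 5) (w : W) :
    NegAlg.del t • ((1 : NegAlg) ⊗ₜ[ℂ] w) = NegAlg.del t ⊗ₜ w := by
  rw [TensorProduct.smul_tmul', smul_eq_mul, mul_one]

omit [LieRingModule sl5 W] [LieModule ℂ sl5 W] in
theorem dd_smul_one (P : Fin 5 × Fin 5) (w : W) :
    NegAlg.dd P • ((1 : NegAlg) ⊗ₜ[ℂ] w) = NegAlg.dd P ⊗ₜ w := by
  rw [TensorProduct.smul_tmul', smul_eq_mul, mul_one]

theorem linearPart_delField (t : Fin 5) : linearPart (delField t) = 0 := by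
  refine Subtype.ext (Matrix.ext fun i j => ?_)
  change MvPowerSeries.coeff (Finsupp.single i 1) ((delField t).1 j) = 0
  simp only [delField]
  split_ifs
  · rw [MvPowerSeries.coeff_one, if_neg]; simp
  · simp

theorem constPart_delField (s t : Fin 5) : constPart s (delField t) = if s = t then 1 else 0 := by
  change MvPowerSeries.constantCoeff ((delField t).1 s) = _
  simp only [delField]; split_ifs <;> simp

theorem constForm_dForm (P Q : Fin 5 × Fin 5) : constForm P (dForm Q) =
    (if P = Q then 1 else 0) - (if P.swap = Q then 1 else 0) := by
  change MvPowerSeries.constantCoeff ((dForm Q).1 P.1 P.2) = _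
  simp only [dForm, map_sub]
  congr 1
  · split_ifs <;> simp
  · change MvPowerSeries.constantCoeff (if P.swap = Q then 1 else 0) = _
    split_ifs <;> simp

/-- Since the action is defined by recursion on the vector, it has to be checked that an element of
`L_-` really acts as left multiplication. The induction works because `∂_t` commutes with all
generators, in `L` as in `U(L_-)`. -/
theorem actEven_delField (t : Fin 5) (m : Ind W) :
    actEven (delField t) m = NegAlg.del t • m := by
  induction m using ind_induction with
  | one w =>
    rw [actEven_one, linearPart_delField, zero_lie, TensorProduct.tmul_zero, add_zero,
      del_smul_one]
    simp [constPart_delField]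
  | add m m' hm hm' => rw [actEven_add, hm, hm', smul_add]
  | smul c m hm => rw [← act_ev, map_smul, act_ev, hm, smul_comm]
  | del s m hm =>
    rw [actEven_del, evenEvenL_delField_delField, actEven_zero_left, zero_add, hm, smul_smul,
      smul_smul, NegAlg.del_mul_del]
  | dd P m hm =>
    rw [actEven_dd, evenOddL_delField_dForm, actOdd_zero_left, zero_add, hm, smul_smul,
      smul_smul, NegAlg.dd_mul_del]

theorem actOdd_dForm (P : Fin 5 × Fin 5) (m : Ind W) :
    actOdd (dForm P) m = NegAlg.dd P • m := by
  induction m using ind_induction with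
  | one w =>
    rw [actOdd_one, dd_smul_one]
    have h : ∀ Q : Fin 5 × Fin 5, (if Q.swap = P then (1 : ℂ) else 0) =
        if Q = P.swap then 1 else 0 := fun Q => by
      congr 1; rw [eq_iff_iff]
      exact ⟨fun h => by rw [← h, Prod.swap_swap], fun h => by rw [h, Prod.swap_swap]⟩
    simp only [constForm_dForm, h, sub_smul, ite_smul, one_smul, zero_smul,
      Finset.sum_sub_distrib, Finset.sum_ite_eq', Finset.mem_univ, if_true]
    rw [NegAlg.dd_swap, TensorProduct.neg_tmul, smul_neg, sub_neg_eq_add, ← add_smul]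
    norm_num
  | add m m' hm hm' => rw [actOdd_add, hm, hm', smul_add]
  | smul c m hm => rw [← act_od, map_smul, act_od, hm, smul_comm]
  | del s m hm =>
    rw [actOdd_del, evenOddL_delField_dForm, actOdd_zero_left, sub_zero, hm, smul_smul,
      smul_smul, NegAlg.dd_mul_del]
  | dd Q m hm =>
    have h := congrArg (fun a => a • m) (NegAlg.dd_mul_dd P Q)
    simp only [add_smul, Finset.sum_smul, smul_assoc] at h
    rw [actOdd_dd, hm, oddOddL_dForm, actEven_sum_smul_left]
    simp only [actEven_delField]
    rw [← h, smul_smul, smul_smul]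
    abel

/-! ### Decomposition of `L` into constant elements and `L_{≥0}` -/

/-- The constant part of a vector field. -/
def evenConst (X : EvenPart) : EvenPart := ∑ t, constPart t X • delField t

/-- The constant part of a two-form. -/
def oddConst (f : OddPart) : OddPart := ∑ P, constForm P f • (1 / 2 : ℂ) • dForm P

theorem evenNonneg_sub_evenConst (X : EvenPart) : EvenNonneg (X - evenConst X) := by
  intro i
  have : constPart i (X - evenConst X) = 0 := by
    rw [map_sub, evenConst, map_sum]
    simp [constPart_delField]
  exact this

theorem oddNonneg_sub_oddConst (f : OddPart) : OddNonneg (f - oddConst f) := by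
  intro i j
  have : constForm (i, j) (f - oddConst f) = 0 := by
    rw [map_sub, oddConst, map_sum]
    simp only [map_smul, constForm_dForm, smul_eq_mul, mul_sub, mul_ite, mul_one, mul_zero,
      Finset.sum_sub_distrib, Finset.sum_ite_eq, Finset.mem_univ, if_true, Prod.swap_prod_mk]
    have : constForm (j, i) f = -constForm (i, j) f := by
      change MvPowerSeries.constantCoeff (f.1 j i) = -MvPowerSeries.constantCoeff (f.1 i j)
      rw [f.2.1 j i, map_neg]
    rw [this]; ring
  exact this


/-! ### Elements of `L_{≥0}` acting on the generating subspace -/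

theorem constPart_of_evenNonneg {X : EvenPart} (hX : EvenNonneg X) (t : Fin 5) :
    constPart t X = 0 := hX t

theorem constForm_of_oddNonneg {f : OddPart} (hf : OddNonneg f) (P : Fin 5 × Fin 5) :
    constForm P f = 0 := hf _ _

theorem coeff_single_one (i : Fin 5) (g : PS) : MvPowerSeries.coeff (Finsupp.single i 1) g =
    MvPowerSeries.constantCoeff (pd i g) := by
  rw [← MvPowerSeries.coeff_zero_eq_constantCoeff_apply, MvPowerSeries.coeff_pderiv]
  simp

theorem linearPart_apply (X : EvenPart) (i j : Fin 5) :
    (linearPart X).1 i j = MvPowerSeries.constantCoeff (pd i (X.1 j)) :=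
  coeff_single_one i _

theorem evenNonneg_evenEvenL {X Y : EvenPart} (hX : EvenNonneg X) (hY : EvenNonneg Y) :
    EvenNonneg (evenEvenL X Y) := by
  intro i
  change MvPowerSeries.constantCoeff (∑ j, (X.1 j * pd j (Y.1 i) - Y.1 j * pd j (X.1 i))) = 0
  simp [hX _, hY _]

theorem linearPart_evenEvenL {X Y : EvenPart} (hX : EvenNonneg X) (hY : EvenNonneg Y) :
    linearPart (evenEvenL X Y) = ⁅linearPart X, linearPart Y⁆ := by
  refine Subtype.ext (Matrix.ext fun i j => ?_)
  rw [linearPart_apply, LieAlgebra.SpecialLinear.sl_bracket, Matrix.sub_apply,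
    Matrix.mul_apply, Matrix.mul_apply, ← Finset.sum_sub_distrib]
  change MvPowerSeries.constantCoeff
    (pd i (∑ k, (X.1 k * pd k (Y.1 j) - Y.1 k * pd k (X.1 j)))) = _
  simp only [map_sum, map_sub, Derivation.leibniz, smul_eq_mul, map_add, map_mul, hX _, hY _,
    zero_mul, zero_add, linearPart_apply]
  exact Finset.sum_congr rfl fun k _ => by ring

theorem oddNonneg_evenOddL {X : EvenPart} {f : OddPart} (hX : EvenNonneg X) (hf : OddNonneg f) :
    OddNonneg (evenOddL X f) := by
  intro i j
  change MvPowerSeries.constantCoeff (lieDer X.1 f.1 i j) = 0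
  simp [lieDer, hX _, hf _ _]

theorem oddOddL_apply_coe (f g : OddPart) (t : Fin 5) : (oddOddL f g).1 t =
    (1 / 4 : ℂ) • ∑ i, ∑ j, ∑ k, ∑ l, (eps ![i, j, k, l, t] : PS) * (f.1 i j * g.1 k l) :=
  formBracket_apply f.1 g.1 t

theorem constantCoeff_smul' (c : ℂ) (g : PS) :
    MvPowerSeries.constantCoeff (c • g) = c * MvPowerSeries.constantCoeff g := by
  simp

theorem evenNonneg_oddOddL {f : OddPart} (hf : OddNonneg f) (g : OddPart) :
    EvenNonneg (oddOddL f g) := by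
  intro t
  rw [oddOddL_apply_coe, constantCoeff_smul']
  simp only [map_sum, map_mul, hf _ _, zero_mul, mul_zero, Finset.sum_const_zero]

theorem linearPart_oddOddL {f g : OddPart} (hf : OddNonneg f) (hg : OddNonneg g) :
    linearPart (oddOddL f g) = 0 := by
  refine Subtype.ext (Matrix.ext fun i j => ?_)
  rw [linearPart_apply, oddOddL_apply_coe, Derivation.map_smul, constantCoeff_smul']
  simp only [map_sum, map_mul, Derivation.leibniz, smul_eq_mul, map_add, hf _ _, hg _ _,
    zero_mul, mul_zero, Finset.sum_const_zero, add_zero]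
  rfl

theorem actEven_one_nonneg {X : EvenPart} (hX : EvenNonneg X) (w : W) :
    actEven X (1 ⊗ₜ[ℂ] w) = 1 ⊗ₜ[ℂ] ⁅linearPart X, w⁆ := by
  rw [actEven_one]
  simp [constPart_of_evenNonneg hX]

theorem actOdd_one_nonneg {f : OddPart} (hf : OddNonneg f) (w : W) :
    actOdd f (1 ⊗ₜ[ℂ] w) = 0 := by
  rw [actOdd_one]
  simp [constForm_of_oddNonneg hf]

/-! ### The commutation relations -/

/-- The commutation relations of `L` hold on the vector `m`. -/
structure CommRel (m : Ind W) : Prop where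
  ee : ∀ X Y, actEven X (actEven Y m) = actEven Y (actEven X m) + actEven (evenEvenL X Y) m
  eo : ∀ X f, actEven X (actOdd f m) = actOdd f (actEven X m) + actOdd (evenOddL X f) m
  oo : ∀ f g, actOdd f (actOdd g m) + actOdd g (actOdd f m) = actEven (oddOddL f g) m

theorem actEven_evenConst (X : EvenPart) (m : Ind W) :
    actEven (evenConst X) m = ∑ t, constPart t X • NegAlg.del t • m := by
  rw [evenConst, actEven_sum_smul_left]
  simp only [actEven_delField]

theorem actOdd_oddConst (f : OddPart) (m : Ind W) :
    actOdd (oddConst f) m = ∑ P, constForm P f • (1 / 2 : ℂ) • NegAlg.dd P • m := by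
  simp only [← actOdd_dForm]
  simp only [oddConst, actOdd, map_sum, map_smul]

theorem actEven_sum_smul {ι : Type*} (s : Finset ι) (c : ι → ℂ) (X : EvenPart)
    (m : ι → Ind W) : actEven X (∑ i ∈ s, c i • m i) = ∑ i ∈ s, c i • actEven X (m i) := by
  simp only [← act_ev, map_sum, map_smul]

theorem actOdd_sum_smul {ι : Type*} (s : Finset ι) (c : ι → ℂ) (f : OddPart)
    (m : ι → Ind W) : actOdd f (∑ i ∈ s, c i • m i) = ∑ i ∈ s, c i • actOdd f (m i) := by
  simp only [← act_od, map_sum, map_smul]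

/-- A relation with one constant argument holds on every vector, because passing a constant element
is how the action was defined. The same applies to the next three lemmas. -/
theorem ee_const (X Y : EvenPart) (m : Ind W) : actEven X (actEven (evenConst Y) m) =
    actEven (evenConst Y) (actEven X m) + actEven (evenEvenL X (evenConst Y)) m := by
  rw [actEven_evenConst, actEven_evenConst, actEven_sum_smul, evenConst, map_sum]
  simp only [map_smul]
  rw [actEven_sum_smul_left, ← Finset.sum_add_distrib]
  exact Finset.sum_congr rfl fun t _ => by rw [actEven_del, smul_add, add_comm]

theorem eo_const_right (X : EvenPart) (f : OddPart) (m : Ind W) :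
    actEven X (actOdd (oddConst f) m) =
    actOdd (oddConst f) (actEven X m) + actOdd (evenOddL X (oddConst f)) m := by
  rw [actOdd_oddConst, actOdd_oddConst, actEven_sum_smul, oddConst]
  simp only [map_sum, map_smul, actOdd]
  rw [← Finset.sum_add_distrib]
  refine Finset.sum_congr rfl fun P _ => ?_
  rw [← act_ev, map_smul, act_ev, actEven_dd, smul_add, smul_add, add_comm]
  rfl

theorem eo_const_left (X : EvenPart) (f : OddPart) (m : Ind W) :
    actEven (evenConst X) (actOdd f m) =
    actOdd f (actEven (evenConst X) m) + actOdd (evenOddL (evenConst X) f) m := by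
  rw [actEven_evenConst, actEven_evenConst, actOdd_sum_smul, evenConst]
  have : actOdd (evenOddL (∑ t, constPart t X • delField t) f) m =
      ∑ t, constPart t X • actOdd (evenOddL (delField t) f) m := by
    simp only [map_sum, map_smul, actOdd, LinearMap.sum_apply, LinearMap.smul_apply]
  rw [this, ← Finset.sum_add_distrib]
  refine Finset.sum_congr rfl fun t _ => ?_
  rw [actOdd_del, smul_sub, sub_add_cancel]

theorem oo_const (f g : OddPart) (m : Ind W) :
    actOdd f (actOdd (oddConst g) m) + actOdd (oddConst g) (actOdd f m) =
      actEven (oddOddL f (oddConst g)) m := by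
  rw [actOdd_oddConst, actOdd_oddConst, actOdd_sum_smul, oddConst]
  have : actEven (oddOddL f (∑ P, constForm P g • (1 / 2 : ℂ) • dForm P)) m =
      ∑ P, constForm P g • (1 / 2 : ℂ) • actEven (oddOddL f (dForm P)) m := by
    simp only [map_sum, map_smul, actEven]
  rw [this, ← Finset.sum_add_distrib]
  refine Finset.sum_congr rfl fun P _ => ?_
  rw [← act_od, map_smul, act_od, actOdd_dd, smul_sub, smul_sub, sub_add_cancel]

/-- Each element is its constant part plus an element of `L_{≥0}`. Relations with a constant
argument are already known. Between elements of `L_{≥0}` they say that `W` is a module for `L_{≥0}`: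
the linear part is a homomorphism to `𝔰𝔩₅`, and brackets that involve odd elements of `L_{≥0}` act
by zero. -/
theorem commRel_one (w : W) : CommRel ((1 : NegAlg) ⊗ₜ[ℂ] w) := by
  set m := (1 : NegAlg) ⊗ₜ[ℂ] w with hm
  refine ⟨fun X Y => ?_, fun X f => ?_, fun f g => ?_⟩
  · have hX := evenNonneg_sub_evenConst X
    have hY := evenNonneg_sub_evenConst Y
    have h1 : actEven (X - evenConst X) (actEven (Y - evenConst Y) m) =
        actEven (Y - evenConst Y) (actEven (X - evenConst X) m)
          + actEven (evenEvenL (X - evenConst X) (Y - evenConst Y)) m := by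
      rw [actEven_one_nonneg hX, actEven_one_nonneg hY, actEven_one_nonneg hX,
        actEven_one_nonneg hY, actEven_one_nonneg (evenNonneg_evenEvenL hX hY),
        linearPart_evenEvenL hX hY, ← TensorProduct.tmul_add, lie_lie, add_sub_cancel]
    -- Bilinear inclusion and exclusion: the pair `(X, Y)` is the pair of nonnegative parts, plus
    -- the two pairs with one constant entry, minus the pair of constants, which was counted twice.
    have h2 := ee_const X Y m
    have h3 := ee_const Y X m
    have h4 := ee_const (evenConst X) Y m
    rw [evenEvenL_neg, actEven_neg_left] at h3
    simp only [map_sub, LinearMap.sub_apply, actEven_sub_left, actEven_sub] at h1 h2 h3 h4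
    linear_combination (norm := module) h1 + h2 - h3 - h4
  · have hX := evenNonneg_sub_evenConst X
    have hf := oddNonneg_sub_oddConst f
    have h1 : actEven (X - evenConst X) (actOdd (f - oddConst f) m) =
        actOdd (f - oddConst f) (actEven (X - evenConst X) m)
          + actOdd (evenOddL (X - evenConst X) (f - oddConst f)) m := by
      rw [actEven_one_nonneg hX, actOdd_one_nonneg hf, actOdd_one_nonneg hf,
        actOdd_one_nonneg (oddNonneg_evenOddL hX hf), ← act_ev, map_zero, add_zero]
    have h2 := eo_const_right X f m
    have h3 := eo_const_left X f m
    have h4 := eo_const_right (evenConst X) f m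
    simp only [map_sub, LinearMap.sub_apply, actEven_sub_left, actEven_sub, actOdd_sub_left,
      actOdd_sub] at h1 h2 h3 h4
    linear_combination (norm := module) h1 + h2 + h3 - h4
  · have hf := oddNonneg_sub_oddConst f
    have hg := oddNonneg_sub_oddConst g
    have h1 : actOdd (f - oddConst f) (actOdd (g - oddConst g) m) +
        actOdd (g - oddConst g) (actOdd (f - oddConst f) m)
          = actEven (oddOddL (f - oddConst f) (g - oddConst g)) m := by
      rw [actOdd_one_nonneg hf, actOdd_one_nonneg hg, actEven_one_nonneg (evenNonneg_oddOddL hf _),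
        linearPart_oddOddL hf hg, ← act_od, ← act_od, map_zero, map_zero, zero_lie,
        TensorProduct.tmul_zero, add_zero]
    have h2 := oo_const f g m
    have h3 := oo_const g f m
    have h4 := oo_const (oddConst f) g m
    rw [oddOddL_comm g] at h3
    simp only [map_sub, LinearMap.sub_apply, actEven_sub_left, actOdd_sub_left,
      actOdd_sub] at h1 h2 h3 h4
    linear_combination (norm := module) h1 + h2 + h3 - h4

/-- If the relations hold on `m`, they hold on `∂_t m` and `d_P m`: passing the generator replaces
an argument by its bracket with that generator, and the Jacobi identities of `L` recombine the
terms. -/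
theorem commRel (m : Ind W) : CommRel m := by
  induction m using ind_induction with
  | one w => exact commRel_one w
  | add m m' h h' =>
    refine ⟨fun X Y => ?_, fun X f => ?_, fun f g => ?_⟩
    · simp only [actEven_add, h.ee X Y, h'.ee X Y]; abel
    · simp only [actEven_add, actOdd_add, h.eo X f, h'.eo X f]; abel
    · simp only [actEven_add, actOdd_add, ← h.oo f g, ← h'.oo f g]; abel
  | smul c m h =>
    refine ⟨fun X Y => ?_, fun X f => ?_, fun f g => ?_⟩
    · have := congrArg (c • ·) (h.ee X Y)
      simpa only [← act_ev, map_smul, smul_add] using this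
    · have := congrArg (c • ·) (h.eo X f)
      simpa only [← act_ev, ← act_od, map_smul, smul_add] using this
    · have := congrArg (c • ·) (h.oo f g)
      simpa only [← act_ev, ← act_od, map_smul, smul_add] using this
  | del t m h =>
    refine ⟨fun X Y => ?_, fun X f => ?_, fun f g => ?_⟩
    · have h1 := h.ee X (evenEvenL Y (delField t))
      have h2 := h.ee Y (evenEvenL X (delField t))
      have h3 := congrArg (NegAlg.del t • ·) (h.ee X Y)
      simp only [actEven_del, actEven_add, evenEvenL_jacobi, actEven_sub_left, smul_add] at h3 ⊢
      rw [h1, h2, h3]; abel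
    · have h1 := h.eo X (evenOddL (delField t) f)
      have h2 := h.eo (evenEvenL X (delField t)) f
      have h3 := congrArg (NegAlg.del t • ·) (h.eo X f)
      have h4 := evenOddL_evenEvenL X (delField t) f
      have h5 : evenOddL (delField t) (evenOddL X f) =
        evenOddL X (evenOddL (delField t) f) - evenOddL (evenEvenL X (delField t)) f := by
          rw [h4]; abel
      simp only [actEven_del, actOdd_del, actEven_sub, actOdd_add, actOdd_sub_left, smul_add,
        h5] at h3 ⊢
      rw [h1, h2, h3]; abel
    · have h1 := h.oo f (evenOddL (delField t) g)
      have h2 := h.oo (evenOddL (delField t) f) g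
      have h3 := congrArg (NegAlg.del t • ·) (h.oo f g)
      have h4 := evenEvenL_oddOddL (delField t) f g
      rw [evenEvenL_neg, neg_eq_iff_eq_neg] at h4
      simp only [actEven_del, actOdd_del, actOdd_sub, h4, actEven_neg_left, actEven_add_left,
        smul_add, ← h1, ← h2] at h3 ⊢
      rw [← h3]; abel
  | dd P m h =>
    refine ⟨fun X Y => ?_, fun X f => ?_, fun f g => ?_⟩
    · have h1 := h.eo X (evenOddL Y (dForm P))
      have h2 := h.eo Y (evenOddL X (dForm P))
      have h3 := congrArg (NegAlg.dd P • ·) (h.ee X Y)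
      simp only [actEven_dd, actEven_add, evenOddL_evenEvenL, actOdd_sub_left, smul_add] at h3 ⊢
      rw [h1, h2, h3]; abel
    · have h1 := h.ee X (oddOddL f (dForm P))
      have h2 := h.oo f (evenOddL X (dForm P))
      have h3 := congrArg (NegAlg.dd P • ·) (h.eo X f)
      simp only [actEven_dd, actOdd_dd, actEven_sub, actOdd_add, actEven_add_left, smul_add,
        evenEvenL_oddOddL, ← h2] at h1 h3 ⊢
      rw [h1, h3]; abel
    · have h1 := h.eo (oddOddL g (dForm P)) f
      have h2 := h.eo (oddOddL f (dForm P)) g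
      have h3 := congrArg (NegAlg.dd P • ·) (h.oo f g)
      have h4 := evenOddL_oddOddL f g (dForm P)
      rw [oddOddL_comm (dForm P) f, add_assoc] at h4
      rw [actEven_dd, eq_neg_of_add_eq_zero_left h4]
      simp only [actOdd_dd, actOdd_sub, actOdd_neg_left, actOdd_add_left, smul_add] at h3 ⊢
      rw [h1, h2, ← h3]; abel

end Induced

/-! ## The induced module as a `U`-module, and its comparison with the Verma module -/

section Induced

variable (W : Type*) [AddCommGroup W] [Module ℂ W] [LieRingModule sl5 W] [LieModule ℂ sl5 W]

/-- `U(L_-) ⊗ W` as a representation of `U`. -/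
def rep : U →ₐ[ℂ] Module.End ℂ (Ind W) :=
  RingQuot.liftAlgHom ℂ ⟨TensorAlgebra.lift ℂ (act (W := W)), by
    intro x y h
    refine LinearMap.ext fun m => ?_
    have hm := commRel m
    induction h with
    | even_even X Y =>
      simpa only [map_mul, map_add, TensorAlgebra.lift_ι_apply, LinearMap.add_apply,
        Module.End.mul_apply, act_ev, evenEvenL_apply] using hm.ee X Y
    | even_odd X f =>
      simpa only [map_mul, map_add, TensorAlgebra.lift_ι_apply, LinearMap.add_apply,
        Module.End.mul_apply, act_ev, act_od, evenOddL_apply] using hm.eo X f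
    | odd_odd f g =>
      simpa only [map_mul, map_add, TensorAlgebra.lift_ι_apply, LinearMap.add_apply,
        Module.End.mul_apply, act_ev, act_od, oddOddL_apply] using hm.oo f g⟩

theorem rep_ι (z : L) : rep W (ι z) = act z :=
  (RingQuot.liftAlgHom_mkAlgHom_apply ℂ (TensorAlgebra.lift ℂ (act (W := W))) _ _).trans (by simp)

/-- Evaluation `u ⊗ w ↦ u (1 ⊗ w)`. -/
def evalInd : U ⊗[ℂ] W →ₗ[ℂ] Ind W :=
  TensorProduct.lift ((LinearMap.lcomp ℂ (Ind W) (TensorProduct.mk ℂ NegAlg W 1)) ∘ₗ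
    (rep W).toLinearMap)

variable {W}

theorem evalInd_tmul (u : U) (w : W) : evalInd W (u ⊗ₜ[ℂ] w) = rep W u (1 ⊗ₜ w) := by
  simp [evalInd]

theorem evalInd_smul (u : U) (x : U ⊗[ℂ] W) : evalInd W (u • x) = rep W u (evalInd W x) := by
  induction x using TensorProduct.induction_on with
  | zero => simp
  | add x y hx hy => rw [smul_add, map_add, map_add, hx, hy, map_add]
  | tmul b w =>
    rw [TensorProduct.smul_tmul', smul_eq_mul, evalInd_tmul, evalInd_tmul, map_mul]; rfl

/-- The defining relations of `M(W)` hold for the vectors `1 ⊗ w` of the induced module, so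
evaluation descends to the quotient. -/
theorem evalInd_eq_zero {x : U ⊗[ℂ] W} (hx : x ∈ vermaRel W) : evalInd W x = 0 := by
  induction hx using Submodule.span_induction with
  | mem x hx =>
    rcases hx with ⟨X, v, hX, rfl⟩ | ⟨f, v, hf, rfl⟩
    · rw [map_sub, evalInd_tmul, evalInd_tmul, rep_ι, map_one, act_ev, actEven_one_nonneg hX]
      exact sub_self _
    · rw [evalInd_tmul, rep_ι, act_od, actOdd_one_nonneg hf]
  | zero => exact map_zero _
  | add x y _ _ hx hy => rw [map_add, hx, hy, add_zero]
  | smul u x _ hx => rw [evalInd_smul, hx, map_zero]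

variable (W) in
/-- The canonical map from the Verma module to the induced module. -/
def vermaMap : Verma W →ₗ[ℂ] Ind W :=
  (Submodule.liftQ ((vermaRel W).restrictScalars ℂ) (evalInd W) fun _ hx => evalInd_eq_zero hx) ∘ₗ
    (Submodule.Quotient.restrictScalarsEquiv ℂ (vermaRel W)).symm.toLinearMap

theorem vermaMap_mkQ (x : U ⊗[ℂ] W) : vermaMap W ((vermaRel W).mkQ x) = evalInd W x := by
  simp only [vermaMap, LinearMap.comp_apply, LinearEquiv.coe_coe, Submodule.mkQ_apply,
    Submodule.Quotient.restrictScalarsEquiv_symm_mk]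
  exact Submodule.liftQ_apply _ _ _

theorem vermaMap_smul (u : U) (m : Verma W) :
    vermaMap W (u • m) = rep W u (vermaMap W m) := by
  obtain ⟨x, rfl⟩ := (vermaRel W).mkQ_surjective m
  rw [← map_smul, vermaMap_mkQ, vermaMap_mkQ, evalInd_smul]

theorem vermaMap_del (t : Fin 5) (m : Verma W) :
    vermaMap W (del t • m) = NegAlg.del t • vermaMap W m := by
  rw [vermaMap_smul, del, rep_ι, act_ev, actEven_delField]

theorem vermaMap_dd (P : Fin 5 × Fin 5) (m : Verma W) :
    vermaMap W (dd P • m) = NegAlg.dd P • vermaMap W m := by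
  rw [vermaMap_smul, dd, rep_ι, act_od, actOdd_dForm]

theorem vermaMap_tmul_one (w : W) : vermaMap W (Verma.tmul 1 w) = 1 ⊗ₜ w := by
  rw [Verma.tmul, vermaMap_mkQ, evalInd_tmul, map_one]; rfl

end Induced

/-! ## Independence of monomials in `U(L_-)` -/

/-- The polynomial ring `ℂ[∂_1, …, ∂_5]`. -/
abbrev DelRing : Type := MvPolynomial (Fin 5) ℂ

/-- A free module with one basis vector for every pair of indices. -/
abbrev PairMod : Type := Fin 5 × Fin 5 → DelRing

/-- The bilinear form `β(e_P, e_Q) = ⅛ ∑_t ε_{PQt} ∂_t`. -/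
def pairForm : LinearMap.BilinForm DelRing PairMod :=
  Matrix.toBilin' (Matrix.of fun P Q => ∑ t,
    MvPolynomial.C ((1 / 8 : ℂ) * (eps ![P.1, P.2, Q.1, Q.2, t] : ℂ)) * MvPolynomial.X t)

/-- The Clifford algebra of `pairForm`. -/
abbrev Cl : Type := CliffordAlgebra (LinearMap.BilinMap.toQuadraticMap pairForm)

/-- The vector of `PairMod` corresponding to `d_P`. -/
def pairVec (P : Fin 5 × Fin 5) : PairMod := Pi.single P 1 - Pi.single P.swap 1

/-- The image of `d_P` in the Clifford algebra. -/
def clDd (P : Fin 5 × Fin 5) : Cl := CliffordAlgebra.ι _ (pairVec P)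

/-- The image of `∂_t` in the Clifford algebra. -/
def clDel (t : Fin 5) : Cl := algebraMap DelRing Cl (MvPolynomial.X t)

theorem pairVec_swap (P : Fin 5 × Fin 5) : pairVec P.swap = -pairVec P := by
  rw [pairVec, pairVec, Prod.swap_swap, neg_sub]

/-- Explains the constant `1/8`: each of the two vectors is a difference of two basis vectors, so
four equal terms add up to `1/2`. The symmetric form enters twice in the anticommutator of the
Clifford algebra, which makes the total 1. -/
theorem pairForm_pairVec (P Q : Fin 5 × Fin 5) : pairForm (pairVec P) (pairVec Q) =
    ∑ t, MvPolynomial.C ((1 / 2 : ℂ) * (eps ![P.1, P.2, Q.1, Q.2, t] : ℂ)) * MvPolynomial.X t := by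
  simp only [pairVec, map_sub, LinearMap.sub_apply, pairForm, Matrix.toBilin'_single,
    Matrix.of_apply, Prod.fst_swap, Prod.snd_swap, ← Finset.sum_sub_distrib, ← sub_mul]
  refine Finset.sum_congr rfl fun t _ => ?_
  rw [eps_swap01 P.1 P.2, eps_swap01 P.1 P.2, eps_swap23 P.1 P.2 Q.1 Q.2]
  simp only [← map_sub]
  congr 2
  push_cast
  ring

theorem clDd_mul_clDd (P Q : Fin 5 × Fin 5) : clDd P * clDd Q + clDd Q * clDd P =
    ∑ t, (eps ![P.1, P.2, Q.1, Q.2, t] : ℂ) • clDel t := by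
  rw [clDd, clDd, CliffordAlgebra.ι_mul_ι_add_swap, LinearMap.BilinMap.polar_toQuadraticMap,
    pairForm_pairVec, pairForm_pairVec, ← Finset.sum_add_distrib, map_sum]
  refine Finset.sum_congr rfl fun t _ => ?_
  rw [eps_swap, ← add_mul, ← map_add, map_mul, clDel, ← MvPolynomial.algebraMap_eq,
    ← IsScalarTower.algebraMap_apply, ← Algebra.smul_def]
  congr 1
  ring

/-- The comparison map to the Clifford algebra. -/
def toCl : NegAlg →ₐ[ℂ] Cl :=
  NegAlg.lift clDel clDd (fun s t => by rw [clDel, clDel, Algebra.commutes])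
    (fun P t => by rw [clDel, Algebra.commutes]) clDd_mul_clDd
    (fun P => by rw [clDd, clDd, pairVec_swap, map_neg])

/-- Contraction with the coordinate function of the pair `H`. -/
def contr (H : Fin 5 × Fin 5) : Cl →ₗ[ℂ] Cl :=
  (CliffordAlgebra.contractLeft (Q := LinearMap.BilinMap.toQuadraticMap pairForm)
    (LinearMap.proj H : PairMod →ₗ[DelRing] DelRing)).restrictScalars ℂ

/-- The pairing of `d_P` with the coordinate function of `H`. -/
def pairing (H P : Fin 5 × Fin 5) : ℂ := (if P = H then 1 else 0) - (if P = H.swap then 1 else 0)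

/-- Contraction is an antiderivation over `ℂ[∂_1, …, ∂_5]`; it removes one factor `d` and leaves the
`∂_t` alone. This is the tool that isolates coefficients. -/
theorem contr_clDd_mul (H P : Fin 5 × Fin 5) (x : Cl) :
    contr H (clDd P * x) = pairing H P • x - clDd P * contr H x := by
  refine (CliffordAlgebra.contractLeft_ι_mul _ _ _).trans ?_
  have h : (LinearMap.proj H : PairMod →ₗ[DelRing] DelRing) (pairVec P) =
      algebraMap ℂ DelRing (pairing H P) := by
    have e : (H = P.swap) = (P = H.swap) := by
      rw [eq_iff_iff]
      exact ⟨fun h => by rw [h, Prod.swap_swap], fun h => by rw [h, Prod.swap_swap]⟩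
    simp only [pairVec, pairing, LinearMap.proj_apply, Pi.single_apply, map_sub,
      apply_ite (algebraMap ℂ DelRing), map_one, map_zero, e, eq_comm (a := H) (b := P)]
  rw [h, algebraMap_smul]
  rfl

theorem contr_clDel_mul (H : Fin 5 × Fin 5) (t : Fin 5) (x : Cl) :
    contr H (clDel t * x) = clDel t * contr H x :=
  CliffordAlgebra.contractLeft_algebraMap_mul _ _ _

theorem contr_one (H : Fin 5 × Fin 5) : contr H 1 = 0 :=
  CliffordAlgebra.contractLeft_one _ _


/-- The projection of the Clifford algebra to `ℂ[∂_1, …, ∂_5]`. -/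
def clProj : Cl →ₗ[DelRing] DelRing :=
  -- Deforming the quadratic form to zero turns the Clifford algebra linearly into the exterior
  -- algebra and fixes scalars. Hence the polynomial ring embeds and is split off.
  ExteriorAlgebra.algebraMapInv.toLinearMap ∘ₗ CliffordAlgebra.changeForm (B := -pairForm)
    (Q := LinearMap.BilinMap.toQuadraticMap pairForm) (Q' := 0) (by
      rw [LinearMap.BilinMap.toQuadraticMap_neg, zero_sub])

theorem clProj_algebraMap (r : DelRing) : clProj (algebraMap DelRing Cl r) = r := by
  rw [clProj, LinearMap.comp_apply, CliffordAlgebra.changeForm_algebraMap]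
  exact ExteriorAlgebra.algebraMap_leftInverse PairMod r

/-- The functional extracting a coefficient of the scalar part of an element of the Clifford
algebra. -/
def clCoeff (n : Fin 5 →₀ ℕ) : Cl →ₗ[ℂ] ℂ :=
  MvPolynomial.lcoeff ℂ n ∘ₗ clProj.restrictScalars ℂ

theorem clCoeff_one : clCoeff 0 1 = 1 := by
  have := clProj_algebraMap 1
  rw [map_one] at this
  simp [clCoeff, this]

theorem clCoeff_clDel (s t : Fin 5) :
    clCoeff (Finsupp.single s 1) (clDel t) = if t = s then 1 else 0 := by
  simp [clCoeff, clDel, clProj_algebraMap, MvPolynomial.coeff_X, Finsupp.single_left_inj]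

theorem contr_clDd (H P : Fin 5 × Fin 5) : contr H (clDd P) = pairing H P • (1 : Cl) := by
  have := contr_clDd_mul H P 1
  rwa [contr_one, mul_zero, sub_zero, mul_one] at this

theorem contr_clDel (H : Fin 5 × Fin 5) (t : Fin 5) : contr H (clDel t) = 0 := by
  have := contr_clDel_mul H t 1
  rwa [contr_one, mul_zero, mul_one] at this

/-! ### Uniqueness of antisymmetrized coefficients in the Clifford algebra -/

section Independence

variable {Y : Type*} [AddCommGroup Y] [Module ℂ Y]

/-- Contraction on `Cl ⊗ Y`. -/
def contrT (Y : Type*) [AddCommGroup Y] [Module ℂ Y] (H : Fin 5 × Fin 5) :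
    Cl ⊗[ℂ] Y →ₗ[ℂ] Cl ⊗[ℂ] Y := (contr H).rTensor Y

theorem contrT_tmul (H : Fin 5 × Fin 5) (x : Cl) (y : Y) :
    contrT Y H (x ⊗ₜ y) = contr H x ⊗ₜ y := rfl

theorem sum_pairing (H : Fin 5 × Fin 5) (F : Fin 5 × Fin 5 → Y) :
    ∑ P, pairing H P • F P = F H - F H.swap := by
  simp only [pairing, sub_smul, ite_smul, one_smul, zero_smul, Finset.sum_sub_distrib,
    Finset.sum_ite_eq', Finset.mem_univ, if_true]

theorem cl_indep_zero {y : Y} (h : (1 : Cl) ⊗ₜ[ℂ] y = 0) : y = 0 := by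
  have := congrArg (TensorProduct.lid ℂ Y ∘ (clCoeff 0).rTensor Y) h
  simpa [clCoeff_one] using this

theorem cl_indep_del {Ψ : Fin 5 → Y} (h : ∑ t, clDel t ⊗ₜ[ℂ] Ψ t = 0) (s : Fin 5) : Ψ s = 0 := by
  have := congrArg (TensorProduct.lid ℂ Y ∘ (clCoeff (Finsupp.single s 1)).rTensor Y) h
  simpa [clCoeff_clDel] using this

theorem cl_indep_one {Ψ : Fin 5 × Fin 5 → Y} (hs : ∀ P, Ψ P.swap = -Ψ P)
    (h : ∑ P, clDd P ⊗ₜ[ℂ] Ψ P = 0) (H : Fin 5 × Fin 5) : Ψ H = 0 := by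
  have h1 := congrArg (contrT Y H) h
  simp only [map_sum, contrT_tmul, contr_clDd, map_zero, ← TensorProduct.smul_tmul'] at h1
  rw [sum_pairing H fun P => (1 : Cl) ⊗ₜ[ℂ] Ψ P, ← TensorProduct.tmul_sub, hs] at h1
  have h2 := cl_indep_zero h1
  rw [sub_neg_eq_add, ← two_smul ℂ] at h2
  exact (smul_eq_zero.mp h2).resolve_left two_ne_zero

/-- Contraction with `H` reduces to words of length one with coefficients `4 Ψ(H, ·)`: two
positions, times the two orientations of `H`. Without the antisymmetry the claim would fail, since
`d_P d_Q + d_Q d_P` is a combination of the `∂_t`. -/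
theorem cl_indep_two {Ψ : Fin 5 × Fin 5 → Fin 5 × Fin 5 → Y} {Ψ' : Fin 5 → Y}
    (hs : ∀ P Q, Ψ P.swap Q = -Ψ P Q) (ha : ∀ P Q, Ψ Q P = -Ψ P Q)
    (h : ∑ P, ∑ Q, (clDd P * clDd Q) ⊗ₜ[ℂ] Ψ P Q + ∑ t, clDel t ⊗ₜ[ℂ] Ψ' t = 0) :
    (∀ P Q, Ψ P Q = 0) ∧ ∀ t, Ψ' t = 0 := by
  have hs' : ∀ P Q, Ψ P Q.swap = -Ψ P Q := fun P Q => by rw [ha, hs, ha P Q, neg_neg]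
  have h0 : ∀ H Q, Ψ H Q = 0 := by
    intro H
    refine cl_indep_one (fun Q => hs' H Q) ?_
    have h1 := congrArg (contrT Y H) h
    simp only [map_add, map_sum, contrT_tmul, contr_clDd_mul, contr_clDd, contr_clDel,
      TensorProduct.zero_tmul, Finset.sum_const_zero, add_zero, map_zero,
      TensorProduct.sub_tmul, mul_smul_comm, mul_one, ← TensorProduct.smul_tmul',
      Finset.sum_sub_distrib, ← Finset.smul_sum] at h1
    rw [sum_pairing H fun P => ∑ Q, clDd Q ⊗ₜ[ℂ] Ψ P Q] at h1
    have h2 : ∀ P, ∑ Q, pairing H Q • (clDd P ⊗ₜ[ℂ] Ψ P Q) =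
        clDd P ⊗ₜ[ℂ] Ψ P H - clDd P ⊗ₜ[ℂ] Ψ P H.swap := fun P =>
      sum_pairing H fun Q => clDd P ⊗ₜ[ℂ] Ψ P Q
    simp only [h2, hs, hs', TensorProduct.tmul_neg, Finset.sum_neg_distrib, sub_neg_eq_add] at h1
    simp only [fun P => ha H P, TensorProduct.tmul_neg] at h1
    have h4 : (4 : ℂ) • ∑ Q, clDd Q ⊗ₜ[ℂ] Ψ H Q = 0 := by
      rw [← h1, Finset.smul_sum]
      simp only [← Finset.sum_add_distrib, ← Finset.sum_sub_distrib]
      exact Finset.sum_congr rfl fun Q _ => by module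
    exact (smul_eq_zero.mp h4).resolve_left (by norm_num)
  refine ⟨h0, ?_⟩
  simp only [h0, TensorProduct.tmul_zero, Finset.sum_const_zero, zero_add] at h
  exact cl_indep_del h

/-- One contraction reduces to length two. The cubic terms acquire the factor 6 (three positions,
two orientations of `H`) and the terms `∂_t d_P` the factor 2. -/
theorem cl_indep_three {Ψ : Fin 5 × Fin 5 → Fin 5 × Fin 5 → Fin 5 × Fin 5 → Y}
    {Ψ' : Fin 5 → Fin 5 × Fin 5 → Y}
    (hs : ∀ P Q R, Ψ P.swap Q R = -Ψ P Q R) (ha : ∀ P Q R, Ψ Q P R = -Ψ P Q R)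
    (hb : ∀ P Q R, Ψ P R Q = -Ψ P Q R) (hs' : ∀ t P, Ψ' t P.swap = -Ψ' t P)
    (h : ∑ P, ∑ Q, ∑ R, (clDd P * (clDd Q * clDd R)) ⊗ₜ[ℂ] Ψ P Q R
      + ∑ t, ∑ P, (clDel t * clDd P) ⊗ₜ[ℂ] Ψ' t P = 0) :
    (∀ P Q R, Ψ P Q R = 0) ∧ ∀ t P, Ψ' t P = 0 := by
  have key : ∀ H, (∀ Q R, (6 : ℂ) • Ψ H Q R = 0) ∧ ∀ t, (2 : ℂ) • Ψ' t H = 0 := by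
    intro H
    refine cl_indep_two (fun Q R => ?_) (fun Q R => ?_) ?_
    · rw [ha Q.swap H, hs, ha H Q, neg_neg, smul_neg]
    · rw [hb, smul_neg]
    have h1 := congrArg (contrT Y H) h
    simp only [map_add, map_sum, contrT_tmul, contr_clDd_mul, contr_clDd, contr_clDel_mul,
      mul_sub, map_zero, TensorProduct.sub_tmul, mul_smul_comm, mul_one,
      ← TensorProduct.smul_tmul', Finset.sum_sub_distrib, ← Finset.smul_sum] at h1
    rw [sum_pairing H fun P => ∑ Q, ∑ R, (clDd Q * clDd R) ⊗ₜ[ℂ] Ψ P Q R] at h1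
    have h2 : ∀ P, ∑ Q, pairing H Q • ∑ R, ((clDd P * clDd R) ⊗ₜ[ℂ] Ψ P Q R) =
        ∑ R, ((clDd P * clDd R) ⊗ₜ[ℂ] Ψ P H R) - ∑ R, ((clDd P * clDd R) ⊗ₜ[ℂ] Ψ P H.swap R) :=
      fun P => sum_pairing H fun Q => ∑ R, ((clDd P * clDd R) ⊗ₜ[ℂ] Ψ P Q R)
    have h3 : ∀ P Q, ∑ R, pairing H R • ((clDd P * clDd Q) ⊗ₜ[ℂ] Ψ P Q R) =
        (clDd P * clDd Q) ⊗ₜ[ℂ] Ψ P Q H - (clDd P * clDd Q) ⊗ₜ[ℂ] Ψ P Q H.swap :=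
      fun P Q => sum_pairing H fun R => ((clDd P * clDd Q) ⊗ₜ[ℂ] Ψ P Q R)
    have h4 : ∀ t, ∑ R, pairing H R • (clDel t ⊗ₜ[ℂ] Ψ' t R) =
        clDel t ⊗ₜ[ℂ] Ψ' t H - clDel t ⊗ₜ[ℂ] Ψ' t H.swap :=
      fun t => sum_pairing H fun R => (clDel t ⊗ₜ[ℂ] Ψ' t R)
    have e1 : ∀ P R, Ψ P H.swap R = Ψ H P R := fun P R => by rw [ha, hs, neg_neg]
    have e2 : ∀ P R, Ψ P H R = -Ψ H P R := fun P R => ha _ _ _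
    have e3 : ∀ P R, Ψ P R H = Ψ H P R := fun P R => by rw [hb, ha, neg_neg]
    have e4 : ∀ P R, Ψ P R H.swap = -Ψ H P R := fun P R => by rw [hb, e1]
    simp only [h2, h3, h4, hs, hs', e1, e2, e3, e4, TensorProduct.tmul_neg,
      Finset.sum_neg_distrib, sub_neg_eq_add, Finset.sum_sub_distrib] at h1
    rw [← h1]
    simp only [← Finset.sum_add_distrib, ← Finset.sum_sub_distrib, ← Finset.sum_neg_distrib]
    refine congrArg₂ (· + ·) ?_ ?_
    · refine Finset.sum_congr rfl fun Q _ => Finset.sum_congr rfl fun R _ => ?_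
      rw [TensorProduct.tmul_smul]
      module
    · refine Finset.sum_congr rfl fun Q _ => ?_
      rw [TensorProduct.tmul_smul]
      module
  exact ⟨fun P Q R => (smul_eq_zero.mp ((key P).1 Q R)).resolve_left (by norm_num),
    fun t P => (smul_eq_zero.mp ((key P).2 t)).resolve_left two_ne_zero⟩

end Independence

/-! ### Transfer of independence to the Verma module -/

section VermaIndependence

variable {W : Type*} [AddCommGroup W] [Module ℂ W] [LieRingModule sl5 W] [LieModule ℂ sl5 W]

theorem toCl_del (t : Fin 5) : toCl (NegAlg.del t) = clDel t := NegAlg.lift_del _ _ _ _ _ _ t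

theorem toCl_dd (P : Fin 5 × Fin 5) : toCl (NegAlg.dd P) = clDd P := NegAlg.lift_dd _ _ _ _ _ _ P

/-- The comparison map from the Verma module to `Cl ⊗ W`. -/
def vermaCl (W : Type*) [AddCommGroup W] [Module ℂ W] [LieRingModule sl5 W] [LieModule ℂ sl5 W] :
    Verma W →ₗ[ℂ] Cl ⊗[ℂ] W := toCl.toLinearMap.rTensor W ∘ₗ vermaMap W

/-- A vanishing combination in `M(W)` can be pushed forward along `vermaCl`, so a map out of `M(W)`
is enough and no isomorphism with `U(L_-) ⊗ W` has to be established. -/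
theorem verma_indep_two {Ψ : Fin 5 × Fin 5 → Fin 5 × Fin 5 → W} {Ψ' : Fin 5 → W}
    (hs : ∀ P Q, Ψ P.swap Q = -Ψ P Q) (ha : ∀ P Q, Ψ Q P = -Ψ P Q)
    (h : ∑ P, ∑ Q, dd P • dd Q • Verma.tmul 1 (Ψ P Q)
      + ∑ t, del t • Verma.tmul 1 (Ψ' t) = 0) :
    (∀ P Q, Ψ P Q = 0) ∧ ∀ t, Ψ' t = 0 := by
  refine cl_indep_two hs ha ?_
  have h1 := congrArg (vermaCl W) h
  simpa only [vermaCl, LinearMap.comp_apply, map_add, map_sum, vermaMap_dd, vermaMap_del,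
    vermaMap_tmul_one, TensorProduct.smul_tmul', smul_eq_mul, mul_one, map_zero,
    LinearMap.rTensor_tmul, AlgHom.toLinearMap_apply, map_mul, toCl_del, toCl_dd] using h1

theorem verma_indep_three {Ψ : Fin 5 × Fin 5 → Fin 5 × Fin 5 → Fin 5 × Fin 5 → W}
    {Ψ' : Fin 5 → Fin 5 × Fin 5 → W}
    (hs : ∀ P Q R, Ψ P.swap Q R = -Ψ P Q R) (ha : ∀ P Q R, Ψ Q P R = -Ψ P Q R)
    (hb : ∀ P Q R, Ψ P R Q = -Ψ P Q R) (hs' : ∀ t P, Ψ' t P.swap = -Ψ' t P)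
    (h : ∑ P, ∑ Q, ∑ R, dd P • dd Q • dd R • Verma.tmul 1 (Ψ P Q R)
      + ∑ t, ∑ P, del t • dd P • Verma.tmul 1 (Ψ' t P) = 0) :
    (∀ P Q R, Ψ P Q R = 0) ∧ ∀ t P, Ψ' t P = 0 := by
  refine cl_indep_three hs ha hb hs' ?_
  have h1 := congrArg (vermaCl W) h
  simpa only [vermaCl, LinearMap.comp_apply, map_add, map_sum, vermaMap_dd, vermaMap_del,
    vermaMap_tmul_one, TensorProduct.smul_tmul', smul_eq_mul, mul_one, map_zero,
    LinearMap.rTensor_tmul, AlgHom.toLinearMap_apply, map_mul, toCl_del, toCl_dd] using h1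

end VermaIndependence

/-! ## Commutation relations in `U` -/

theorem mkU_rel {x y : TensorAlgebra ℂ L} (h : Rel x y) : mkU x = mkU y :=
  RingQuot.mkAlgHom_rel ℂ h

theorem ι_ev_mul_ι_ev (X Y : EvenPart) :
    ι (ev X) * ι (ev Y) = ι (ev Y) * ι (ev X) + ι (ev (evenEvenL X Y)) := by
  have h := mkU_rel (Rel.even_even X Y)
  rwa [map_mul, map_add, map_mul] at h

theorem ι_ev_mul_ι_od (X : EvenPart) (f : OddPart) :
    ι (ev X) * ι (od f) = ι (od f) * ι (ev X) + ι (od (evenOddL X f)) := by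
  have h := mkU_rel (Rel.even_odd X f)
  rwa [map_mul, map_add, map_mul] at h

theorem ι_od_mul_ι_od (f g : OddPart) :
    ι (od f) * ι (od g) + ι (od g) * ι (od f) = ι (ev (oddOddL f g)) := by
  have h := mkU_rel (Rel.odd_odd f g)
  rwa [map_add, map_mul, map_mul] at h

/-- The inclusion of the even part in `U`. -/
def ιEven : EvenPart →ₗ[ℂ] U := ι ∘ₗ LinearMap.inl ℂ EvenPart OddPart

/-- The inclusion of the odd part in `U`. -/
def ιOdd : OddPart →ₗ[ℂ] U := ι ∘ₗ LinearMap.inr ℂ EvenPart OddPart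

theorem ιEven_apply (X : EvenPart) : ιEven X = ι (ev X) := rfl

theorem ιOdd_apply (f : OddPart) : ιOdd f = ι (od f) := rfl

theorem dd_swap (P : Fin 5 × Fin 5) : dd P.swap = -dd P := by
  rw [dd, dd, dForm_swap, ← ιOdd_apply, ← ιOdd_apply, map_neg]

theorem dd_mul_dd (P Q : Fin 5 × Fin 5) : dd P * dd Q + dd Q * dd P =
    ∑ t, (eps ![P.1, P.2, Q.1, Q.2, t] : ℂ) • del t := by
  rw [dd, dd, ι_od_mul_ι_od, oddOddL_dForm, ← ιEven_apply]
  simp only [map_sum, map_smul]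
  rfl

theorem del_mul_dd (t : Fin 5) (P : Fin 5 × Fin 5) : del t * dd P = dd P * del t := by
  rw [dd, del, ι_ev_mul_ι_od, evenOddL_delField_dForm, ← ιOdd_apply 0, map_zero, add_zero]

/-! ## The elements `ω_I` in degrees one and three -/

theorem omega_one (P : Fin 5 × Fin 5) : omega ![P] = dd P := by
  have h : SIF 1 = {∅} := by decide
  rw [omega, h, Finset.sum_singleton]
  simp [crossing, DSet, dRest]

/-- The bracket `[d_P, d_Q] ∈ U`. -/
def ddBracket (P Q : Fin 5 × Fin 5) : U := ∑ t, (eps ![P.1, P.2, Q.1, Q.2, t] : ℂ) • del t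

/-- In three positions at most one pair fits, so there are no crossings, and the sign of each
correction is `(-1)^{k+l}`. -/
theorem omega_three (P Q R : Fin 5 × Fin 5) : omega ![P, Q, R] =
    dd P * dd Q * dd R - (1 / 2 : ℂ) • (ddBracket P Q * dd R)
      + (1 / 2 : ℂ) • (ddBracket P R * dd Q) - (1 / 2 : ℂ) • (ddBracket Q R * dd P) := by
  have h : SIF 3 = {∅, {(0, 1)}, {(0, 2)}, {(1, 2)}} := by decide
  have hn : ∀ s : Fin 3 × Fin 3, crossing {s} = 0 := by decide
  have he : crossing (∅ : Finset (Fin 3 × Fin 3)) = 0 := by decide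
  have hd : ∀ I : Idx 3, DSet I ∅ = 1 := fun I => by simp [DSet]
  have hs : ∀ (I : Idx 3) s, DSet I {s} = DPair I s := fun I s => by simp [DSet]
  have h0 : dRest ![P, Q, R] ∅ = dd P * dd Q * dd R := by
    simp [dRest, List.finRange_succ, mul_assoc]
  have h1 : dRest ![P, Q, R] {(0, 1)} = dd R := by
    simp [dRest, List.finRange_succ]
  have h2 : dRest ![P, Q, R] {(0, 2)} = dd Q := by
    simp [dRest, List.finRange_succ]
  have h3 : dRest ![P, Q, R] {(1, 2)} = dd P := by
    simp [dRest, List.finRange_succ]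
  have hz : ∀ A B : Fin 5 × Fin 5, ∑ t, eps ![A.1, A.2, B.1, B.2, t] • del t = ddBracket A B :=
    fun A B => Finset.sum_congr rfl fun t _ => (Int.cast_smul_eq_zsmul ℂ _ _).symm
  rw [omega, h, Finset.sum_insert (by decide), Finset.sum_insert (by decide),
    Finset.sum_insert (by decide), Finset.sum_singleton]
  simp only [hn, he, hd, hs, h0, h1, h2, h3, pow_zero, one_smul, one_mul, DPair]
  simp only [Matrix.cons_val_zero, Matrix.cons_val_one, Matrix.cons_val, hz, smul_mul_assoc,
    Fin.val_zero, Fin.val_one, Fin.val_two]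
  norm_num
  abel

/-- `ω_I` is the antisymmetrization of `d_I`. -/
theorem six_smul_omega (P Q R : Fin 5 × Fin 5) : (6 : ℂ) • omega ![P, Q, R] =
    dd P * dd Q * dd R - dd P * dd R * dd Q - dd Q * dd P * dd R + dd Q * dd R * dd P
      + dd R * dd P * dd Q - dd R * dd Q * dd P := by
  have hb : ∀ A B, ddBracket A B = dd A * dd B + dd B * dd A := fun A B => (dd_mul_dd A B).symm
  have hc : ∀ A B C, ddBracket A B * dd C = dd C * ddBracket A B := fun A B C => by
    simp only [ddBracket, Finset.sum_mul, Finset.mul_sum, smul_mul_assoc, mul_smul_comm,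
      del_mul_dd]
  have c1 := hc P Q R
  have c2 := hc P R Q
  have c3 := hc Q R P
  rw [omega_three]
  simp only [hb] at c1 c2 c3 ⊢
  simp only [add_mul, mul_add, ← mul_assoc] at c1 c2 c3 ⊢
  -- The two sides differ only by commutators of a bracket `[d_A, d_B]` with a third `d_C`, and
  -- these vanish because the bracket is a combination of the `∂_t`, which commute with the `d_C`.
  linear_combination (norm := module) (2 : ℂ) • c1 + (4 : ℂ) • c2


/-! ## Sums over orbit representatives -/

section Sums

variable {M : Type*} [AddCommGroup M]

theorem sum_pairs_symm [Module ℂ M] {F : Fin 5 × Fin 5 → M} (hF : ∀ P, F P.swap = F P)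
    (h0 : ∀ i, F (i, i) = 0) : ∑ P, F P = (2 : ℂ) • ∑ P with P.1 < P.2, F P := by
  have h1 : ∑ P, F P = ∑ P, ((if P.1 < P.2 then F P else 0) + if P.2 < P.1 then F P else 0) := by
    refine Finset.sum_congr rfl fun P _ => ?_
    obtain ⟨i, j⟩ := P
    rcases lt_trichotomy i j with h | rfl | h
    · simp [h, h.not_gt]
    · simp [h0]
    · simp [h, h.not_gt]
  have h2 : ∑ P : Fin 5 × Fin 5, (if P.2 < P.1 then F P else 0) =
      ∑ P : Fin 5 × Fin 5, if P.1 < P.2 then F P else 0 :=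
    Fintype.sum_equiv (Equiv.prodComm _ _) _ _ fun P => by
      simp only [Equiv.prodComm_apply, Prod.fst_swap, Prod.snd_swap, hF]
  rw [h1, Finset.sum_add_distrib, h2, two_smul, Finset.sum_filter]

/-- Terms with a repeated entry vanish, and a triple of distinct entries is sorted by exactly one of
the six permutations. -/
theorem sum_triples {X β : Type*} [Fintype X] [LinearOrder β] (k : X → β)
    (hk : Function.Injective k) (G : X → X → X → M) (h01 : ∀ P R, G P P R = 0)
    (h12 : ∀ P Q, G P Q Q = 0) (h02 : ∀ P Q, G P Q P = 0) :
    ∑ P, ∑ Q, ∑ R, G P Q R = ∑ P, ∑ Q, ∑ R, if k P < k Q ∧ k Q < k R then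
      G P Q R + G P R Q + G Q P R + G Q R P + G R P Q + G R Q P else 0 := by
  have h1 : ∀ P Q R, G P Q R = (if k P < k Q ∧ k Q < k R then G P Q R else 0)
      + (if k P < k R ∧ k R < k Q then G P Q R else 0)
      + (if k Q < k P ∧ k P < k R then G P Q R else 0)
      + (if k R < k P ∧ k P < k Q then G P Q R else 0)
      + (if k Q < k R ∧ k R < k P then G P Q R else 0)
      + (if k R < k Q ∧ k Q < k P then G P Q R else 0) := by
    intro P Q R
    rcases lt_trichotomy (k P) (k Q) with h | h | h
    · rcases lt_trichotomy (k Q) (k R) with h' | h' | h'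
      · simp [h, h', h.not_gt, h'.not_gt, (h.trans h').not_gt]
      · rw [hk h', h12]; simp
      · rcases lt_trichotomy (k P) (k R) with h'' | h'' | h''
        · simp [h, h', h'', h.not_gt, h'.not_gt, h''.not_gt]
        · rw [hk h'', h02]; simp
        · simp [h, h', h'', h.not_gt, h'.not_gt, h''.not_gt]
    · rw [hk h, h01]; simp
    · rcases lt_trichotomy (k P) (k R) with h' | h' | h'
      · simp [h, h', h.not_gt, h'.not_gt, (h.trans h').not_gt]
      · rw [hk h', h02]; simp
      · rcases lt_trichotomy (k Q) (k R) with h'' | h'' | h''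
        · simp [h, h', h'', h.not_gt, h'.not_gt, h''.not_gt]
        · rw [hk h'', h12]; simp
        · simp [h, h', h'', h.not_gt, h'.not_gt, h''.not_gt]
  have s12 : ∀ F : X → X → X → M, ∑ P, ∑ Q, ∑ R, F P Q R = ∑ P, ∑ Q, ∑ R, F P R Q :=
    fun F => Finset.sum_congr rfl fun P _ => Finset.sum_comm
  have s01 : ∀ F : X → X → X → M, ∑ P, ∑ Q, ∑ R, F P Q R = ∑ P, ∑ Q, ∑ R, F Q P R :=
    fun F => Finset.sum_comm
  have r1 := s12 fun P Q R => if k P < k R ∧ k R < k Q then G P Q R else 0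
  have r2 := s01 fun P Q R => if k Q < k P ∧ k P < k R then G P Q R else 0
  have r3 := (s12 fun P Q R => if k R < k P ∧ k P < k Q then G P Q R else 0).trans (s01 _)
  have r4 := (s01 fun P Q R => if k Q < k R ∧ k R < k P then G P Q R else 0).trans (s12 _)
  have r5 := ((s01 fun P Q R => if k R < k Q ∧ k Q < k P then G P Q R else 0).trans
    (s12 _)).trans (s01 _)
  calc _ = _ := Finset.sum_congr rfl fun P _ => Finset.sum_congr rfl fun Q _ =>
        Finset.sum_congr rfl fun R _ => h1 P Q R
    _ = _ := by
      simp only [Finset.sum_add_distrib] at r1 r2 r3 r4 r5 ⊢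
      rw [r1, r2, r3, r4, r5]
      simp only [← Finset.sum_add_distrib]
      refine Finset.sum_congr rfl fun P _ => Finset.sum_congr rfl fun Q _ =>
        Finset.sum_congr rfl fun R _ => ?_
      split_ifs
      · abel
      · simp

theorem sum_idx_three {X : Type*} [Fintype X] (f : (Fin 3 → X) → M) :
    ∑ I, f I = ∑ P, ∑ Q, ∑ R, f ![P, Q, R] := by
  have h := Fintype.sum_equiv
    (⟨fun I => (I 0, I 1, I 2), fun x => ![x.1, x.2.1, x.2.2], fun I => by
      funext i; fin_cases i <;> rfl, fun _ => rfl⟩ : (Fin 3 → X) ≃ X × X × X)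
    f (fun x => f ![x.1, x.2.1, x.2.2]) (fun I => congrArg f (by
      funext i; fin_cases i <;> rfl))
  simpa only [Fintype.sum_prod_type] using h

theorem sum_orbitReps_three (f : Idx 3 → M) : ∑ I ∈ orbitReps 3, f I =
    ∑ P with P.1 < P.2, ∑ Q with Q.1 < Q.2, ∑ R with R.1 < R.2,
      if toLex P < toLex Q ∧ toLex Q < toLex R then f ![P, Q, R] else 0 := by
  rw [orbitReps, Finset.sum_filter, sum_idx_three, Finset.sum_filter]
  refine Finset.sum_congr rfl fun P _ => ?_
  split_ifs with hP
  swap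
  · refine Finset.sum_eq_zero fun Q _ => Finset.sum_eq_zero fun R _ => if_neg fun h => hP (h.1 0)
  rw [Finset.sum_filter]
  refine Finset.sum_congr rfl fun Q _ => ?_
  split_ifs with hQ
  swap
  · refine Finset.sum_eq_zero fun R _ => if_neg fun h => hQ (h.1 1)
  rw [Finset.sum_filter]
  refine Finset.sum_congr rfl fun R _ => ?_
  split_ifs with h1 h2 h3 h4 h5
  · rfl
  · exact absurd ⟨h1.2 0 1 (by decide), h1.2 1 2 (by decide)⟩ h3
  · exact absurd (h1.1 2) h2
  · refine absurd ⟨?_, ?_⟩ h1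
    · intro l; fin_cases l <;> assumption
    · intro l m hlm
      fin_cases l <;> fin_cases m <;> first | exact absurd hlm (by decide) | skip
      · exact h5.1
      · exact h5.1.trans h5.2
      · exact h5.2
  · rfl
  · rfl

theorem sum_orbitReps_one (f : Idx 1 → M) : ∑ I ∈ orbitReps 1, f I =
    ∑ P with P.1 < P.2, f ![P] := by
  rw [orbitReps, Finset.sum_filter, Finset.sum_filter]
  refine Fintype.sum_equiv (Equiv.funUnique (Fin 1) _) _ _ fun I => ?_
  have h : I = ![I 0] := by funext i; fin_cases i; rfl
  simp only [Equiv.funUnique_apply, Fin.default_eq_zero]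
  rw [← h]
  refine if_congr ⟨fun hI => hI.1 0, fun hI => ⟨fun l => ?_, fun l m hlm => ?_⟩⟩ rfl rfl
  · fin_cases l; exact hI
  · exact absurd hlm (by rw [Subsingleton.elim l m]; exact lt_irrefl m)

end Sums


/-! ## Alternating families -/

section Alternating

variable {A : Type*} [AddCommGroup A]

theorem IsAlternating.swap_zero {θ : Idx 3 → A} (h : IsAlternating θ) (P Q R : Fin 5 × Fin 5) :
    θ ![P.swap, Q, R] = -θ ![P, Q, R] := by
  have h1 := h ![-1, 1, 1] 1 ![P, Q, R]
  have e : signedPerm ![-1, 1, 1] 1 ![P, Q, R] = ![P.swap, Q, R] := by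
    funext j; fin_cases j <;> simp [signedPerm]
  rw [e] at h1
  simpa [Fin.prod_univ_three] using h1

theorem IsAlternating.perm_zero_one {θ : Idx 3 → A} (h : IsAlternating θ)
    (P Q R : Fin 5 × Fin 5) : θ ![Q, P, R] = -θ ![P, Q, R] := by
  have h1 := h 1 (Equiv.swap 0 1) ![P, Q, R]
  have e : signedPerm 1 (Equiv.swap 0 1) ![P, Q, R] = ![Q, P, R] := by
    funext j; fin_cases j <;> simp [signedPerm, Equiv.swap_apply_def]
  rw [e] at h1
  simpa using h1

theorem IsAlternating.perm_one_two {θ : Idx 3 → A} (h : IsAlternating θ)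
    (P Q R : Fin 5 × Fin 5) : θ ![P, R, Q] = -θ ![P, Q, R] := by
  have h1 := h 1 (Equiv.swap 1 2) ![P, Q, R]
  have e : signedPerm 1 (Equiv.swap 1 2) ![P, Q, R] = ![P, R, Q] := by
    funext j; fin_cases j <;> simp [signedPerm, Equiv.swap_apply_def]
  rw [e] at h1
  simpa using h1

theorem IsAlternating.swap_one {θ : Idx 3 → A} (h : IsAlternating θ) (P Q R : Fin 5 × Fin 5) :
    θ ![P, Q.swap, R] = -θ ![P, Q, R] := by
  rw [h.perm_zero_one, h.swap_zero, h.perm_zero_one P, neg_neg]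

theorem IsAlternating.swap_two {θ : Idx 3 → A} (h : IsAlternating θ) (P Q R : Fin 5 × Fin 5) :
    θ ![P, Q, R.swap] = -θ ![P, Q, R] := by
  rw [h.perm_one_two, h.swap_one, h.perm_one_two P, neg_neg]

theorem IsAlternating.swap_single {θ : Idx 1 → A} (h : IsAlternating θ) (P : Fin 5 × Fin 5) :
    θ ![P.swap] = -θ ![P] := by
  have h1 := h ![-1] 1 ![P]
  have e : signedPerm ![-1] 1 ![P] = ![P.swap] := by
    funext j; fin_cases j; simp [signedPerm]
  rw [e] at h1
  simpa using h1

end Alternating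

theorem eq_zero_of_eq_neg {A : Type*} [AddCommGroup A] [Module ℂ A] {a : A} (h : a = -a) :
    a = 0 := by
  have h2 : (2 : ℂ) • a = 0 := by
    rw [two_smul]; exact add_eq_zero_iff_eq_neg.mpr h
  exact (smul_eq_zero.mp h2).resolve_left two_ne_zero

/-! ## The vector `Φ(v)` -/

section Phi

variable {V : Type*} [AddCommGroup V] [Module ℂ V] [LieRingModule sl5 V] [LieModule ℂ sl5 V]
variable {W : Type*} [AddCommGroup W] [Module ℂ W] [LieRingModule sl5 W] [LieModule ℂ sl5 W]

/-- The map `w ↦ 1 ⊗ w`. -/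
def vone : W →ₗ[ℂ] Verma W :=
  (vermaRel W).mkQ.restrictScalars ℂ ∘ₗ TensorProduct.mk ℂ U W 1

theorem vone_apply (w : W) : vone w = Verma.tmul 1 w := rfl

theorem tmul_eq_smul_vone (u : U) (w : W) : Verma.tmul u w = u • vone w := by
  rw [vone_apply, Verma.tmul, Verma.tmul, ← map_smul, TensorProduct.smul_tmul', smul_eq_mul,
    mul_one]

omit [LieRingModule sl5 V] [LieModule ℂ sl5 V] in
theorem applyPhi_tmul (u : U) (θ : V →ₗ[ℂ] W) (v : V) :
    applyPhi (u ⊗ₜ[ℂ] θ) v = u • vone (θ v) := by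
  rw [← tmul_eq_smul_vone]; rfl

omit [LieRingModule sl5 V] [LieModule ℂ sl5 V] in
theorem applyPhi_add (Φ Φ' : U ⊗[ℂ] (V →ₗ[ℂ] W)) (v : V) :
    applyPhi (Φ + Φ') v = applyPhi Φ v + applyPhi Φ' v := by
  simp only [applyPhi, map_add]

omit [LieRingModule sl5 V] [LieModule ℂ sl5 V] in
theorem applyPhi_sum {κ : Type*} (s : Finset κ) (Φ : κ → U ⊗[ℂ] (V →ₗ[ℂ] W)) (v : V) :
    applyPhi (∑ i ∈ s, Φ i) v = ∑ i ∈ s, applyPhi (Φ i) v := by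
  simp only [applyPhi, map_sum]

/-- The vector `Φ(v)` as a sum over all sequences of pairs. -/
def phiSum (θ : Idx 3 → (V →ₗ[ℂ] W)) (θ' : Fin 5 → Idx 1 → (V →ₗ[ℂ] W)) (v : V) : Verma W :=
  ∑ P, ∑ Q, ∑ R, dd P • dd Q • dd R • vone (θ ![P, Q, R] v)
    -- The factor 24 is |B_3| / |B_1| = 48 / 2; with it both sums are the same multiple of the sums
    -- over orbits.
    + ∑ t, ∑ P, del t • dd P • vone ((24 : ℂ) • θ' t ![P] v)

omit [LieRingModule sl5 V] [LieModule ℂ sl5 V] in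
-- Summing over sequences counts each orbit with all its orientations and orderings: `2^3 · 3! = 48`
-- of them in length three, 2 in length one. The six orderings of a sorted sequence combine to `6
-- ω_I` by `six_smul_omega`. Sequences with a pair `(i, i)` or with a repeated pair contribute
-- nothing, because alternating families vanish there.
theorem phiSum_eq {θ : Idx 3 → (V →ₗ[ℂ] W)} {θ' : Fin 5 → Idx 1 → (V →ₗ[ℂ] W)}
    (hθ : IsAlternating θ) (hθ' : ∀ t, IsAlternating (θ' t)) (v : V) :
    phiSum θ θ' v = (48 : ℂ) • applyPhi (Phi3 θ θ') v := by
  have z0 : ∀ i Q R, θ ![(i, i), Q, R] = 0 := fun i Q R =>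
    eq_zero_of_eq_neg (hθ.swap_zero (i, i) Q R)
  have z1 : ∀ i Q R, θ ![Q, (i, i), R] = 0 := fun i Q R =>
    eq_zero_of_eq_neg (hθ.swap_one Q (i, i) R)
  have z2 : ∀ i Q R, θ ![Q, R, (i, i)] = 0 := fun i Q R =>
    eq_zero_of_eq_neg (hθ.swap_two Q R (i, i))
  have z3 : ∀ t i, θ' t ![(i, i)] = 0 := fun t i => eq_zero_of_eq_neg ((hθ' t).swap_single (i, i))
  have e01 : ∀ P R, θ ![P, P, R] = 0 := fun P R => eq_zero_of_eq_neg (hθ.perm_zero_one P P R)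
  have e12 : ∀ P Q, θ ![P, Q, Q] = 0 := fun P Q => eq_zero_of_eq_neg (hθ.perm_one_two P Q Q)
  have e02 : ∀ P Q, θ ![P, Q, P] = 0 := fun P Q => by rw [hθ.perm_one_two, e01, neg_zero]
  have h1 : ∑ t, ∑ P, del t • dd P • vone ((24 : ℂ) • θ' t ![P] v) =
      (48 : ℂ) • ∑ t, ∑ I ∈ orbitReps 1, (del t * omega I) • vone (θ' t I v) := by
    rw [Finset.smul_sum]
    refine Finset.sum_congr rfl fun t _ => ?_
    rw [sum_orbitReps_one, sum_pairs_symm]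
    · rw [Finset.smul_sum, Finset.smul_sum]
      refine Finset.sum_congr rfl fun P _ => ?_
      rw [omega_one, map_smul, smul_comm (dd P) (24 : ℂ), smul_comm (del t) (24 : ℂ), smul_smul,
        smul_smul]
      norm_num
    · intro P
      rw [dd_swap, (hθ' t).swap_single, LinearMap.neg_apply, smul_neg, map_neg, smul_neg, neg_smul,
        neg_neg]
    · intro i
      rw [z3, LinearMap.zero_apply, smul_zero, map_zero, smul_zero, smul_zero]
  set T : Fin 5 × Fin 5 → Fin 5 × Fin 5 → Fin 5 × Fin 5 → Verma W :=
    fun P Q R => (dd P * dd Q * dd R) • vone (θ ![P, Q, R] v) with hT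
  have hTs0 : ∀ P Q R, T P.swap Q R = T P Q R := fun P Q R => by
    simp only [hT, dd_swap, hθ.swap_zero, LinearMap.neg_apply, map_neg, neg_mul, smul_neg,
      neg_smul, neg_neg]
  have hTs1 : ∀ P Q R, T P Q.swap R = T P Q R := fun P Q R => by
    simp only [hT, dd_swap, hθ.swap_one, LinearMap.neg_apply, map_neg, neg_mul, mul_neg, smul_neg,
      neg_smul, neg_neg]
  have hTs2 : ∀ P Q R, T P Q R.swap = T P Q R := fun P Q R => by
    simp only [hT, dd_swap, hθ.swap_two, LinearMap.neg_apply, map_neg, mul_neg, smul_neg,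
      neg_smul, neg_neg]
  have h2 : ∑ P, ∑ Q, ∑ R, T P Q R = (48 : ℂ) • ∑ I ∈ orbitReps 3, omega I • vone (θ I v) := by
    have c : ∑ P, ∑ Q, ∑ R, T P Q R = (8 : ℂ) • ∑ P with P.1 < P.2, ∑ Q with Q.1 < Q.2,
        ∑ R with R.1 < R.2, T P Q R := by
      rw [sum_pairs_symm (fun P => by simp only [hTs0]) (fun i => by simp [hT, z0])]
      have c2 : ∀ P, ∑ Q, ∑ R, T P Q R = (4 : ℂ) • ∑ Q with Q.1 < Q.2, ∑ R with R.1 < R.2,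
          T P Q R := by
        intro P
        rw [sum_pairs_symm (fun Q => by simp only [hTs1]) (fun i => by simp [hT, z1])]
        have c3 : ∀ Q, ∑ R, T P Q R = (2 : ℂ) • ∑ R with R.1 < R.2, T P Q R :=
          fun Q => sum_pairs_symm (fun R => hTs2 P Q R) (fun i => by simp [hT, z2])
        simp only [c3, ← Finset.smul_sum, smul_smul]
        norm_num
      simp only [c2, ← Finset.smul_sum, smul_smul]
      norm_num
    have s : ∀ P Q R : Fin 5 × Fin 5, T P Q R + T P R Q + T Q P R + T Q R P + T R P Q + T R Q P =
        (6 : ℂ) • (omega ![P, Q, R] • vone (θ ![P, Q, R] v)) := by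
      intro P Q R
      rw [← smul_assoc, six_smul_omega]
      simp only [hT, hθ.perm_one_two P Q R, hθ.perm_zero_one P Q R, hθ.perm_one_two Q P R,
        hθ.perm_zero_one P R Q, hθ.perm_one_two R P Q, LinearMap.neg_apply, map_neg,
        neg_neg, add_smul, sub_smul, smul_neg]
      abel
    have f : ∀ F : Fin 5 × Fin 5 → Fin 5 × Fin 5 → Fin 5 × Fin 5 → Verma W,
        ∑ P with P.1 < P.2, ∑ Q with Q.1 < Q.2, ∑ R with R.1 < R.2, F P Q R =
          ∑ P, ∑ Q, ∑ R, if P.1 < P.2 ∧ Q.1 < Q.2 ∧ R.1 < R.2 then F P Q R else 0 := by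
      intro F
      simp only [Finset.sum_filter, ite_and, Finset.sum_ite_irrel, Finset.sum_const_zero]
    rw [c, f, sum_triples (toLex : Fin 5 × Fin 5 → _) toLex.injective, sum_orbitReps_three, f]
    · simp only [Finset.smul_sum]
      refine Finset.sum_congr rfl fun P _ => Finset.sum_congr rfl fun Q _ =>
        Finset.sum_congr rfl fun R _ => ?_
      by_cases hP : P.1 < P.2
      · by_cases hQ : Q.1 < Q.2
        · by_cases hR : R.1 < R.2
          · simp only [hP, hQ, hR, and_self, if_true, s]
            split_ifs
            · rw [smul_smul]; norm_num
            · rw [smul_zero, smul_zero]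
          · simp [hR]
        · simp [hQ]
      · simp [hP]
    · intro P R; simp [hT, e01]
    · intro P R; simp [hT, e12]
    · intro P R; simp [hT, e02]
  rw [phiSum, h1, Phi3, applyPhi_add, applyPhi_sum, applyPhi_sum, smul_add]
  simp only [applyPhi_sum, applyPhi_tmul]
  rw [← h2]
  simp only [hT, mul_smul]

end Phi

/-! ## Brackets with elements of `L_0` and with the forms `x_p d_{pq}` -/

theorem evenNonneg_slField (x : sl5) : EvenNonneg (slField x) := by
  intro i
  simp only [slField, map_sum, constantCoeff_smul', MvPowerSeries.constantCoeff_X, mul_zero,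
    Finset.sum_const_zero]

theorem pd_slField (x : sl5) (i j : Fin 5) :
    pd i ((slField x).1 j) = x.1 i j • (1 : PS) := by
  simp only [slField, map_sum]
  rw [Finset.sum_eq_single i]
  · rw [Derivation.map_smul, MvPowerSeries.pderiv_X_self]
  · intro k _ hk
    rw [Derivation.map_smul, MvPowerSeries.pderiv_X_of_ne hk, smul_zero]
  · simp

theorem linearPart_slField (x : sl5) : linearPart (slField x) = x := by
  refine Subtype.ext (Matrix.ext fun i j => ?_)
  rw [linearPart_apply, pd_slField, constantCoeff_smul', map_one, mul_one]

theorem evenOddL_slField_dForm (x : sl5) (i j : Fin 5) : evenOddL (slField x) (dForm (i, j)) =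
    ∑ k, (x.1 k i • dForm (k, j) + x.1 k j • dForm (i, k)) := by
  refine Subtype.ext (funext fun a => funext fun b => ?_)
  rw [Submodule.coe_sum, Finset.sum_apply, Finset.sum_apply]
  change lieDer (slField x).1 (dForm (i, j)).1 a b = ∑ k,
    (x.1 k i • (dForm (k, j)).1 a b + x.1 k j • (dForm (i, k)).1 a b)
  simp only [lieDer, pd_dForm, mul_zero, zero_add, pd_slField]
  simp only [dForm, Prod.mk.injEq, ite_and,
    smul_sub, mul_sub, smul_ite, mul_ite, mul_one, mul_zero, smul_zero, Finset.sum_add_distrib,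
    Finset.sum_sub_distrib, Finset.sum_ite_eq, Finset.sum_ite_eq', Finset.mem_univ, if_true,
    Finset.sum_ite_irrel, Finset.sum_const_zero]
  ring

theorem evenEvenL_slField_delField (x : sl5) (t : Fin 5) :
    evenEvenL (slField x) (delField t) = -∑ k, x.1 t k • delField k := by
  rw [evenEvenL_neg]
  refine congrArg _ (Subtype.ext (funext fun i => ?_))
  rw [evenEvenL_delField, pd_slField, Submodule.coe_sum, Finset.sum_apply]
  simp [delField]

/-- The closed two-form `dg ∧ dx_j`. -/
def eta (g : PS) (j : Fin 5) : OddPart :=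
  ⟨fun a b => (if b = j then pd a g else 0) - (if a = j then pd b g else 0), by
    refine ⟨fun a b => by ring, fun a b c => ?_⟩
    have h : ∀ (i k : Fin 5) (p : Prop) [Decidable p],
        pd i (if p then pd k g else 0) = if p then pd i (pd k g) else 0 := by
      intro i k p _
      split_ifs <;> simp
    simp only [map_sub, h]
    rw [pd_comm a b, pd_comm b c, pd_comm c a]
    ring⟩

theorem eta_apply (g : PS) (j a b : Fin 5) :
    (eta g j).1 a b = (if b = j then pd a g else 0) - (if a = j then pd b g else 0) := rfl

/-- The form `x_p d_{pq}`. -/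
def zForm (p q : Fin 5) : OddPart :=
  (1 / 2 : ℂ) • eta (MvPowerSeries.X p * MvPowerSeries.X p) q

theorem pd_X (i j : Fin 5) : pd i (MvPowerSeries.X j : PS) = if i = j then 1 else 0 := by
  split_ifs with h
  · rw [h, MvPowerSeries.pderiv_X_self]
  · rw [MvPowerSeries.pderiv_X_of_ne (Ne.symm h)]

theorem zForm_apply (p q a b : Fin 5) :
    (zForm p q).1 a b = MvPowerSeries.X p * (dForm (p, q)).1 a b := by
  have h : ∀ a, pd a (MvPowerSeries.X p * MvPowerSeries.X p : PS) =
      if a = p then (2 : ℂ) • MvPowerSeries.X p else 0 := by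
    intro a
    rw [Derivation.leibniz, pd_X]
    split_ifs <;> simp [two_smul]
  change (1 / 2 : ℂ) • (eta _ q).1 a b = _
  rw [eta_apply, h, h]
  simp only [dForm, Prod.mk.injEq]
  simp only [ite_and, mul_sub, mul_ite, mul_one, mul_zero, smul_sub, smul_ite, smul_smul, smul_zero]
  rw [show (1 / 2 * 2 : ℂ) = 1 by norm_num, one_smul]
  congr 1 <;> split_ifs <;> rfl

theorem oddNonneg_zForm (p q : Fin 5) : OddNonneg (zForm p q) := by
  intro i j
  rw [zForm_apply, map_mul, MvPowerSeries.constantCoeff_X, zero_mul]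

theorem evenOddL_delField_zForm (t p q : Fin 5) : evenOddL (delField t) (zForm p q) =
    if t = p then dForm (p, q) else 0 := by
  refine Subtype.ext (funext fun i => funext fun j => ?_)
  rw [evenOddL_delField, zForm_apply, Derivation.leibniz, pd_dForm, smul_zero, zero_add, pd_X]
  split_ifs <;> simp

theorem slField_xdel_apply {p γ : Fin 5} (h : p ≠ γ) (j : Fin 5) :
    (slField (xdel p γ)).1 j = if j = γ then MvPowerSeries.X p else 0 := by
  simp only [slField, xdel, dif_pos h, LieAlgebra.SpecialLinear.val_single]
  simp only [Matrix.single_apply, ite_smul, one_smul, zero_smul, ite_and,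
    Finset.sum_ite_eq, Finset.mem_univ, if_true, eq_comm]

theorem xdel_apply {p γ : Fin 5} (h : p ≠ γ) (i j : Fin 5) :
    (xdel p γ).1 i j = if i = p ∧ j = γ then 1 else 0 := by
  simp only [xdel, dif_pos h, LieAlgebra.SpecialLinear.val_single, Matrix.single_apply, eq_comm]

theorem oddOddL_zForm_dForm (p q : Fin 5) (P : Fin 5 × Fin 5) : oddOddL (zForm p q) (dForm P) =
    ∑ γ, (eps ![p, q, P.1, P.2, γ] : ℂ) • slField (xdel p γ) := by
  refine Subtype.ext (funext fun t => ?_)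
  have h1 : (oddOddL (zForm p q) (dForm P)).1 t =
      MvPowerSeries.X p * (oddOddL (dForm (p, q)) (dForm P)).1 t := by
    rw [oddOddL_apply_coe, oddOddL_apply_coe, mul_smul_comm]
    simp only [zForm_apply, Finset.mul_sum]
    refine congrArg _ ?_
    refine Finset.sum_congr rfl fun i _ => Finset.sum_congr rfl fun j _ =>
      Finset.sum_congr rfl fun k _ => Finset.sum_congr rfl fun l _ => ?_
    rw [mul_assoc (MvPowerSeries.X p), mul_left_comm]
  rw [h1, oddOddL_dForm]
  simp only [Submodule.coe_sum, Finset.sum_apply, Finset.mul_sum]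
  refine Finset.sum_congr rfl fun γ _ => ?_
  change MvPowerSeries.X p * ((eps ![p, q, P.1, P.2, γ] : ℂ) • (delField γ).1 t) =
    (eps ![p, q, P.1, P.2, γ] : ℂ) • (slField (xdel p γ)).1 t
  by_cases h : p = γ
  · subst h; simp
  · rw [slField_xdel_apply h, mul_smul_comm]
    simp [delField]

/-! ## The action of `L_{≥0}` on the generating vectors -/

section Action

variable {W : Type*} [AddCommGroup W] [Module ℂ W] [LieRingModule sl5 W] [LieModule ℂ sl5 W]

theorem ι_ev_smul_vone {X : EvenPart} (hX : EvenNonneg X) (w : W) :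
    ι (ev X) • vone w = vone ⁅linearPart X, w⁆ := by
  rw [← tmul_eq_smul_vone, vone_apply, Verma.tmul, Verma.tmul, ← sub_eq_zero, ← map_sub,
    Submodule.mkQ_apply, Submodule.Quotient.mk_eq_zero]
  exact Submodule.subset_span (Or.inl ⟨X, w, hX, rfl⟩)

theorem ι_od_smul_vone {f : OddPart} (hf : OddNonneg f) (w : W) : ι (od f) • vone w = 0 := by
  rw [← tmul_eq_smul_vone, Verma.tmul, Submodule.mkQ_apply, Submodule.Quotient.mk_eq_zero]
  exact Submodule.subset_span (Or.inr ⟨f, w, hf, rfl⟩)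

/-- The element of `U` given by `x ∈ L_0`. -/
def slU (x : sl5) : U := ι (ev (slField x))

theorem slU_smul_vone (x : sl5) (w : W) : slU x • vone w = vone ⁅x, w⁆ := by
  rw [slU, ι_ev_smul_vone (evenNonneg_slField x), linearPart_slField]

theorem slU_mul_dd (x : sl5) (P : Fin 5 × Fin 5) : slU x * dd P =
    dd P * slU x + ∑ k, (x.1 k P.1 • dd (k, P.2) + x.1 k P.2 • dd (P.1, k)) := by
  rw [slU, dd, ι_ev_mul_ι_od, evenOddL_slField_dForm, ← ιOdd_apply (∑ _, _)]
  simp only [map_sum, map_add, map_smul]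
  rfl

theorem slU_mul_del (x : sl5) (t : Fin 5) : slU x * del t =
    del t * slU x - ∑ k, x.1 t k • del k := by
  rw [slU, del, ι_ev_mul_ι_ev, evenEvenL_slField_delField, ← ιEven_apply (-_)]
  simp only [map_sum, map_neg, map_smul, ← sub_eq_add_neg]
  rfl

theorem zForm_mul_dd (p q : Fin 5) (P : Fin 5 × Fin 5) : ι (od (zForm p q)) * dd P =
    ∑ γ, (eps ![p, q, P.1, P.2, γ] : ℂ) • slU (xdel p γ) - dd P * ι (od (zForm p q)) := by
  rw [dd, eq_sub_iff_add_eq, ι_od_mul_ι_od, oddOddL_zForm_dForm, ← ιEven_apply]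
  simp only [map_sum, map_smul]
  rfl

theorem zForm_mul_del (p q t : Fin 5) : ι (od (zForm p q)) * del t =
    del t * ι (od (zForm p q)) - if t = p then dd (p, q) else 0 := by
  rw [del, eq_sub_iff_add_eq, ι_ev_mul_ι_od, evenOddL_delField_zForm, ← ιOdd_apply (ite _ _ _)]
  congr 1
  split_ifs
  · rfl
  · rw [map_zero]

variable {M N : Type*} [AddCommGroup M] [Module ℂ M] [AddCommGroup N] [Module ℂ N]

/-- The action of `x ∈ L_0` on families indexed by pairs which is dual to its action on the
elements `d_P`. -/
def star (x : sl5) (F : Fin 5 × Fin 5 → M) (P : Fin 5 × Fin 5) : M :=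
  ∑ k, (x.1 P.1 k • F (k, P.2) + x.1 P.2 k • F (P.1, k))

theorem map_star (f : M →ₗ[ℂ] N) (x : sl5) (F : Fin 5 × Fin 5 → M) (P : Fin 5 × Fin 5) :
    star x (fun Q => f (F Q)) P = f (star x F P) := by
  simp only [star, map_sum, map_add, map_smul]

theorem star_sum {κ : Type*} (s : Finset κ) (x : sl5) (F : κ → Fin 5 × Fin 5 → M)
    (P : Fin 5 × Fin 5) : star x (fun Q => ∑ i ∈ s, F i Q) P = ∑ i ∈ s, star x (F i) P := by
  simp only [star, Finset.smul_sum, ← Finset.sum_add_distrib]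
  rw [Finset.sum_comm]

theorem smul_star (u : U) (x : sl5) (F : Fin 5 × Fin 5 → Verma W) (P : Fin 5 × Fin 5) :
    star x (fun Q => u • F Q) P = u • star x F P := by
  simp only [star, Finset.smul_sum, smul_add, smul_comm u (_ : ℂ)]

/-- Passing `x` to the right of `d_P` replaces an index of the pair; reindexing the sum moves this
replacement to the coefficients as the transposed action `star`. -/
theorem slU_smul_sum_dd (x : sl5) (F : Fin 5 × Fin 5 → Verma W) :
    slU x • ∑ P, dd P • F P = ∑ P, dd P • (star x F P + slU x • F P) := by
  have h1 : ∑ P : Fin 5 × Fin 5, ∑ k, x.1 k P.1 • dd (k, P.2) • F P =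
      ∑ P : Fin 5 × Fin 5, ∑ k, x.1 P.1 k • dd P • F (k, P.2) := by
    rw [Fintype.sum_prod_type, Fintype.sum_prod_type]
    exact (Finset.sum_congr rfl fun i _ => Finset.sum_comm).trans
      (Finset.sum_comm.trans (Finset.sum_congr rfl fun i _ => Finset.sum_comm))
  have h2 : ∑ P : Fin 5 × Fin 5, ∑ k, x.1 k P.2 • dd (P.1, k) • F P =
      ∑ P : Fin 5 × Fin 5, ∑ k, x.1 P.2 k • dd P • F (P.1, k) := by
    rw [Fintype.sum_prod_type, Fintype.sum_prod_type]
    exact Finset.sum_congr rfl fun i _ => Finset.sum_comm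
  simp only [Finset.smul_sum, smul_smul, slU_mul_dd, add_smul, Finset.sum_smul, smul_add,
    Finset.sum_add_distrib, star, smul_assoc, smul_comm (dd _) (_ : ℂ)]
  rw [h1, h2, add_comm]

theorem slU_smul_sum_del (x : sl5) (F : Fin 5 → Verma W) :
    slU x • ∑ t, del t • F t = ∑ t, del t • (slU x • F t - ∑ k, x.1 k t • F k) := by
  simp only [Finset.smul_sum, smul_smul, slU_mul_del, sub_smul, Finset.sum_smul, smul_sub,
    Finset.sum_sub_distrib, smul_assoc, smul_comm (del _) (_ : ℂ)]
  rw [Finset.sum_comm (f := fun i j => x.1 i j • del j • F i)]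

end Action

/-! ## Consequences of the invariance under `L_0` -/

section Invariance

variable {V : Type*} [AddCommGroup V] [Module ℂ V] [LieRingModule sl5 V] [LieModule ℂ sl5 V]
variable {W : Type*} [AddCommGroup W] [Module ℂ W] [LieRingModule sl5 W] [LieModule ℂ sl5 W]

theorem applyPhi_L0act (x : sl5) (Φ : U ⊗[ℂ] (V →ₗ[ℂ] W)) (v : V) :
    applyPhi (L0act x Φ) v = slU x • applyPhi Φ v - applyPhi Φ ⁅x, v⁆ := by
  induction Φ with
  | zero => simp [applyPhi]
  | add Φ Φ' h h' =>
    rw [map_add, applyPhi_add, applyPhi_add, applyPhi_add, h, h', smul_add]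
    abel
  | tmul u f =>
    have h : L0act x (u ⊗ₜ[ℂ] f) = (slU x * u - u * slU x) ⊗ₜ[ℂ] f + u ⊗ₜ[ℂ] ⁅x, f⁆ := rfl
    rw [h, applyPhi_add, applyPhi_tmul, applyPhi_tmul, applyPhi_tmul, applyPhi_tmul,
      LieHom.lie_apply, map_sub, ← slU_smul_vone, sub_smul, mul_smul, mul_smul, smul_sub]
    abel

theorem slU_smul_sum_one (x : sl5) (G : Fin 5 × Fin 5 → W) :
    slU x • ∑ R, dd R • vone (G R) = ∑ R, dd R • vone (⁅x, G R⁆ + star x G R) := by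
  rw [slU_smul_sum_dd]
  refine Finset.sum_congr rfl fun R _ => ?_
  rw [map_star, slU_smul_vone, map_add, add_comm]

theorem slU_smul_sum_two (x : sl5) (G : Fin 5 × Fin 5 → Fin 5 × Fin 5 → W) :
    slU x • ∑ Q, dd Q • ∑ R, dd R • vone (G Q R) = ∑ Q, dd Q • ∑ R, dd R •
      vone (⁅x, G Q R⁆ + star x (fun Q' => G Q' R) Q + star x (G Q) R) := by
  rw [slU_smul_sum_dd]
  refine Finset.sum_congr rfl fun Q _ => congrArg (dd Q • ·) ?_
  rw [slU_smul_sum_one, star_sum, ← Finset.sum_add_distrib]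
  refine Finset.sum_congr rfl fun R _ => ?_
  rw [smul_star, map_star, ← smul_add, ← map_add]
  refine congrArg (fun w => dd R • vone w) ?_
  abel

theorem slU_smul_sum_three (x : sl5) (G : Fin 5 × Fin 5 → Fin 5 × Fin 5 → Fin 5 × Fin 5 → W) :
    slU x • ∑ P, dd P • ∑ Q, dd Q • ∑ R, dd R • vone (G P Q R) =
      ∑ P, dd P • ∑ Q, dd Q • ∑ R, dd R • vone (⁅x, G P Q R⁆ + star x (fun P' => G P' Q R) P
        + star x (fun Q' => G P Q' R) Q + star x (G P Q) R) := by
  rw [slU_smul_sum_dd]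
  refine Finset.sum_congr rfl fun P _ => congrArg (dd P • ·) ?_
  rw [slU_smul_sum_two, star_sum, ← Finset.sum_add_distrib]
  refine Finset.sum_congr rfl fun Q _ => ?_
  rw [smul_star, star_sum, ← smul_add, ← Finset.sum_add_distrib]
  refine congrArg (dd Q • ·) (Finset.sum_congr rfl fun R _ => ?_)
  rw [smul_star, map_star, ← smul_add, ← map_add]
  refine congrArg (fun w => dd R • vone w) ?_
  abel

theorem sum_dd_two (F : Fin 5 × Fin 5 → Fin 5 × Fin 5 → Verma W) :
    ∑ P, ∑ Q, dd P • dd Q • F P Q = ∑ P, dd P • ∑ Q, dd Q • F P Q := by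
  simp only [Finset.smul_sum]

theorem sum_dd_three (F : Fin 5 × Fin 5 → Fin 5 × Fin 5 → Fin 5 × Fin 5 → Verma W) :
    ∑ P, ∑ Q, ∑ R, dd P • dd Q • dd R • F P Q R =
      ∑ P, dd P • ∑ Q, dd Q • ∑ R, dd R • F P Q R := by
  simp only [Finset.smul_sum]

theorem sum_del_dd (F : Fin 5 → Fin 5 × Fin 5 → Verma W) :
    ∑ t, ∑ P, del t • dd P • F t P = ∑ t, del t • ∑ P, dd P • F t P := by
  simp only [Finset.smul_sum]

theorem star_neg {M : Type*} [AddCommGroup M] [Module ℂ M] (x : sl5) (F : Fin 5 × Fin 5 → M)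
    (P : Fin 5 × Fin 5) : star x (fun Q => -F Q) P = -star x F P :=
  map_star (-LinearMap.id) x F P

theorem star_smul {M : Type*} [AddCommGroup M] [Module ℂ M] (c : ℂ) (x : sl5)
    (F : Fin 5 × Fin 5 → M) (P : Fin 5 × Fin 5) :
    star x (fun Q => c • F Q) P = c • star x F P :=
  map_star (LinearMap.lsmul ℂ M c) x F P

theorem star_swap {M : Type*} [AddCommGroup M] [Module ℂ M] (x : sl5) {F : Fin 5 × Fin 5 → M}
    (hF : ∀ P, F P.swap = -F P) (P : Fin 5 × Fin 5) : star x F P.swap = -star x F P := by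
  simp only [star, ← Finset.sum_neg_distrib]
  refine Finset.sum_congr rfl fun k _ => ?_
  have h1 := hF (k, P.1)
  have h2 := hF (P.2, k)
  simp only [Prod.swap_prod_mk] at h1 h2
  rw [Prod.fst_swap, Prod.snd_swap, h1, h2, smul_neg, smul_neg, neg_add_rev, neg_neg, neg_neg,
    add_comm]

theorem star_congr_neg {M : Type*} [AddCommGroup M] [Module ℂ M] (x : sl5)
    {F G : Fin 5 × Fin 5 → M} (h : ∀ P, F P = -G P) (P : Fin 5 × Fin 5) :
    star x F P = -star x G P := by
  rw [← star_neg]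
  exact congrArg (fun F => star x F P) (funext h)

variable {θ : Idx 3 → (V →ₗ[ℂ] W)} {θ' : Fin 5 → Idx 1 → (V →ₗ[ℂ] W)}

/-- This reads `x.Φ = 0` coefficient by coefficient: evaluate at `v`, move `x` to the right through
`phiSum`, and use `verma_indep_three`. Later it serves to trade the index replacements `star` for
the derivative `x.θ`. -/
theorem invariance (hθ : IsAlternating θ) (hθ' : ∀ t, IsAlternating (θ' t)) (x : sl5)
    (hinv : L0act x (Phi3 θ θ') = 0) (v : V) :
    (∀ P Q R, ⁅x, θ ![P, Q, R]⁆ v + star x (fun P' => θ ![P', Q, R] v) P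
      + star x (fun Q' => θ ![P, Q', R] v) Q + star x (fun R' => θ ![P, Q, R'] v) R = 0) ∧
    ∀ t P, ⁅x, θ' t ![P]⁆ v + star x (fun P' => θ' t ![P'] v) P
      - ∑ k, x.1 k t • θ' k ![P] v = 0 := by
  have h0 : slU x • phiSum θ θ' v - phiSum θ θ' ⁅x, v⁆ = 0 := by
    rw [phiSum_eq hθ hθ', phiSum_eq hθ hθ', smul_comm (slU x) (48 : ℂ), ← smul_sub,
      ← applyPhi_L0act, hinv]
    simp [applyPhi]
  have key : (∀ P Q R, ⁅x, θ ![P, Q, R]⁆ v + star x (fun P' => θ ![P', Q, R] v) P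
      + star x (fun Q' => θ ![P, Q', R] v) Q + star x (fun R' => θ ![P, Q, R'] v) R = 0) ∧
    ∀ t P, (24 : ℂ) • (⁅x, θ' t ![P]⁆ v + star x (fun P' => θ' t ![P'] v) P
      - ∑ k, x.1 k t • θ' k ![P] v) = 0 := by
    apply verma_indep_three
    · intro P Q R
      rw [hθ.swap_zero, lie_neg, LinearMap.neg_apply, star_swap x fun P' => by
          rw [hθ.swap_zero, LinearMap.neg_apply],
        star_congr_neg x (fun Q' => by rw [hθ.swap_zero, LinearMap.neg_apply]) Q,
        star_congr_neg x (fun R' => by rw [hθ.swap_zero, LinearMap.neg_apply]) R]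
      abel
    · intro P Q R
      rw [hθ.perm_zero_one, lie_neg, LinearMap.neg_apply,
        star_congr_neg x (fun Q' => by rw [hθ.perm_zero_one, LinearMap.neg_apply]) Q,
        star_congr_neg x (fun Q' => by rw [hθ.perm_zero_one, LinearMap.neg_apply]) P,
        star_congr_neg x (fun R' => by rw [hθ.perm_zero_one, LinearMap.neg_apply]) R]
      abel
    · intro P Q R
      rw [hθ.perm_one_two, lie_neg, LinearMap.neg_apply,
        star_congr_neg x (fun Q' => by rw [hθ.perm_one_two, LinearMap.neg_apply]) P,
        star_congr_neg x (fun Q' => by rw [hθ.perm_one_two, LinearMap.neg_apply]) R,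
        star_congr_neg x (fun R' => by rw [hθ.perm_one_two, LinearMap.neg_apply]) Q]
      abel
    · intro t P
      simp only [(hθ' _).swap_single, LinearMap.neg_apply, lie_neg]
      rw [star_swap x fun P => by rw [(hθ' t).swap_single, LinearMap.neg_apply], ← smul_neg]
      refine congrArg _ ?_
      simp only [smul_neg, Finset.sum_neg_distrib]
      abel
    · rw [← h0]
      simp only [phiSum, sum_dd_three, sum_del_dd, smul_add, ← vone_apply]
      rw [slU_smul_sum_three, slU_smul_sum_del, add_sub_add_comm, ← Finset.sum_sub_distrib,
        ← Finset.sum_sub_distrib]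
      refine congrArg₂ _ (Finset.sum_congr rfl fun P _ => ?_) (Finset.sum_congr rfl fun t _ => ?_)
      · rw [← smul_sub, ← Finset.sum_sub_distrib]
        refine congrArg _ (Finset.sum_congr rfl fun Q _ => ?_)
        rw [← smul_sub, ← Finset.sum_sub_distrib]
        refine congrArg _ (Finset.sum_congr rfl fun R _ => ?_)
        rw [← smul_sub, ← map_sub, LieHom.lie_apply]
        refine congrArg (fun w => dd R • vone w) ?_
        abel
      · rw [slU_smul_sum_one, ← smul_sub, sub_sub]
        refine congrArg _ ?_
        simp only [Finset.smul_sum]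
        rw [Finset.sum_comm, ← Finset.sum_add_distrib, ← Finset.sum_sub_distrib]
        refine Finset.sum_congr rfl fun R _ => ?_
        simp only [smul_comm _ (dd R), ← map_smul, ← Finset.smul_sum, ← map_sum, ← smul_add,
          ← smul_sub, ← map_sub, ← map_add]
        refine congrArg (fun w => dd R • vone w) ?_
        simp only [map_smul]
        rw [LieHom.lie_apply, lie_smul,
          star_smul]
        simp only [smul_sub, smul_add, Finset.smul_sum, smul_comm (_ : ℂ) (24 : ℂ)]
        abel
  refine ⟨key.1, fun t P => (smul_eq_zero.mp (key.2 t P)).resolve_left (by norm_num)⟩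

end Invariance

/-! ## The action of `x_p d_{pq}` on `Φ(v)` -/

section ZAction

variable {V : Type*} [AddCommGroup V] [Module ℂ V] [LieRingModule sl5 V] [LieModule ℂ sl5 V]
variable {W : Type*} [AddCommGroup W] [Module ℂ W] [LieRingModule sl5 W] [LieModule ℂ sl5 W]

/-- The structure constant of `x_γ ∂_p` in `[x_p d_{pq}, d_P]`, `s = (P, γ)`. -/
def zCoef (p q : Fin 5) (s : (Fin 5 × Fin 5) × Fin 5) : ℂ := eps ![p, q, s.1.1, s.1.2, s.2]

theorem sum_smul_sum_dd {κ : Type*} (s : Finset κ) (c : κ → ℂ) (F : κ → Fin 5 × Fin 5 → Verma W) :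
    ∑ i ∈ s, c i • ∑ R, dd R • F i R = ∑ R, dd R • ∑ i ∈ s, c i • F i R := by
  simp only [Finset.smul_sum, smul_comm (_ : ℂ) (dd _)]
  exact Finset.sum_comm

theorem sum_smul_vone {κ : Type*} (s : Finset κ) (c : κ → ℂ) (F : κ → W) :
    ∑ i ∈ s, c i • vone (F i) = vone (∑ i ∈ s, c i • F i) := by
  simp only [map_sum, map_smul]

theorem zForm_smul_sum_dd (p q : Fin 5) (F : Fin 5 × Fin 5 → Verma W) :
    ι (od (zForm p q)) • ∑ P, dd P • F P =
      ∑ s, zCoef p q s • slU (xdel p s.2) • F s.1 - ∑ P, dd P • ι (od (zForm p q)) • F P := by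
  have h : ∑ s, zCoef p q s • slU (xdel p s.2) • F s.1 =
      ∑ P, ∑ γ, (eps ![p, q, P.1, P.2, γ] : ℂ) • slU (xdel p γ) • F P := Fintype.sum_prod_type _
  rw [h]
  simp only [Finset.smul_sum, smul_smul, zForm_mul_dd, sub_smul, Finset.sum_smul,
    Finset.sum_sub_distrib, smul_assoc]

theorem zForm_smul_sum_one (p q : Fin 5) (G : Fin 5 × Fin 5 → W) :
    ι (od (zForm p q)) • ∑ R, dd R • vone (G R) =
      vone (∑ s, zCoef p q s • ⁅xdel p s.2, G s.1⁆) := by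
  rw [zForm_smul_sum_dd]
  simp only [ι_od_smul_vone (oddNonneg_zForm p q), smul_zero, Finset.sum_const_zero, sub_zero,
    slU_smul_vone, sum_smul_vone]

theorem zForm_smul_sum_two (p q : Fin 5) (G : Fin 5 × Fin 5 → Fin 5 × Fin 5 → W) :
    ι (od (zForm p q)) • ∑ Q, dd Q • ∑ R, dd R • vone (G Q R) =
      ∑ R, dd R • vone (∑ s, zCoef p q s • (⁅xdel p s.2, G s.1 R⁆ + star (xdel p s.2) (G s.1) R
        - ⁅xdel p s.2, G R s.1⁆)) := by
  rw [zForm_smul_sum_dd]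
  simp only [zForm_smul_sum_one, slU_smul_sum_one]
  rw [sum_smul_sum_dd, ← Finset.sum_sub_distrib]
  refine Finset.sum_congr rfl fun R _ => ?_
  rw [← smul_sub, sum_smul_vone, ← map_sub, ← Finset.sum_sub_distrib]
  simp only [smul_sub]

/-- The odd element `z` passes the three factors with alternating signs and finally kills the
generating vector. At each factor it leaves some `x_p ∂_γ`, which then acts on the remaining factors
and on `W`. -/
theorem zForm_smul_sum_three (p q : Fin 5)
    (G : Fin 5 × Fin 5 → Fin 5 × Fin 5 → Fin 5 × Fin 5 → W) :
    ι (od (zForm p q)) • ∑ P, dd P • ∑ Q, dd Q • ∑ R, dd R • vone (G P Q R) =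
      ∑ Q, dd Q • ∑ R, dd R • vone (∑ s, zCoef p q s • (⁅xdel p s.2, G s.1 Q R⁆
        + star (xdel p s.2) (fun Q' => G s.1 Q' R) Q + star (xdel p s.2) (G s.1 Q) R
        - (⁅xdel p s.2, G Q s.1 R⁆ + star (xdel p s.2) (G Q s.1) R
          - ⁅xdel p s.2, G Q R s.1⁆))) := by
  rw [zForm_smul_sum_dd]
  simp only [zForm_smul_sum_two, slU_smul_sum_two]
  rw [sum_smul_sum_dd, ← Finset.sum_sub_distrib]
  refine Finset.sum_congr rfl fun Q _ => ?_
  rw [← smul_sub, sum_smul_sum_dd, ← Finset.sum_sub_distrib]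
  refine congrArg _ (Finset.sum_congr rfl fun R _ => ?_)
  rw [← smul_sub, sum_smul_vone, ← map_sub, ← Finset.sum_sub_distrib]
  simp only [smul_sub]

/-- Only `∂_p` fails to commute with `x_p d_{pq}`. The resulting `-d_{pq}` is the source of the
terms with `χ_{pq}`. -/
theorem zForm_smul_sum_del (p q : Fin 5) (F : Fin 5 → Verma W) :
    ι (od (zForm p q)) • ∑ t, del t • F t =
      ∑ t, del t • ι (od (zForm p q)) • F t - dd (p, q) • F p := by
  simp only [Finset.smul_sum, smul_smul, zForm_mul_del, sub_smul, Finset.sum_sub_distrib, ite_smul,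
    zero_smul, Finset.sum_ite_eq', Finset.mem_univ, if_true]

theorem sum_chi_smul {M : Type*} [AddCommGroup M] [Module ℂ M] {p q : Fin 5} (h : p ≠ q)
    (F : Fin 5 × Fin 5 → M) : ∑ Q, chi (p, q) Q • F Q = F (p, q) - F (q, p) := by
  have h1 : ∀ Q : Fin 5 × Fin 5, chi (p, q) Q =
      (if Q = (p, q) then 1 else 0) - (if Q = (q, p) then 1 else 0) := by
    intro Q
    have hne : (p, q) ≠ (q, p) := fun hh => h (congrArg Prod.fst hh)
    simp only [chi, Prod.swap_prod_mk]
    by_cases h1 : Q = (p, q)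
    · simp [h1, hne]
    · split_ifs <;> simp
  simp only [h1, sub_smul, ite_smul, one_smul, zero_smul, Finset.sum_sub_distrib,
    Finset.sum_ite_eq', Finset.mem_univ, if_true]

theorem dd_eq_sum_chi {p q : Fin 5} (h : p ≠ q) :
    dd (p, q) = ∑ Q, ((1 / 2 : ℂ) * chi (p, q) Q) • dd Q := by
  have h2 : dd (q, p) = -dd (p, q) := dd_swap (p, q)
  simp only [mul_smul, ← Finset.smul_sum]
  rw [sum_chi_smul h dd, h2]
  module

variable {θ : Idx 3 → (V →ₗ[ℂ] W)} {θ' : Fin 5 → Idx 1 → (V →ₗ[ℂ] W)}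

theorem star_xdel {M : Type*} [AddCommGroup M] [Module ℂ M] {p γ : Fin 5} (h : p ≠ γ)
    (F : Fin 5 × Fin 5 → M) (P : Fin 5 × Fin 5) : star (xdel p γ) F P =
      (if P.1 = p then F (γ, P.2) else 0) + if P.2 = p then F (P.1, γ) else 0 := by
  simp only [star, xdel_apply h, ite_and, ite_smul, one_smul, zero_smul, Finset.sum_add_distrib,
    Finset.sum_ite_irrel, Finset.sum_ite_eq', Finset.sum_const_zero, Finset.mem_univ, if_true]

/-- Here `star` replaces an occurrence of `p` in the pair, while the coefficient `ε_{p,q,P,γ}`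
vanishes as soon as the pair contains `p`. If `γ = p`, the coefficient vanishes as well. -/
theorem zCoef_smul_star {M : Type*} [AddCommGroup M] [Module ℂ M] (p q : Fin 5)
    (F : Fin 5 × Fin 5 → M) (s : (Fin 5 × Fin 5) × Fin 5) :
    zCoef p q s • star (xdel p s.2) F s.1 = 0 := by
  by_cases h : p = s.2
  · simp [zCoef, ← h]
  · rw [star_xdel h]
    by_cases h1 : s.1.1 = p
    · simp [zCoef, h1]
    · by_cases h2 : s.1.2 = p
      · simp [zCoef, h2]
      · simp [h1, h2]

/-- The coefficient of `d_Q d_R` in `x_p d_{pq} Φ(v)`, before antisymmetrization. -/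
def zCoefTwo (θ : Idx 3 → (V →ₗ[ℂ] W)) (θ' : Fin 5 → Idx 1 → (V →ₗ[ℂ] W)) (p q : Fin 5) (v : V)
    (Q R : Fin 5 × Fin 5) : W :=
  ∑ s, zCoef p q s • ((3 : ℂ) • ⁅xdel p s.2, θ ![s.1, Q, R] v⁆ - ⁅xdel p s.2, θ ![s.1, Q, R]⁆ v
    + star (xdel p s.2) (fun R' => θ ![s.1, Q, R'] v) R) - (12 * chi (p, q) Q) • θ' p ![R] v

/-- By alternation the three places at which `z` can hit a factor give the same term, whence the 3
in `zCoefTwo`. The 12 there is the 24 of `phiSum` times the `1/2` needed to write `d_{pq}` as a sum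
over both orientations. -/
theorem zForm_smul_phiSum (hθ : IsAlternating θ) (hθ' : ∀ t, IsAlternating (θ' t))
    (hinv : ∀ x, L0act x (Phi3 θ θ') = 0) {p q : Fin 5} (hpq : p ≠ q) (v : V) :
    ι (od (zForm p q)) • phiSum θ θ' v =
      ∑ Q, ∑ R, dd Q • dd R • vone (zCoefTwo θ θ' p q v Q R)
        + ∑ t, del t • vone (∑ s, zCoef p q s • ⁅xdel p s.2, (24 : ℂ) • θ' t ![s.1] v⁆) := by
  rw [phiSum, sum_dd_three, sum_del_dd, smul_add, zForm_smul_sum_three, zForm_smul_sum_del,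
    sum_dd_two]
  simp only [zForm_smul_sum_one]
  rw [add_sub_assoc', add_sub_right_comm]
  refine congrArg₂ _ ?_ rfl
  rw [dd_eq_sum_chi hpq, Finset.sum_smul, ← Finset.sum_sub_distrib]
  refine Finset.sum_congr rfl fun Q _ => ?_
  rw [smul_assoc, ← smul_comm (dd Q) (_ : ℂ), ← smul_sub, Finset.smul_sum, ← Finset.sum_sub_distrib]
  refine congrArg _ (Finset.sum_congr rfl fun R _ => ?_)
  rw [← smul_comm (dd R) (_ : ℂ), ← smul_sub, ← map_smul, ← map_sub]
  refine congrArg (fun w => dd R • vone w) ?_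
  rw [zCoefTwo, smul_smul]
  congr 1
  · refine Finset.sum_congr rfl fun s _ => ?_
    -- The direct computation gives one replacement in `Q` and two in `R`. Invariance exchanges one
    -- replacement in each for `-x.θ`, leaving a single one in `R`; the replacement in the first
    -- slot drops out by `zCoef_smul_star`.
    have hi := (invariance hθ hθ' (xdel p s.2) (hinv _) v).1 s.1 Q R
    rw [star_congr_neg (xdel p s.2) (F := fun R' => θ ![Q, s.1, R'] v)
        (fun R' => by rw [hθ.perm_zero_one, LinearMap.neg_apply]) R, hθ.perm_zero_one s.1 Q R,
      LinearMap.neg_apply, lie_neg, hθ.perm_one_two Q s.1 R, hθ.perm_zero_one s.1 Q R, neg_neg]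
    have h3 := congrArg (zCoef p q s • ·) hi
    simp only [smul_add, zCoef_smul_star, smul_zero, add_zero] at h3
    rw [← sub_eq_zero, ← h3, ← smul_sub, ← smul_add, ← smul_add]
    refine congrArg _ ?_
    module
  · congr 1
    ring

end ZAction

/-! ### Coefficients of `x_p d_{pq} Φ(v)` in independent monomials -/

section SingularVectors

theorem sum_cyc {M : Type*} [AddCommMonoid M] {p q a b c : Fin 5} (h : [p, q, a, b, c].Nodup)
    (g : Fin 5 × Fin 5 × Fin 5 → M) :
    ∑ s ∈ cyc a b c, g s = g (a, b, c) + g (b, c, a) + g (c, a, b) := by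
  simp only [List.nodup_cons, List.mem_cons, not_or, List.not_mem_nil, not_false_eq_true,
    List.nodup_nil, and_true] at h
  obtain ⟨-, -, ⟨hab, hac⟩, hbc⟩ := h
  rw [cyc, Finset.sum_insert, Finset.sum_insert, Finset.sum_singleton, add_assoc]
  · simp only [Finset.mem_singleton, Prod.mk.injEq]
    exact fun hh => hbc hh.1
  · simp only [Finset.mem_insert, Finset.mem_singleton, Prod.mk.injEq]
    exact fun hh => hh.elim (fun h => hab h.1) fun h => hac h.1

/-- The coefficient is nonzero only if the pair and `γ` exhaust `a, b, c`. Of these six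
arrangements, reversing the pair changes both signs, so each of the three cyclic ones counts twice.
-/
theorem sum_zCoef {M : Type*} [AddCommGroup M] [Module ℂ M] {p q a b c : Fin 5}
    (h : [p, q, a, b, c].Nodup) (g : (Fin 5 × Fin 5) × Fin 5 → M)
    (hg : ∀ P γ, g (P.swap, γ) = -g (P, γ)) : ∑ s, zCoef p q s • g s =
      (2 * eps ![p, q, a, b, c] : ℂ) • ∑ s ∈ cyc a b c, g ((s.1, s.2.1), s.2.2) := by
  have e1 : eps ![p, q, a, c, b] = -eps ![p, q, a, b, c] := eps_swap34 ..
  have e2 : eps ![p, q, b, a, c] = -eps ![p, q, a, b, c] := eps_swap23 ..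
  have e3 : eps ![p, q, c, b, a] = -eps ![p, q, a, b, c] := eps_swap24 ..
  have e4 : eps ![p, q, b, c, a] = eps ![p, q, a, b, c] := by rw [eps_swap34, e2, neg_neg]
  have e5 : eps ![p, q, c, a, b] = eps ![p, q, a, b, c] := by rw [eps_swap23, e1, neg_neg]
  have g1 : ∀ i j k, g ((i, j), k) = -g ((j, i), k) := fun i j k => hg (j, i) k
  rw [sum_cyc h, Fintype.sum_prod_type, Fintype.sum_prod_type]
  simp only [sum_of_nodup h, zCoef, eps_eq02, eps_eq03, eps_eq04, eps_eq12,
    eps_eq13, eps_eq14, eps_eq23, eps_eq24, eps_eq34, Int.cast_zero,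
    zero_smul, add_zero, zero_add, e1, e2, e3, e4, e5]
  rw [g1 b a c, g1 c b a, g1 a c b]
  push_cast
  module

variable {V : Type*} [AddCommGroup V] [Module ℂ V] [LieRingModule sl5 V] [LieModule ℂ sl5 V]
variable {W : Type*} [AddCommGroup W] [Module ℂ W] [LieRingModule sl5 W] [LieModule ℂ sl5 W]

/-- Every product `d_Q d_R` is half its commutator plus half its anticommutator, and the latter is a
combination of the `∂_t`. This puts the sum in the form to which `verma_indep_two` applies. -/
theorem sum_dd_dd_eq (F : Fin 5 × Fin 5 → Fin 5 × Fin 5 → W) :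
    ∑ Q, ∑ R, dd Q • dd R • vone (F Q R) =
      ∑ Q, ∑ R, dd Q • dd R • vone ((1 / 2 : ℂ) • (F Q R - F R Q))
        + ∑ t, del t • vone ((1 / 2 : ℂ) • ∑ Q, ∑ R : Fin 5 × Fin 5,
          (eps ![Q.1, Q.2, R.1, R.2, t] : ℂ) • F Q R) := by
  have h1 : ∑ t, del t • vone (∑ Q, ∑ R : Fin 5 × Fin 5,
      (eps ![Q.1, Q.2, R.1, R.2, t] : ℂ) • F Q R) =
      ∑ Q, ∑ R, (dd Q * dd R + dd R * dd Q) • vone (F Q R) := by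
    simp only [dd_mul_dd, Finset.sum_smul, map_sum, map_smul, Finset.smul_sum, smul_assoc,
      smul_comm (del _) (_ : ℂ)]
    rw [Finset.sum_comm]
    refine Finset.sum_congr rfl fun Q _ => Finset.sum_comm
  have h2 : ∑ Q, ∑ R, dd R • dd Q • vone (F Q R) = ∑ Q, ∑ R, dd Q • dd R • vone (F R Q) :=
    Finset.sum_comm
  simp only [map_smul, smul_comm _ (1 / 2 : ℂ), ← Finset.smul_sum]
  rw [h1]
  simp only [map_sub, smul_sub, add_smul, mul_smul, Finset.sum_add_distrib, Finset.sum_sub_distrib]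
  rw [h2]
  simp only [sum_dd_two]
  generalize ∑ Q, dd Q • ∑ R, dd R • vone (F R Q) = x
  generalize ∑ Q, dd Q • ∑ R, dd R • vone (F Q R) = y
  module

variable {θ : Idx 3 → (V →ₗ[ℂ] W)} {θ' : Fin 5 → Idx 1 → (V →ₗ[ℂ] W)}

theorem chi_swap {p q : Fin 5} (h : p ≠ q) (P : Fin 5 × Fin 5) :
    chi (p, q) P.swap = -chi (p, q) P := by
  obtain ⟨i, j⟩ := P
  simp only [chi, Prod.swap_prod_mk, Prod.mk.injEq]
  by_cases h1 : i = p <;> by_cases h2 : j = q <;> by_cases h3 : i = q <;> by_cases h4 : j = p <;>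
    simp_all

/-- The coefficient of `∂_t` in `x_p d_{pq} Φ(v)`. -/
def zCoefOne (θ : Idx 3 → (V →ₗ[ℂ] W)) (θ' : Fin 5 → Idx 1 → (V →ₗ[ℂ] W)) (p q : Fin 5) (v : V)
    (t : Fin 5) : W :=
  ∑ s, zCoef p q s • ⁅xdel p s.2, (24 : ℂ) • θ' t ![s.1] v⁆ + (1 / 2 : ℂ) • ∑ Q, ∑ R,
    (eps ![Q.1, Q.2, R.1, R.2, t] : ℂ) • zCoefTwo θ θ' p q v Q R

theorem zCoefTwo_swap_left (hθ : IsAlternating θ) {p q : Fin 5} (h : p ≠ q) (v : V)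
    (Q R : Fin 5 × Fin 5) : zCoefTwo θ θ' p q v Q.swap R = -zCoefTwo θ θ' p q v Q R := by
  have h1 : ∀ s : (Fin 5 × Fin 5) × Fin 5,
      star (xdel p s.2) (fun R' => θ ![s.1, Q.swap, R'] v) R =
        -star (xdel p s.2) (fun R' => θ ![s.1, Q, R'] v) R := fun s =>
    star_congr_neg _ (fun R' => by rw [hθ.swap_one, LinearMap.neg_apply]) R
  simp only [zCoefTwo, h1]
  simp only [hθ.swap_one, chi_swap h, LinearMap.neg_apply, lie_neg]
  rw [neg_sub', ← Finset.sum_neg_distrib]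
  refine congrArg₂ _ (Finset.sum_congr rfl fun s _ => ?_) ?_ <;> module

theorem zCoefTwo_swap_right (hθ : IsAlternating θ) (hθ' : ∀ t, IsAlternating (θ' t))
    (p q : Fin 5) (v : V) (Q R : Fin 5 × Fin 5) :
    zCoefTwo θ θ' p q v Q R.swap = -zCoefTwo θ θ' p q v Q R := by
  have h1 : ∀ s : (Fin 5 × Fin 5) × Fin 5,
      star (xdel p s.2) (fun R' => θ ![s.1, Q, R'] v) R.swap =
        -star (xdel p s.2) (fun R' => θ ![s.1, Q, R'] v) R := fun s =>
    star_swap _ (fun R' => by rw [hθ.swap_two, LinearMap.neg_apply]) R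
  simp only [zCoefTwo, h1]
  simp only [hθ.swap_two, (hθ' _).swap_single, LinearMap.neg_apply, lie_neg]
  rw [neg_sub', ← Finset.sum_neg_distrib]
  refine congrArg₂ _ (Finset.sum_congr rfl fun s _ => ?_) ?_ <;> module

/-- Once the quadratic coefficients are antisymmetrized, independence in `M(W)` makes vanishing of
the vector equivalent to vanishing of every coefficient. -/
theorem zForm_smul_applyPhi_eq_zero_iff (hθ : IsAlternating θ) (hθ' : ∀ t, IsAlternating (θ' t))
    (hinv : ∀ x, L0act x (Phi3 θ θ') = 0) {p q : Fin 5} (hpq : p ≠ q) (v : V) :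
    ι (od (zForm p q)) • applyPhi (Phi3 θ θ') v = 0 ↔
      (∀ Q R, (1 / 2 : ℂ) • (zCoefTwo θ θ' p q v Q R - zCoefTwo θ θ' p q v R Q) = 0) ∧
      ∀ t, zCoefOne θ θ' p q v t = 0 := by
  have h1 : ι (od (zForm p q)) • phiSum θ θ' v =
      ∑ Q, ∑ R, dd Q • dd R • vone ((1 / 2 : ℂ) •
        (zCoefTwo θ θ' p q v Q R - zCoefTwo θ θ' p q v R Q))
        + ∑ t, del t • vone (zCoefOne θ θ' p q v t) := by
    rw [zForm_smul_phiSum hθ hθ' hinv hpq, sum_dd_dd_eq, add_assoc, ← Finset.sum_add_distrib]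
    refine congrArg _ (Finset.sum_congr rfl fun t _ => ?_)
    rw [← smul_add, ← map_add, add_comm, zCoefOne]
  have h2 : ι (od (zForm p q)) • applyPhi (Phi3 θ θ') v = 0 ↔
      ι (od (zForm p q)) • phiSum θ θ' v = 0 := by
    rw [phiSum_eq hθ hθ', smul_comm _ (48 : ℂ),
      smul_eq_zero_iff_right (by norm_num : (48 : ℂ) ≠ 0)]
  rw [h2, h1]
  constructor
  · intro h
    refine verma_indep_two (fun P Q => ?_) (fun P Q => ?_) h
    · rw [zCoefTwo_swap_left hθ hpq, zCoefTwo_swap_right hθ hθ']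
      module
    · module
  · rintro ⟨hA, hB⟩
    simp only [hA, hB, map_zero, smul_zero, Finset.sum_const_zero, add_zero]

/-- Antisymmetrizing joins the replacement in `R` with the one in `Q`, and invariance turns their
sum into a third copy of `-x.θ`. The bracketed terms then become `3(-x.θ + 2 x.(θ v))`, and
`sum_zCoef` reduces the sum to cyclic triples. -/
theorem zCoefTwo_antisymm (hθ : IsAlternating θ) (hθ' : ∀ t, IsAlternating (θ' t))
    (hinv : ∀ x, L0act x (Phi3 θ θ') = 0) {p q a b c : Fin 5} (h : [p, q, a, b, c].Nodup) (v : V)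
    (Q R : Fin 5 × Fin 5) :
    (1 / 2 : ℂ) • (zCoefTwo θ θ' p q v Q R - zCoefTwo θ θ' p q v R Q) =
      (6 : ℂ) • (chi (p, q) R • θ' p ![Q] v - chi (p, q) Q • θ' p ![R] v
          + ((1 / 2 : ℂ) * eps ![p, q, a, b, c]) • ∑ s ∈ cyc a b c,
              (-(⁅xdel p s.2.2, θ ![(s.1, s.2.1), Q, R]⁆ v)
                + (2 : ℂ) • ⁅xdel p s.2.2, θ ![(s.1, s.2.1), Q, R] v⁆)) := by
  have h1 : ∀ s : (Fin 5 × Fin 5) × Fin 5,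
      zCoef p q s • ((3 : ℂ) • ⁅xdel p s.2, θ ![s.1, Q, R] v⁆ - ⁅xdel p s.2, θ ![s.1, Q, R]⁆ v
        + star (xdel p s.2) (fun R' => θ ![s.1, Q, R'] v) R)
      - zCoef p q s • ((3 : ℂ) • ⁅xdel p s.2, θ ![s.1, R, Q] v⁆ - ⁅xdel p s.2, θ ![s.1, R, Q]⁆ v
        + star (xdel p s.2) (fun R' => θ ![s.1, R, R'] v) Q) =
      zCoef p q s • ((3 : ℂ) • (-(⁅xdel p s.2, θ ![s.1, Q, R]⁆ v)
        + (2 : ℂ) • ⁅xdel p s.2, θ ![s.1, Q, R] v⁆)) := by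
    intro s
    have hi := congrArg (zCoef p q s • ·) ((invariance hθ hθ' (xdel p s.2) (hinv _) v).1 s.1 Q R)
    simp only [smul_add, zCoef_smul_star, smul_zero, add_zero] at hi
    rw [star_congr_neg (xdel p s.2) (fun R' => by rw [hθ.perm_one_two, LinearMap.neg_apply]) Q,
      hθ.perm_one_two s.1 Q R, LinearMap.neg_apply, lie_neg, lie_neg, LinearMap.neg_apply,
      ← sub_eq_zero, ← hi, ← smul_sub, ← smul_sub, ← smul_add, ← smul_add]
    refine congrArg _ ?_
    module
  have h2 := sum_zCoef h (fun s => (3 : ℂ) • (-(⁅xdel p s.2, θ ![s.1, Q, R]⁆ v)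
        + (2 : ℂ) • ⁅xdel p s.2, θ ![s.1, Q, R] v⁆)) (fun P γ => by
    simp only [hθ.swap_zero, lie_neg, LinearMap.neg_apply]
    module)
  rw [← Finset.smul_sum] at h2
  rw [zCoefTwo, zCoefTwo, sub_sub_sub_comm, ← Finset.sum_sub_distrib]
  simp only [h1]
  rw [h2]
  module

/-- The replacement frees one index of `R` and fixes it to `p` inside `ε`, which leaves the
structure constants of `x_p d_{pt}`. The two slots of `R` contribute equally by antisymmetry, hence
the 2. -/
theorem sum_eps_star {t p γ : Fin 5} (h : p ≠ γ) {M : Type*} [AddCommGroup M] [Module ℂ M]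
    {F : Fin 5 × Fin 5 → M} (hF : ∀ P, F P.swap = -F P) (Q : Fin 5 × Fin 5) :
    ∑ R : Fin 5 × Fin 5, (eps ![Q.1, Q.2, R.1, R.2, t] : ℂ) • star (xdel p γ) F R =
      (-2 : ℂ) • ∑ l, zCoef p t (Q, l) • F (γ, l) := by
  have e1 : ∀ m n l, eps ![m, n, p, l, t] = -eps ![p, t, m, n, l] := fun m n l => by
    rw [eps_swap02, eps_swap12, eps_swap34, eps_swap23, eps_swap12]
    ring
  have e2 : ∀ m n l, eps ![m, n, l, p, t] = eps ![p, t, m, n, l] := fun m n l => by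
    rw [eps_swap23, e1, neg_neg]
  have hF' : ∀ l, F (l, γ) = -F (γ, l) := fun l => hF (γ, l)
  simp only [star_xdel h, Fintype.sum_prod_type, smul_add, smul_ite, smul_zero,
    Finset.sum_add_distrib, Finset.sum_ite_irrel, Finset.sum_const_zero, Finset.sum_ite_eq',
    Finset.mem_univ, if_true, e1, e2, hF', zCoef]
  push_cast
  simp only [neg_smul, smul_neg, Finset.sum_neg_distrib]
  module

/-- Reordering `d_Q d_R` contracts the coefficients with `ε_{Q,R,t}`, which is symmetric in `Q` and
`R`. The parts of `zCoefTwo` that are alternating in `Q, R` therefore drop out; only the replacement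
term and the `χ` term remain. -/
theorem zCoefOne_eq (hθ : IsAlternating θ) {p q : Fin 5} (hpq : p ≠ q) (v : V) (t : Fin 5) :
    zCoefOne θ θ' p q v t =
      (24 : ℂ) • ∑ s, zCoef p q s • ⁅xdel p s.2, θ' t ![s.1] v⁆
      - ∑ s, zCoef p q s • ∑ s', zCoef p t s' • θ ![s.1, s'.1, (s.2, s'.2)] v
      - (12 : ℂ) • ∑ R : Fin 5 × Fin 5, (eps ![p, q, R.1, R.2, t] : ℂ) • θ' p ![R] v := by
  have h1 : ∑ Q, ∑ R : Fin 5 × Fin 5, (eps ![Q.1, Q.2, R.1, R.2, t] : ℂ) •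
      (12 * chi (p, q) Q) • θ' p ![R] v =
      (24 : ℂ) • ∑ R : Fin 5 × Fin 5, (eps ![p, q, R.1, R.2, t] : ℂ) • θ' p ![R] v := by
    rw [Finset.sum_comm, Finset.smul_sum]
    refine Finset.sum_congr rfl fun R _ => ?_
    have := sum_chi_smul hpq fun Q =>
      (12 : ℂ) • (eps ![Q.1, Q.2, R.1, R.2, t] : ℂ) • θ' p ![R] v
    rw [eps_swap01 p q] at this
    refine Eq.trans (Finset.sum_congr rfl fun Q _ => ?_) (this.trans ?_)
    · module
    · push_cast
      module
  have h2 : ∀ s : (Fin 5 × Fin 5) × Fin 5, ∑ Q, ∑ R : Fin 5 × Fin 5,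
      (eps ![Q.1, Q.2, R.1, R.2, t] : ℂ) • ((3 : ℂ) • ⁅xdel p s.2, θ ![s.1, Q, R] v⁆
        - ⁅xdel p s.2, θ ![s.1, Q, R]⁆ v) = 0 := by
    intro s
    refine eq_zero_of_eq_neg ?_
    conv_lhs => rw [Finset.sum_comm]
    rw [← Finset.sum_neg_distrib]
    refine Finset.sum_congr rfl fun Q _ => ?_
    rw [← Finset.sum_neg_distrib]
    refine Finset.sum_congr rfl fun R _ => ?_
    rw [eps_swap, hθ.perm_one_two, LinearMap.neg_apply, lie_neg, lie_neg, LinearMap.neg_apply]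
    module
  have h3 : ∀ s : (Fin 5 × Fin 5) × Fin 5, zCoef p q s • ∑ Q, ∑ R : Fin 5 × Fin 5,
      (eps ![Q.1, Q.2, R.1, R.2, t] : ℂ) • star (xdel p s.2) (fun R' => θ ![s.1, Q, R'] v) R =
      (-2 : ℂ) • zCoef p q s • ∑ s', zCoef p t s' • θ ![s.1, s'.1, (s.2, s'.2)] v := by
    intro s
    by_cases h : p = s.2
    · simp [zCoef, ← h]
    · have h4 : ∑ s', zCoef p t s' • θ ![s.1, s'.1, (s.2, s'.2)] v = ∑ Q, ∑ l,
        zCoef p t (Q, l) • θ ![s.1, Q, (s.2, l)] v := Fintype.sum_prod_type _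
      rw [← smul_comm (zCoef p q s) (-2 : ℂ), h4, Finset.smul_sum (r := (-2 : ℂ))]
      refine congrArg (zCoef p q s • ·) (Finset.sum_congr rfl fun Q _ => ?_)
      exact sum_eps_star h (fun P => by rw [hθ.swap_two, LinearMap.neg_apply]) Q
  have h5 : ∑ Q, ∑ R : Fin 5 × Fin 5, (eps ![Q.1, Q.2, R.1, R.2, t] : ℂ) •
      zCoefTwo θ θ' p q v Q R = ∑ s, zCoef p q s • (∑ Q, ∑ R : Fin 5 × Fin 5,
      (eps ![Q.1, Q.2, R.1, R.2, t] : ℂ) • ((3 : ℂ) • ⁅xdel p s.2, θ ![s.1, Q, R] v⁆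
        - ⁅xdel p s.2, θ ![s.1, Q, R]⁆ v) + ∑ Q, ∑ R : Fin 5 × Fin 5,
      (eps ![Q.1, Q.2, R.1, R.2, t] : ℂ) • star (xdel p s.2) (fun R' => θ ![s.1, Q, R'] v) R)
      - ∑ Q, ∑ R : Fin 5 × Fin 5, (eps ![Q.1, Q.2, R.1, R.2, t] : ℂ) •
      (12 * chi (p, q) Q) • θ' p ![R] v := by
    have h6 : ∀ Q R : Fin 5 × Fin 5, (eps ![Q.1, Q.2, R.1, R.2, t] : ℂ) •
        zCoefTwo θ θ' p q v Q R = ∑ s, zCoef p q s • ((eps ![Q.1, Q.2, R.1, R.2, t] : ℂ) •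
          ((3 : ℂ) • ⁅xdel p s.2, θ ![s.1, Q, R] v⁆ - ⁅xdel p s.2, θ ![s.1, Q, R]⁆ v) +
          (eps ![Q.1, Q.2, R.1, R.2, t] : ℂ) •
            star (xdel p s.2) (fun R' => θ ![s.1, Q, R'] v) R) -
        (eps ![Q.1, Q.2, R.1, R.2, t] : ℂ) • (12 * chi (p, q) Q) • θ' p ![R] v := by
      intro Q R
      rw [zCoefTwo, smul_sub, Finset.smul_sum]
      congr 1
      refine Finset.sum_congr rfl fun s _ => ?_
      rw [← smul_add, smul_comm]
    simp only [h6, Finset.sum_sub_distrib]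
    congr 1
    simp only [← Finset.sum_add_distrib, Finset.smul_sum]
    exact (Finset.sum_congr rfl fun Q _ => Finset.sum_comm).trans Finset.sum_comm
  rw [zCoefOne, h5, h1]
  simp only [h2, zero_add, h3, ← Finset.smul_sum, lie_smul, smul_comm _ (24 : ℂ)]
  module

end SingularVectors

/-! ### Identification with the four equations -/

section Equations

variable {V : Type*} [AddCommGroup V] [Module ℂ V] [LieRingModule sl5 V] [LieModule ℂ sl5 V]
variable {W : Type*} [AddCommGroup W] [Module ℂ W] [LieRingModule sl5 W] [LieModule ℂ sl5 W]
variable {θ : Idx 3 → (V →ₗ[ℂ] W)} {θ' : Fin 5 → Idx 1 → (V →ₗ[ℂ] W)}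

theorem sum_zCoef_lie (hθ' : ∀ t, IsAlternating (θ' t)) {p q a b c : Fin 5}
    (h : [p, q, a, b, c].Nodup) (v : V) (t : Fin 5) :
    ∑ s, zCoef p q s • ⁅xdel p s.2, θ' t ![s.1] v⁆ = (2 * eps ![p, q, a, b, c] : ℂ) •
      ∑ s ∈ cyc a b c, ⁅xdel p s.2.2, θ' t ![(s.1, s.2.1)] v⁆ :=
  sum_zCoef h (fun s => ⁅xdel p s.2, θ' t ![s.1] v⁆) fun P γ => by
    simp only [(hθ' t).swap_single, LinearMap.neg_apply, lie_neg]

theorem sum_zCoef_sum_zCoef (hθ : IsAlternating θ) {p q a b c t a' b' c' : Fin 5}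
    (h : [p, q, a, b, c].Nodup) (h' : [p, t, a', b', c'].Nodup) (v : V) :
    ∑ s, zCoef p q s • ∑ s', zCoef p t s' • θ ![s.1, s'.1, (s.2, s'.2)] v =
      (4 * eps ![p, q, a, b, c] * eps ![p, t, a', b', c'] : ℂ) • ∑ s ∈ cyc a b c,
        ∑ s' ∈ cyc a' b' c', θ ![(s.1, s.2.1), (s'.1, s'.2.1), (s.2.2, s'.2.2)] v := by
  have h1 : ∀ s : (Fin 5 × Fin 5) × Fin 5,
      ∑ s', zCoef p t s' • θ ![s.1, s'.1, (s.2, s'.2)] v = (2 * eps ![p, t, a', b', c'] : ℂ) •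
        ∑ s' ∈ cyc a' b' c', θ ![s.1, (s'.1, s'.2.1), (s.2, s'.2.2)] v := fun s =>
    sum_zCoef h' (fun s' => θ ![s.1, s'.1, (s.2, s'.2)] v) fun P γ => by
      simp only [hθ.swap_one, LinearMap.neg_apply]
  simp only [h1]
  rw [sum_zCoef h (fun s => (2 * eps ![p, t, a', b', c'] : ℂ) •
        ∑ s' ∈ cyc a' b' c', θ ![s.1, (s'.1, s'.2.1), (s.2, s'.2.2)] v),
    ← Finset.smul_sum, smul_smul]
  · congr 1
    ring
  · intro P γ
    simp only [hθ.swap_zero, LinearMap.neg_apply, Finset.sum_neg_distrib, smul_neg]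

/-- Of the nine terms the three diagonal ones contain a pair `(i, i)` and vanish. The others are
rearrangements of the same three pairs, all with sign +1. -/
theorem sum_sum_cyc_same (hθ : IsAlternating θ) {p q a b c : Fin 5} (h : [p, q, a, b, c].Nodup)
    (v : V) : ∑ s ∈ cyc a b c, ∑ s' ∈ cyc a b c,
        θ ![(s.1, s.2.1), (s'.1, s'.2.1), (s.2.2, s'.2.2)] v =
      (6 : ℂ) • θ ![(a, b), (b, c), (c, a)] v := by
  have z2 : ∀ i Q R, θ ![Q, R, (i, i)] = 0 := fun i Q R =>
    eq_zero_of_eq_neg (hθ.swap_two Q R (i, i))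
  have s2 : ∀ i j Q R, θ ![Q, R, (i, j)] = -θ ![Q, R, (j, i)] := fun i j Q R =>
    hθ.swap_two Q R (j, i)
  have c1 : θ ![(b, c), (c, a), (a, b)] = θ ![(a, b), (b, c), (c, a)] := by
    rw [hθ.perm_one_two, hθ.perm_zero_one, neg_neg]
  have c2 : θ ![(c, a), (a, b), (b, c)] = θ ![(a, b), (b, c), (c, a)] := by
    rw [hθ.perm_zero_one, hθ.perm_one_two, neg_neg]
  simp only [sum_cyc h, z2, LinearMap.zero_apply]
  rw [s2 c b, s2 a c, s2 b a, hθ.perm_one_two (a, b) (b, c) (c, a),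
    hθ.perm_one_two (b, c) (c, a) (a, b), hθ.perm_one_two (c, a) (a, b) (b, c), c1, c2, neg_neg]
  module

theorem nodup_swap {p q a b c : Fin 5} (h : [p, q, a, b, c].Nodup) : [p, a, q, b, c].Nodup :=
  ((List.Perm.swap a q [b, c]).cons p).nodup_iff.mp h

/-- Of the nine terms two contain a pair `(i, i)` and one repeats a pair. The remaining six fall
into two classes of three equal terms. -/
theorem sum_sum_cyc_ne (hθ : IsAlternating θ) {p q a b c : Fin 5} (h : [p, q, a, b, c].Nodup)
    (v : V) : ∑ s ∈ cyc a b c, ∑ s' ∈ cyc q b c,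
        θ ![(s.1, s.2.1), (s'.1, s'.2.1), (s.2.2, s'.2.2)] v =
      (3 : ℂ) • θ ![(a, b), (b, c), (c, q)] v + (3 : ℂ) • θ ![(a, c), (c, b), (b, q)] v := by
  have z2 : ∀ i Q R, θ ![Q, R, (i, i)] = 0 := fun i Q R =>
    eq_zero_of_eq_neg (hθ.swap_two Q R (i, i))
  have z01 : ∀ P R, θ ![P, P, R] = 0 := fun P R => eq_zero_of_eq_neg (hθ.perm_zero_one P P R)
  have s0 : ∀ i j Q R, θ ![(i, j), Q, R] = -θ ![(j, i), Q, R] := fun i j Q R =>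
    hθ.swap_zero (j, i) Q R
  have s1 : ∀ i j Q R, θ ![Q, (i, j), R] = -θ ![Q, (j, i), R] := fun i j Q R =>
    hθ.swap_one Q (j, i) R
  have s2 : ∀ i j Q R, θ ![Q, R, (i, j)] = -θ ![Q, R, (j, i)] := fun i j Q R =>
    hθ.swap_two Q R (j, i)
  have rot : ∀ P Q R, θ ![Q, R, P] = θ ![P, Q, R] := fun P Q R => by
    rw [hθ.perm_one_two, hθ.perm_zero_one, neg_neg]
  have t1 : θ ![(a, b), (c, q), (c, b)] = θ ![(a, b), (b, c), (c, q)] := by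
    rw [hθ.perm_one_two, s1 c b, neg_neg]
  have t2 : θ ![(b, c), (q, b), (a, c)] = θ ![(a, c), (c, b), (b, q)] := by
    rw [s0 b c, s1 q b, neg_neg, rot]
  have t3 : θ ![(b, c), (c, q), (a, b)] = θ ![(a, b), (b, c), (c, q)] := rot _ _ _
  have t4 : θ ![(c, a), (q, b), (b, c)] = θ ![(a, c), (c, b), (b, q)] := by
    rw [s0 c a, s1 q b, s2 b c, hθ.perm_one_two, neg_neg, neg_neg]
  have t5 : θ ![(c, a), (b, c), (b, q)] = θ ![(a, c), (c, b), (b, q)] := by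
    rw [s0 c a, s1 b c, neg_neg]
  rw [sum_cyc h, sum_cyc (nodup_swap h), sum_cyc (nodup_swap h), sum_cyc (nodup_swap h)]
  simp only [z2, z01, LinearMap.zero_apply, t1, t2, t3, t4, t5]
  module

theorem sum_zCoef_eq_zero {M : Type*} [AddCommGroup M] [Module ℂ M] (p q : Fin 5)
    (F : Fin 5 × Fin 5 → M) {t : Fin 5} (h : t = p ∨ t = q) :
    ∑ R : Fin 5 × Fin 5, (eps ![p, q, R.1, R.2, t] : ℂ) • F R = 0 := by
  rcases h with rfl | rfl <;> simp

/-- For `t = p` both other contributions carry an `ε` in which `p` is repeated. -/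
theorem zCoefOne_fst (hθ : IsAlternating θ) (hθ' : ∀ t, IsAlternating (θ' t)) {p q a b c : Fin 5}
    (h : [p, q, a, b, c].Nodup) (v : V) : zCoefOne θ θ' p q v p =
      (48 * eps ![p, q, a, b, c] : ℂ) •
        ∑ s ∈ cyc a b c, ⁅xdel p s.2.2, θ' p ![(s.1, s.2.1)] v⁆ := by
  rw [zCoefOne_eq hθ (by rintro rfl; simp at h), sum_zCoef_eq_zero p q _ (Or.inl rfl),
    sum_zCoef_lie hθ' h]
  simp only [zCoef, eps_eq01, Int.cast_zero, zero_smul, Finset.sum_const_zero, smul_zero, sub_zero]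
  rw [smul_smul]
  congr 1
  ring

theorem eps_sq {p q a b c : Fin 5} (h : [p, q, a, b, c].Nodup) :
    (eps ![p, q, a, b, c] : ℂ) * eps ![p, q, a, b, c] = 1 := by
  have u : ∀ i j : Fin 5, i ≠ j → IsUnit (Int.sign ((j : ℤ) - i)) := by decide
  simp only [List.nodup_cons, List.mem_cons, not_or, List.not_mem_nil, not_false_eq_true,
    List.nodup_nil, and_true] at h
  obtain ⟨⟨hpq, hpa, hpb, hpc⟩, ⟨hqa, hqb, hqc⟩, ⟨hab, hac⟩, hbc⟩ := h
  have hu : IsUnit (eps ![p, q, a, b, c]) := by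
    rw [eps_eq]
    exact (((((((((u _ _ hpq).mul (u _ _ hpa)).mul (u _ _ hpb)).mul (u _ _ hpc)).mul
      (u _ _ hqa)).mul (u _ _ hqb)).mul (u _ _ hqc)).mul (u _ _ hab)).mul (u _ _ hac)).mul
      (u _ _ hbc)
  exact_mod_cast Int.isUnit_mul_self hu

theorem zCoefOne_snd (hθ : IsAlternating θ) (hθ' : ∀ t, IsAlternating (θ' t)) {p q a b c : Fin 5}
    (h : [p, q, a, b, c].Nodup) (v : V) : zCoefOne θ θ' p q v q =
      (48 : ℂ) • ((eps ![p, q, a, b, c] : ℂ) • ∑ s ∈ cyc a b c,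
              ⁅xdel p s.2.2, θ' q ![(s.1, s.2.1)] v⁆
          - (1 / 2 : ℂ) • θ ![(a, b), (b, c), (c, a)] v) := by
  rw [zCoefOne_eq hθ (by rintro rfl; simp at h), sum_zCoef_eq_zero p q _ (Or.inr rfl),
    sum_zCoef_lie hθ' h, sum_zCoef_sum_zCoef hθ h h, mul_assoc, eps_sq h, sum_sum_cyc_same hθ h]
  module

/-- For the remaining values of `t` all three contributions survive. Exchanging `q` and `a` reverses
`ε`, which fixes the sign of the terms with `θ` on three pairs. -/
theorem zCoefOne_ne (hθ : IsAlternating θ) (hθ' : ∀ t, IsAlternating (θ' t))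
    (hinv : ∀ x, L0act x (Phi3 θ θ') = 0) {p q a b c : Fin 5}
    (h : [p, q, a, b, c].Nodup) (v : V) : zCoefOne θ θ' p q v a =
      (48 : ℂ) • ((1 / 4 : ℂ) • θ ![(a, b), (b, c), (c, q)] v
          + (1 / 4 : ℂ) • θ ![(a, c), (c, b), (b, q)] v
          + ((1 / 2 : ℂ) * eps ![p, q, a, b, c]) • ∑ s ∈ cyc a b c,
              (-(⁅xdel p s.2.2, θ' a ![(s.1, s.2.1)]⁆ v)
                + (2 : ℂ) • ⁅xdel p s.2.2, θ' a ![(s.1, s.2.1)] v⁆)) := by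
  have hn := h
  simp only [List.nodup_cons, List.mem_cons, not_or, List.not_mem_nil, not_false_eq_true,
    List.nodup_nil, and_true] at hn
  obtain ⟨⟨hpq, hpa, hpb, hpc⟩, ⟨hqa, hqb, hqc⟩, ⟨hab, hac⟩, hbc⟩ := hn
  have e1 : eps ![p, a, q, b, c] = -eps ![p, q, a, b, c] := eps_swap12 ..
  have h1 : ∑ R : Fin 5 × Fin 5, (eps ![p, q, R.1, R.2, a] : ℂ) • θ' p ![R] v =
      (2 * eps ![p, q, a, b, c] : ℂ) • θ' p ![(b, c)] v := by
    have s1 : θ' p ![(c, b)] = -θ' p ![(b, c)] := (hθ' p).swap_single (b, c)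
    have e2 : eps ![p, q, b, c, a] = eps ![p, q, a, b, c] := by
      rw [eps_swap34, eps_swap23, neg_neg]
    have e3 : eps ![p, q, c, b, a] = -eps ![p, q, a, b, c] := eps_swap24 ..
    rw [Fintype.sum_prod_type]
    simp only [sum_of_nodup h, eps_eq02, eps_eq03, eps_eq12, eps_eq13, eps_eq23, eps_eq24,
      eps_eq34, Int.cast_zero, zero_smul, add_zero, zero_add, e2, e3, s1, LinearMap.neg_apply]
    push_cast
    module
  -- Invariance converts the stray `θ^p_{bc}` into the derivatives in the second equation: the pairs
  -- avoid `p`, so `x_p ∂_γ` acts on `θ^a` only through its upper index, and this is nonzero just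
  -- for `γ = a`.
  have h2 : ∑ s ∈ cyc a b c, ⁅xdel p s.2.2, θ' a ![(s.1, s.2.1)]⁆ v = θ' p ![(b, c)] v := by
    have i : ∀ {γ : Fin 5} (_ : p ≠ γ) {α β : Fin 5} (_ : α ≠ p) (_ : β ≠ p),
        ⁅xdel p γ, θ' a ![(α, β)]⁆ v = if a = γ then θ' p ![(α, β)] v else 0 := by
      intro γ hγ α β hα hβ
      have := (invariance hθ hθ' (xdel p γ) (hinv _) v).2 a (α, β)
      rw [star_xdel hγ, if_neg hα, if_neg hβ, add_zero, add_zero, sub_eq_zero] at this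
      rw [this]
      simp only [xdel_apply hγ, ite_and, ite_smul, one_smul, zero_smul, Finset.sum_ite_eq',
        Finset.mem_univ, if_true]
    rw [sum_cyc h, i hpc (Ne.symm hpa) (Ne.symm hpb), i hpa (Ne.symm hpb) (Ne.symm hpc),
      i hpb (Ne.symm hpc) (Ne.symm hpa), if_neg hac, if_neg hab, if_pos rfl, zero_add, add_zero]
  rw [zCoefOne_eq hθ hpq, sum_zCoef_lie hθ' h, h1, ← h2, sum_zCoef_sum_zCoef hθ h (nodup_swap h),
    sum_sum_cyc_ne hθ h, e1, Finset.sum_add_distrib, Finset.sum_neg_distrib, ← Finset.smul_sum,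
    Int.cast_neg, mul_neg, mul_assoc, eps_sq h]
  module

theorem exists_nodup {p q : Fin 5} (h : p ≠ q) : ∃ a b c, [p, q, a, b, c].Nodup := by
  revert p q
  decide

theorem exists_nodup_three {p q a : Fin 5} (h : p ≠ q) (hp : a ≠ p) (hq : a ≠ q) :
    ∃ b c, [p, q, a, b, c].Nodup := by
  revert p q a
  decide

/-- The coefficients of `x_p d_{pq} Φ(v)` are nonzero multiples of the left sides of the four
equations. As `(p, q, a, b, c)` runs over all permutations, every value of `t` is covered. -/
theorem zForm_smul_applyPhi_iff (hθ : IsAlternating θ) (hθ' : ∀ t, IsAlternating (θ' t))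
    (hinv : ∀ x, L0act x (Phi3 θ θ') = 0) :
    (∀ p q : Fin 5, p ≠ q → ∀ v : V, ι (od (zForm p q)) • applyPhi (Phi3 θ θ') v = 0) ↔
      ∀ (H L : Fin 5 × Fin 5) (p q a b c : Fin 5), [p, q, a, b, c].Nodup → ∀ v : V,
        (chi (p, q) L • θ' p ![H] v - chi (p, q) H • θ' p ![L] v
          + ((1 / 2 : ℂ) * eps ![p, q, a, b, c]) • ∑ s ∈ cyc a b c,
              (-(⁅xdel p s.2.2, θ ![(s.1, s.2.1), H, L]⁆ v)
                + (2 : ℂ) • ⁅xdel p s.2.2, θ ![(s.1, s.2.1), H, L] v⁆) = 0) ∧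
        ((1 / 4 : ℂ) • θ ![(a, b), (b, c), (c, q)] v
          + (1 / 4 : ℂ) • θ ![(a, c), (c, b), (b, q)] v
          + ((1 / 2 : ℂ) * eps ![p, q, a, b, c]) • ∑ s ∈ cyc a b c,
              (-(⁅xdel p s.2.2, θ' a ![(s.1, s.2.1)]⁆ v)
                + (2 : ℂ) • ⁅xdel p s.2.2, θ' a ![(s.1, s.2.1)] v⁆) = 0) ∧
        (∑ s ∈ cyc a b c, ⁅xdel p s.2.2, θ' p ![(s.1, s.2.1)] v⁆ = 0) ∧
        ((eps ![p, q, a, b, c] : ℂ) • ∑ s ∈ cyc a b c,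
              ⁅xdel p s.2.2, θ' q ![(s.1, s.2.1)] v⁆
          - (1 / 2 : ℂ) • θ ![(a, b), (b, c), (c, a)] v = 0) := by
  have h6 : (6 : ℂ) ≠ 0 := by norm_num
  have h48 : (48 : ℂ) ≠ 0 := by norm_num
  constructor
  · intro hz H L p q a b c h v
    have hpq : p ≠ q := by rintro rfl; simp at h
    have he : (48 * eps ![p, q, a, b, c] : ℂ) ≠ 0 := fun h0 => by
      have := eps_sq h
      simp_all
    obtain ⟨hA, hB⟩ := (zForm_smul_applyPhi_eq_zero_iff hθ hθ' hinv hpq v).mp (hz p q hpq v)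
    refine ⟨?_, ?_, ?_, ?_⟩
    · have := hA H L
      rw [zCoefTwo_antisymm hθ hθ' hinv h] at this
      exact (smul_eq_zero_iff_right h6).mp this
    · have := hB a
      rw [zCoefOne_ne hθ hθ' hinv h] at this
      exact (smul_eq_zero_iff_right h48).mp this
    · have := hB p
      rw [zCoefOne_fst hθ hθ' h] at this
      exact (smul_eq_zero_iff_right he).mp this
    · have := hB q
      rw [zCoefOne_snd hθ hθ' h] at this
      exact (smul_eq_zero_iff_right h48).mp this
  · intro he p q hpq v
    rw [zForm_smul_applyPhi_eq_zero_iff hθ hθ' hinv hpq v]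
    obtain ⟨a, b, c, h⟩ := exists_nodup hpq
    refine ⟨fun Q R => ?_, fun t => ?_⟩
    · rw [zCoefTwo_antisymm hθ hθ' hinv h, (he Q R p q a b c h v).1, smul_zero]
    · by_cases hp : t = p
      -- The last three equations do not involve `H` and `L`, so `(p, p)` is an arbitrary filler.
      · rw [hp, zCoefOne_fst hθ hθ' h, (he (p, p) (p, p) p q a b c h v).2.2.1, smul_zero]
      · by_cases hq : t = q
        · rw [hq, zCoefOne_snd hθ hθ' h, (he (p, p) (p, p) p q a b c h v).2.2.2, smul_zero]
        -- The permutation is chosen anew so that `t` takes the place of `a` in the second equation.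
        · obtain ⟨b, c, h⟩ := exists_nodup_three hpq hp hq
          rw [zCoefOne_ne hθ hθ' hinv h, (he (p, p) (p, p) p q t b c h v).2.1, smul_zero]

end Equations

/-! ## Exact two-forms and the associated divergence-free fields -/

/-- `g ↦ dg ∧ dx_j` as a linear map. -/
def etaL (j : Fin 5) : PS →ₗ[ℂ] OddPart where
  toFun g := eta g j
  map_add' g h := Subtype.ext (funext fun a => funext fun b => by
    change (eta (g + h) j).1 a b = (eta g j).1 a b + (eta h j).1 a b
    simp only [eta_apply, map_add]
    split_ifs <;> ring)
  map_smul' c g := Subtype.ext (funext fun a => funext fun b => by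
    change (eta (c • g) j).1 a b = c • (eta g j).1 a b
    simp only [eta_apply, Derivation.map_smul, smul_sub, smul_ite, smul_zero])

theorem etaL_apply (j : Fin 5) (g : PS) : etaL j g = eta g j := rfl

/-- The vector field `∂_i h ∂_j - ∂_j h ∂_i`, linear in `h`. -/
def xiL (i j : Fin 5) : PS →ₗ[ℂ] EvenPart where
  toFun h := ⟨fun n => (if n = j then pd i h else 0) - (if n = i then pd j h else 0), by
    rw [mem_evenPart]
    have e : ∀ (k l n : Fin 5), pd n (if n = k then pd l h else 0) =
        if n = k then pd k (pd l h) else 0 := by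
      intro k l n
      split_ifs with hn
      · rw [hn]
      · exact map_zero _
    simp only [map_sub, e, Finset.sum_sub_distrib, Finset.sum_ite_eq', Finset.mem_univ, if_true]
    rw [pd_comm, sub_self]⟩
  map_add' g h := Subtype.ext (funext fun n => by
    simp only [map_add, Submodule.coe_add, Pi.add_apply]
    split_ifs <;> ring)
  map_smul' c g := Subtype.ext (funext fun n => by
    simp only [Derivation.map_smul, RingHom.id_apply, SetLike.val_smul, Pi.smul_apply, smul_sub,
      smul_ite, smul_zero])

theorem xiL_apply (i j : Fin 5) (h : PS) (n : Fin 5) : (xiL i j h).1 n =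
    (if n = j then pd i h else 0) - (if n = i then pd j h else 0) := rfl

/-- The Leibniz rule for the Lie derivative of `dg ∧ dx_j`, which is `d(Xg) ∧ dx_j + dg ∧ dX_j`. -/
theorem evenOddL_eta_apply (X : EvenPart) (g : PS) (j a b : Fin 5) :
    (evenOddL X (eta g j)).1 a b = (eta (∑ k, X.1 k * pd k g) j).1 a b
      + (pd a g * pd b (X.1 j) - pd b g * pd a (X.1 j)) := by
  have hpd : ∀ (k l : Fin 5) (p : Prop) [Decidable p],
      pd k (if p then pd l g else 0) = if p then pd k (pd l g) else 0 := by
    intro k l p _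
    split_ifs <;> simp
  change lieDer X.1 (eta g j).1 a b = _
  simp only [lieDer, eta_apply, map_sub, hpd, map_sum, Derivation.leibniz, smul_eq_mul]
  simp only [mul_sub, mul_ite, mul_zero, Finset.sum_add_distrib, Finset.sum_sub_distrib,
    Finset.sum_ite_irrel, Finset.sum_const_zero, Finset.sum_ite_eq', Finset.mem_univ, if_true,
    fun k => pd_comm k a g, fun k => pd_comm k b g, fun k => mul_comm (pd k g)]
  split_ifs <;> ring

theorem evenOddL_xdel_eta {a p : Fin 5} (h : a ≠ p) (g : PS) (j : Fin 5) :
    evenOddL (slField (xdel a p)) (eta g j) =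
      eta (MvPowerSeries.X a * pd p g) j + if p = j then eta g a else 0 := by
  refine Subtype.ext (funext fun m => funext fun n => ?_)
  rw [evenOddL_eta_apply]
  simp only [slField_xdel_apply h, ite_mul, zero_mul, Finset.sum_ite_eq', Finset.mem_univ, if_true]
  have e : ((eta (MvPowerSeries.X a * pd p g) j + if p = j then eta g a else 0 : OddPart)).1 m n =
    (eta (MvPowerSeries.X a * pd p g) j).1 m n + if p = j then (eta g a).1 m n else 0 := by
    split_ifs <;> rfl
  rw [e]
  by_cases hj : p = j
  · simp [hj, pd_X, eta_apply g a]
  · simp [hj, Ne.symm hj]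

theorem evenEvenL_xdel_xi {a p : Fin 5} (h : a ≠ p) (g : PS) (i j : Fin 5) :
    evenEvenL (slField (xdel a p)) (xiL i j g) = xiL i j (MvPowerSeries.X a * pd p g)
      - (if a = i then xiL p j g else 0) - if a = j then xiL i p g else 0 := by
  have hpd : ∀ (k l : Fin 5) (p : Prop) [Decidable p],
      pd k (if p then pd l g else 0) = if p then pd k (pd l g) else 0 := by
    intro k l p _
    split_ifs <;> simp
  have hpd' : ∀ (k l : Fin 5) (p : Prop) [Decidable p],
      pd k (if p then (MvPowerSeries.X l : PS) else 0) =
        if p then (if k = l then 1 else 0) else 0 := by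
    intro k l p _
    split_ifs <;> simp_all [pd_X]
  refine Subtype.ext (funext fun n => ?_)
  have e : ((xiL i j (MvPowerSeries.X a * pd p g)
      - (if a = i then xiL p j g else 0) - if a = j then xiL i p g else 0 : EvenPart)).1 n =
      (xiL i j (MvPowerSeries.X a * pd p g)).1 n
      - (if a = i then (xiL p j g).1 n else 0) - if a = j then (xiL i p g).1 n else 0 := by
    split_ifs <;> rfl
  rw [e]
  change vfBracket (slField (xdel a p)).1 (xiL i j g).1 n = _
  simp only [vfBracket, slField_xdel_apply h, xiL_apply, map_sub, hpd, hpd', ite_mul, zero_mul,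
    mul_ite, mul_zero, mul_one, Finset.sum_sub_distrib, Finset.sum_ite_eq', Finset.mem_univ,
    if_true, Finset.sum_ite_irrel, Finset.sum_const_zero, Derivation.leibniz, smul_eq_mul, pd_X]
  rw [pd_comm p i, pd_comm p j]
  simp only [eq_comm (a := i) (b := a), eq_comm (a := j) (b := a)]
  split_ifs <;> ring

theorem oddOddL_zForm_apply (p k : Fin 5) (f : OddPart) (t : Fin 5) :
    (oddOddL (zForm p k) f).1 t = (1 / 2 : ℂ) • (MvPowerSeries.X p *
      ∑ i, ∑ j, (eps ![p, k, i, j, t] : PS) * f.1 i j) := by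
  have e : ∀ i j, eps ![k, p, i, j, t] = -eps ![p, k, i, j, t] := fun i j => eps_swap01 ..
  rw [oddOddL_apply_coe, sum_pairs_comm, Finset.mul_sum, Finset.smul_sum, Finset.smul_sum]
  refine Finset.sum_congr rfl fun i _ => ?_
  rw [Finset.mul_sum, Finset.smul_sum, Finset.smul_sum]
  refine Finset.sum_congr rfl fun j _ => ?_
  simp only [zForm_apply, dForm, Prod.mk.injEq, ite_and, mul_sub, mul_ite, mul_one, mul_zero,
    sub_mul, ite_mul, zero_mul, Finset.sum_sub_distrib, Finset.sum_ite_irrel,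
    Finset.sum_const_zero, Finset.sum_ite_eq', Finset.mem_univ, if_true, e]
  push_cast
  rw [neg_mul, mul_left_comm]
  module

theorem oddOddL_zForm_eta_apply (p k l : Fin 5) (g : PS) (t : Fin 5) :
    (oddOddL (zForm p k) (eta g l)).1 t =
      MvPowerSeries.X p * ∑ i, (eps ![p, k, i, l, t] : PS) * pd i g := by
  have e : ∀ i, eps ![p, k, l, i, t] = -eps ![p, k, i, l, t] := fun i => eps_swap23 ..
  rw [oddOddL_zForm_apply]
  simp only [eta_apply, mul_sub, mul_ite, mul_zero, Finset.sum_sub_distrib, Finset.sum_ite_eq',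
    Finset.mem_univ, if_true, Finset.sum_ite_irrel, Finset.sum_const_zero, e]
  push_cast
  simp only [neg_mul, mul_neg, Finset.sum_neg_distrib]
  generalize MvPowerSeries.X p * ∑ x, (eps ![p, k, x, l, t] : PS) * pd x g = y
  module

/-! ## Vanishing to a given order at the origin -/

/-- `g` vanishes at the origin to order `n`. -/
def VanishesTo : ℕ → PS → Prop
  | 0, _ => True
  | n + 1, g => MvPowerSeries.constantCoeff g = 0 ∧ ∀ i, VanishesTo n (pd i g)

theorem VanishesTo.pd {n : ℕ} {g : PS} (h : VanishesTo (n + 1) g) (i : Fin 5) :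
    VanishesTo n (pd i g) := h.2 i

theorem VanishesTo.of_succ {n : ℕ} {g : PS} (h : VanishesTo (n + 1) g) : VanishesTo n g := by
  induction n generalizing g with
  | zero => trivial
  | succ n ih => exact ⟨h.1, fun i => ih (h.2 i)⟩

theorem VanishesTo.add {n : ℕ} {g h : PS} (hg : VanishesTo n g) (hh : VanishesTo n h) :
    VanishesTo n (g + h) := by
  induction n generalizing g h with
  | zero => trivial
  | succ n ih =>
    refine ⟨by rw [map_add, hg.1, hh.1, add_zero], fun i => ?_⟩
    rw [map_add]
    exact ih (hg.2 i) (hh.2 i)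

theorem vanishesTo_zero (n : ℕ) : VanishesTo n 0 := by
  induction n with
  | zero => trivial
  | succ n ih => exact ⟨map_zero _, fun i => by rw [map_zero]; exact ih⟩

theorem VanishesTo.smul {n : ℕ} {g : PS} (hg : VanishesTo n g) (c : ℂ) : VanishesTo n (c • g) := by
  induction n generalizing g with
  | zero => trivial
  | succ n ih =>
    refine ⟨by rw [constantCoeff_smul', hg.1, mul_zero], fun i => ?_⟩
    rw [Derivation.map_smul]
    exact ih (hg.2 i)

theorem VanishesTo.sum {n : ℕ} {κ : Type*} (s : Finset κ) {g : κ → PS}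
    (hg : ∀ i ∈ s, VanishesTo n (g i)) : VanishesTo n (∑ i ∈ s, g i) := by
  classical
  induction s using Finset.induction_on with
  | empty => rw [Finset.sum_empty]; exact vanishesTo_zero n
  | insert a s ha ih =>
    rw [Finset.sum_insert ha]
    exact (hg a (Finset.mem_insert_self a s)).add
      (ih fun i hi => hg i (Finset.mem_insert_of_mem hi))

/-- The even elements whose coefficients vanish to order `n`. -/
def EvenVanishes (n : ℕ) (X : EvenPart) : Prop := ∀ i, VanishesTo n (X.1 i)

/-- The odd elements whose coefficients vanish to order `n`. -/
def OddVanishes (n : ℕ) (f : OddPart) : Prop := ∀ i j, VanishesTo n (f.1 i j)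

theorem EvenVanishes.evenOddL_dForm {n : ℕ} {X : EvenPart} (h : EvenVanishes (n + 1) X)
    (P : Fin 5 × Fin 5) : OddVanishes n (evenOddL X (dForm P)) := by
  intro i j
  change VanishesTo n (lieDer X.1 (dForm P).1 i j)
  have e : ∀ a b, ∃ c : ℂ, (dForm P).1 a b = c • 1 := by
    intro a b
    refine ⟨(if (a, b) = P then 1 else 0) - (if (b, a) = P then 1 else 0), ?_⟩
    simp only [dForm, sub_smul, ite_smul, one_smul, zero_smul]
  simp only [lieDer, pd_dForm, mul_zero, zero_add]
  refine VanishesTo.sum _ fun k _ => ?_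
  obtain ⟨c, hc⟩ := e k j
  obtain ⟨c', hc'⟩ := e i k
  rw [hc, hc', mul_smul_comm, mul_smul_comm, mul_one, mul_one]
  exact (((h k).pd i).smul c).add (((h k).pd j).smul c')

theorem EvenVanishes.evenEvenL_delField {n : ℕ} {X : EvenPart} (h : EvenVanishes (n + 1) X)
    (t : Fin 5) : EvenVanishes n (evenEvenL X (delField t)) := by
  intro i
  rw [evenEvenL_neg]
  change VanishesTo n (-(evenEvenL (delField t) X).1 i)
  rw [E510.evenEvenL_delField, ← neg_one_smul ℂ]
  exact ((h i).pd t).smul (-1)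

theorem OddVanishes.oddOddL_dForm {n : ℕ} {f : OddPart} (h : OddVanishes n f)
    (P : Fin 5 × Fin 5) : EvenVanishes n (oddOddL f (dForm P)) := by
  intro t
  rw [oddOddL_apply_coe]
  refine (VanishesTo.sum _ fun i _ => VanishesTo.sum _ fun j _ => VanishesTo.sum _ fun k _ =>
    VanishesTo.sum _ fun l _ => ?_).smul _
  have e : (eps ![i, j, k, l, t] : PS) * (f.1 i j * (dForm P).1 k l) =
      ((eps ![i, j, k, l, t] : ℂ) * ((if (k, l) = P then 1 else 0) - (if (l, k) = P then 1 else 0)))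
        • f.1 i j := by
    simp only [dForm, sub_smul, ite_smul, zero_smul, mul_sub, mul_ite, mul_one, mul_zero,
      Int.cast_smul_eq_zsmul, zsmul_eq_mul]
  rw [e]
  exact (h i j).smul _

theorem OddVanishes.evenOddL_delField {n : ℕ} {f : OddPart} (h : OddVanishes (n + 1) f)
    (t : Fin 5) : OddVanishes n (evenOddL (delField t) f) := by
  intro i j
  rw [E510.evenOddL_delField]
  exact (h i j).pd t

/-! ## The components of degree one, two and three -/

theorem pd_X_smul (i j : Fin 5) :
    pd i (MvPowerSeries.X j : PS) = (if i = j then 1 else 0 : ℂ) • (1 : PS) := by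
  rw [pd_X]
  split_ifs <;> simp

theorem constantCoeff_pd_mul_X (b m a k : Fin 5) : MvPowerSeries.constantCoeff
    (pd b (pd m (MvPowerSeries.X a * MvPowerSeries.X k : PS))) =
      (if m = a then 1 else 0) * (if b = k then 1 else 0)
        + (if m = k then 1 else 0) * (if b = a then 1 else 0) := by
  simp only [Derivation.leibniz, pd_X_smul, smul_eq_mul, map_add, mul_smul_comm, mul_one,
    Derivation.map_smul, constantCoeff_smul', map_one]
  ring

theorem constantCoeff_pd_mul_X_mul_X (c d m a b k : Fin 5) : MvPowerSeries.constantCoeff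
    (pd c (pd d (pd m (MvPowerSeries.X a * MvPowerSeries.X b * MvPowerSeries.X k : PS)))) =
      (if m = a then 1 else 0) * (if d = b then 1 else 0) * (if c = k then 1 else 0)
      + (if m = a then 1 else 0) * (if d = k then 1 else 0) * (if c = b then 1 else 0)
      + (if m = b then 1 else 0) * (if d = a then 1 else 0) * (if c = k then 1 else 0)
      + (if m = b then 1 else 0) * (if d = k then 1 else 0) * (if c = a then 1 else 0)
      + (if m = k then 1 else 0) * (if d = a then 1 else 0) * (if c = b then 1 else 0)
      + (if m = k then 1 else 0) * (if d = b then 1 else 0) * (if c = a then 1 else 0) := by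
  simp only [Derivation.leibniz, pd_X_smul, smul_eq_mul, map_add, mul_smul_comm, mul_one,
    Derivation.map_smul, constantCoeff_smul', map_one, smul_add, mul_add]
  ring

theorem sum_etaL_apply {κ : Type*} [Fintype κ] (α : κ → Fin 5 → ℂ) (g : κ → PS) (m n : Fin 5) :
    (∑ s, ∑ j, α s j • etaL j (g s)).1 m n =
      ∑ s, (α s n • pd m (g s) - α s m • pd n (g s)) := by
  have e : ∀ s j, (α s j • etaL j (g s)).1 m n = α s j • (eta (g s) j).1 m n := fun _ _ => rfl
  simp only [Submodule.coe_sum, Finset.sum_apply, e, eta_apply, smul_sub, smul_ite, smul_zero,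
    Finset.sum_sub_distrib, Finset.sum_ite_eq, Finset.mem_univ, if_true]

theorem pd_cyclic_eq_zero (f : OddPart) (i j k : Fin 5) :
    pd i (f.1 j k) + pd j (f.1 k i) + pd k (f.1 i j) = 0 := f.2.2 i j k

theorem oddPart_antisymm (f : OddPart) (i j : Fin 5) : f.1 i j = -f.1 j i := f.2.1 i j

/-- The Poincaré lemma for the linear part. The Euler field `E` scales a two-form with linear
coefficients by 3, so Cartan's formula exhibits it as `1/3` of `d(ι_E f)`; expanding `ι_E f` in
monomials gives the coefficients. -/
theorem exists_quadratic_eta {f : OddPart} (hf : OddNonneg f) :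
    ∃ α : Fin 5 × Fin 5 → Fin 5 → ℂ, OddVanishes 2 (f - ∑ s, ∑ j, α s j •
      etaL j (MvPowerSeries.X s.1 * MvPowerSeries.X s.2)) := by
  refine ⟨fun s j => (1 / 3 : ℂ) * MvPowerSeries.constantCoeff (pd s.1 (f.1 s.2 j)),
    fun m n => ⟨?_, fun b => ⟨?_, fun _ => trivial⟩⟩⟩ <;>
    rw [Submodule.coe_sub, Pi.sub_apply, Pi.sub_apply, sum_etaL_apply]
  · have h := hf m n
    simp only [map_sub, map_sum, h, constantCoeff_smul', Derivation.leibniz, pd_X_smul, map_add,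
      mul_smul_comm, smul_eq_mul, mul_one, MvPowerSeries.constantCoeff_X, mul_zero, add_zero,
      sub_zero, Finset.sum_const_zero]
  · simp only [map_sub, map_sum, Derivation.map_smul, constantCoeff_smul', constantCoeff_pd_mul_X]
    have h1 := congrArg MvPowerSeries.constantCoeff (pd_cyclic_eq_zero f b m n)
    have h2 := congrArg (fun g => MvPowerSeries.constantCoeff (pd m g)) (oddPart_antisymm f n b)
    have h3 := congrArg (fun g => MvPowerSeries.constantCoeff (pd b g)) (oddPart_antisymm f n m)
    simp only [map_add, map_neg, map_zero] at h1 h2 h3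
    simp only [Fintype.sum_prod_type, mul_add, mul_ite, mul_one, mul_zero,
      Finset.sum_add_distrib, Finset.sum_sub_distrib, Finset.sum_ite_eq, Finset.sum_ite_irrel,
      Finset.sum_const_zero, Finset.mem_univ, if_true]
    linear_combination (1/3 : ℂ) * h1 - (1/3 : ℂ) * h2 + (1/3 : ℂ) * h3

/-- The same homotopy one degree higher: the Euler field scales by 4, and the Taylor coefficient
contributes a further `1/2`, whence `1/8`. -/
theorem exists_cubic_eta {f : OddPart} (hf : OddVanishes 2 f) :
    ∃ α : Fin 5 × Fin 5 × Fin 5 → Fin 5 → ℂ, OddVanishes 3 (f - ∑ s, ∑ j, α s j •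
      etaL j (MvPowerSeries.X s.1 * MvPowerSeries.X s.2.1 * MvPowerSeries.X s.2.2)) := by
  refine ⟨fun s j => (1 / 8 : ℂ) * MvPowerSeries.constantCoeff (pd s.1 (pd s.2.1 (f.1 s.2.2 j))),
    fun m n => ⟨?_, fun d => ⟨?_, fun c => ⟨?_, fun _ => trivial⟩⟩⟩⟩ <;>
    rw [Submodule.coe_sub, Pi.sub_apply, Pi.sub_apply, sum_etaL_apply]
  · have h := (hf m n).1
    simp only [map_sub, map_sum, h, constantCoeff_smul', Derivation.leibniz, pd_X_smul, map_add,
      mul_smul_comm, smul_eq_mul, mul_one, MvPowerSeries.constantCoeff_X, mul_zero, add_zero,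
      sub_zero, Finset.sum_const_zero, smul_add, mul_add, map_mul]
  · have h := ((hf m n).2 d).1
    simp only [map_sub, map_sum, h, constantCoeff_smul', Derivation.leibniz, pd_X_smul, map_add,
      mul_smul_comm, smul_eq_mul, mul_one, MvPowerSeries.constantCoeff_X, mul_zero, add_zero,
      sub_zero, Finset.sum_const_zero, smul_add, mul_add, Derivation.map_smul]
  · simp only [map_sub, map_sum, Derivation.map_smul, constantCoeff_smul',
      constantCoeff_pd_mul_X_mul_X]
    have h1 := congrArg (fun g => MvPowerSeries.constantCoeff (pd c g)) (pd_cyclic_eq_zero f m d n)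
    have h2 := congrArg (fun g => MvPowerSeries.constantCoeff (pd d g)) (pd_cyclic_eq_zero f m c n)
    have ha : ∀ i j k l, MvPowerSeries.constantCoeff (pd i (pd j (f.1 k l))) =
        -MvPowerSeries.constantCoeff (pd i (pd j (f.1 l k))) := fun i j k l => by
      rw [oddPart_antisymm f k l, map_neg, map_neg, map_neg]
    have hs : ∀ i j k l, MvPowerSeries.constantCoeff (pd i (pd j (f.1 k l))) =
        MvPowerSeries.constantCoeff (pd j (pd i (f.1 k l))) := fun i j k l => by rw [pd_comm]
    simp only [map_add, map_zero] at h1 h2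
    simp only [Fintype.sum_prod_type, mul_add, mul_ite, mul_one, mul_zero,
      Finset.sum_add_distrib, Finset.sum_sub_distrib, Finset.sum_ite_eq, Finset.sum_ite_irrel,
      Finset.sum_const_zero, Finset.mem_univ, if_true]
    rw [hs m d c n, hs m c d n, hs d c m n, hs n d c m, hs n c d m, hs d c n m]
    rw [ha c n m d] at h1
    rw [ha d n m c, hs d c n m] at h2
    linear_combination -(1 / 4 : ℂ) * h1 - (1 / 4 : ℂ) * h2 + (3 / 4 : ℂ) * ha c d n m

theorem sum_xiL_apply {κ : Type*} [Fintype κ] (α : κ → Fin 5 → ℂ) (g : κ → Fin 5 → PS) (n : Fin 5) :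
    (∑ s, ∑ i, ∑ j, α s j • xiL i j (g s i)).1 n =
      ∑ s, ∑ i, (α s n • pd i (g s i) - α s i • pd i (g s n)) := by
  have e : ∀ s i j, (α s j • xiL i j (g s i)).1 n = α s j • (xiL i j (g s i)).1 n :=
    fun _ _ _ => rfl
  simp only [Submodule.coe_sum, Finset.sum_apply, e, xiL_apply, smul_sub, smul_ite, smul_zero,
    Finset.sum_sub_distrib, Finset.sum_ite_eq, Finset.mem_univ, if_true, Finset.sum_ite_irrel,
    Finset.sum_const_zero]

/-- For a quadratic divergence-free `X`, summing the fields attached to `x_i X_j` over `i, j` gives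
`(5 + 2 - 1) X = 6 X`: 5 from the dimension, 2 from Euler's formula, and -1 from the second term,
whose divergence part is zero. With the `1/2` of the Taylor coefficient this is `1/12`. -/
theorem exists_cubic_xi {X : EvenPart} (hX : EvenVanishes 2 X) :
    ∃ α : Fin 5 × Fin 5 → Fin 5 → ℂ, EvenVanishes 3 (X - ∑ s, ∑ i, ∑ j, α s j •
      xiL i j (MvPowerSeries.X i * MvPowerSeries.X s.1 * MvPowerSeries.X s.2)) := by
  refine ⟨fun s j => (1 / 12 : ℂ) * MvPowerSeries.constantCoeff (pd s.1 (pd s.2 (X.1 j))),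
    fun n => ⟨?_, fun d => ⟨?_, fun c => ⟨?_, fun _ => trivial⟩⟩⟩⟩ <;>
    rw [Submodule.coe_sub, Pi.sub_apply, sum_xiL_apply]
  · have h := (hX n).1
    simp only [map_sub, map_sum, h, constantCoeff_smul', Derivation.leibniz, pd_X_smul, map_add,
      mul_smul_comm, smul_eq_mul, mul_one, MvPowerSeries.constantCoeff_X, mul_zero, add_zero,
      sub_zero, Finset.sum_const_zero, smul_add, mul_add, map_mul]
  · have h := ((hX n).2 d).1
    simp only [map_sub, map_sum, h, constantCoeff_smul', Derivation.leibniz, pd_X_smul, map_add,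
      mul_smul_comm, smul_eq_mul, mul_one, MvPowerSeries.constantCoeff_X, mul_zero, add_zero,
      sub_zero, Finset.sum_const_zero, smul_add, mul_add, Derivation.map_smul]
  · simp only [map_sub, map_sum, Derivation.map_smul, constantCoeff_smul',
      constantCoeff_pd_mul_X_mul_X]
    have hd : ∀ e, ∑ j, MvPowerSeries.constantCoeff (pd e (pd j (X.1 j))) = 0 := fun e => by
      rw [← map_sum, ← map_sum, mem_evenPart.mp X.2, map_zero, map_zero]
    have hs : ∀ i j k, MvPowerSeries.constantCoeff (pd i (pd j (X.1 k))) =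
        MvPowerSeries.constantCoeff (pd j (pd i (X.1 k))) := fun i j k => by rw [pd_comm]
    simp only [Fintype.sum_prod_type, mul_add, mul_ite, mul_one, mul_zero,
      Finset.sum_add_distrib, Finset.sum_sub_distrib, Finset.sum_ite_eq, Finset.sum_ite_irrel,
      Finset.sum_const_zero, Finset.mem_univ, if_true]
    have hc : ∀ e, ∑ x, (1 / 12 : ℂ) * MvPowerSeries.constantCoeff (pd x (pd e (X.1 x))) = 0 := by
      intro e
      simp only [fun x => hs x e x, ← Finset.mul_sum, hd, mul_zero]
    simp only [Finset.sum_ite_eq', Finset.mem_univ, if_true, hc, ← Finset.mul_sum, hd, mul_zero,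
      ite_self, Finset.sum_const, Finset.card_univ, Fintype.card_fin]
    rw [hs d c n]
    simp only [nsmul_eq_mul]
    push_cast
    ring

theorem evenVanishes_sub_linear {X : EvenPart} (hX : EvenNonneg X) :
    EvenVanishes 2 (X - slField (linearPart X)) := by
  refine fun n => ⟨?_, fun d => ⟨?_, fun _ => trivial⟩⟩ <;>
    rw [Submodule.coe_sub, Pi.sub_apply]
  · rw [map_sub, hX n, evenNonneg_slField, sub_zero]
  · rw [map_sub, pd_slField, map_sub, constantCoeff_smul', map_one, mul_one,
      linearPart_apply, sub_self]

/-! ## Vectors annihilated by `L_+` -/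

section Annihilators

variable {M : Type*} [AddCommGroup M] [Module U M] {V : Type*} (m : V → M)

/-- The even elements annihilating all `m v`. -/
def killEven : Submodule ℂ EvenPart where
  carrier := {X | ∀ v, ιEven X • m v = 0}
  zero_mem' v := by rw [map_zero, zero_smul]
  add_mem' hX hY v := by rw [map_add, add_smul, hX v, hY v, add_zero]
  smul_mem' c X hX v := by
    rw [map_smul, Algebra.smul_def, mul_smul, hX v, smul_zero]

/-- The odd elements annihilating all `m v`. -/
def killOdd : Submodule ℂ OddPart where
  carrier := {f | ∀ v, ιOdd f • m v = 0}
  zero_mem' v := by rw [map_zero, zero_smul]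
  add_mem' hX hY v := by rw [map_add, add_smul, hX v, hY v, add_zero]
  smul_mem' c X hX v := by
    rw [map_smul, Algebra.smul_def, mul_smul, hX v, smul_zero]

variable {m}

theorem mem_killEven {X : EvenPart} : X ∈ killEven m ↔ ∀ v, ι (ev X) • m v = 0 := Iff.rfl

theorem mem_killOdd {f : OddPart} : f ∈ killOdd m ↔ ∀ v, ι (od f) • m v = 0 := Iff.rfl

theorem oddOddL_mem_killEven {f g : OddPart} (hf : f ∈ killOdd m) (hg : g ∈ killOdd m) :
    oddOddL f g ∈ killEven m := by
  rw [mem_killOdd] at hf hg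
  intro v
  rw [ιEven_apply, ← ι_od_mul_ι_od, add_smul, mul_smul, mul_smul, hf, hg, smul_zero, smul_zero,
    add_zero]

theorem evenOddL_mem_killOdd {X : EvenPart} {f : OddPart} (hX : X ∈ killEven m)
    (hf : f ∈ killOdd m) : evenOddL X f ∈ killOdd m := by
  rw [mem_killEven] at hX
  rw [mem_killOdd] at hf
  intro v
  rw [ιOdd_apply, ← sub_eq_of_eq_add' (ι_ev_mul_ι_od X f), sub_smul, mul_smul, mul_smul, hf, hX,
    smul_zero, smul_zero, sub_zero]

variable [Bracket sl5 V]

/-- The family `m` is carried into itself by `L_0`, so its annihilator is normalized by `L_0`. -/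
theorem evenOddL_slField_mem_killOdd (hm : ∀ (x : sl5) v, slU x • m v = m ⁅x, v⁆) (x : sl5)
    {f : OddPart} (hf : f ∈ killOdd m) : evenOddL (slField x) f ∈ killOdd m := by
  rw [mem_killOdd] at hf
  intro v
  have h : ι (ev (slField x)) • m v = m ⁅x, v⁆ := hm x v
  rw [ιOdd_apply, ← sub_eq_of_eq_add' (ι_ev_mul_ι_od _ f), sub_smul, mul_smul, mul_smul, hf, h,
    hf, smul_zero, sub_zero]

theorem evenEvenL_slField_mem_killEven (hm : ∀ (x : sl5) v, slU x • m v = m ⁅x, v⁆) (x : sl5)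
    {X : EvenPart} (hX : X ∈ killEven m) : evenEvenL (slField x) X ∈ killEven m := by
  rw [mem_killEven] at hX
  intro v
  have h : ι (ev (slField x)) • m v = m ⁅x, v⁆ := hm x v
  rw [ιEven_apply, ← sub_eq_of_eq_add' (ι_ev_mul_ι_ev _ X), sub_smul, mul_smul, mul_smul, hX, h,
    hX, smul_zero, sub_zero]

variable (m) in
/-- The power series `g` such that all forms `dg ∧ dx_j` annihilate all `m v`. -/
def killEta : Submodule ℂ PS := ⨅ j, (killOdd m).comap (etaL j)

variable (m) in
/-- The power series `h` such that all fields `∂_i h ∂_j - ∂_j h ∂_i` annihilate all `m v`. -/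
def killXi : Submodule ℂ PS := ⨅ i, ⨅ j, (killEven m).comap (xiL i j)

theorem mem_killEta {g : PS} : g ∈ killEta m ↔ ∀ j, eta g j ∈ killOdd m := by
  simp only [killEta, Submodule.mem_iInf, Submodule.mem_comap, etaL_apply]

theorem mem_killXi {g : PS} : g ∈ killXi m ↔ ∀ i j, xiL i j g ∈ killEven m := by
  simp only [killXi, Submodule.mem_iInf, Submodule.mem_comap]

/-- The action of `x_a ∂_p` on `dg ∧ dx_j` is its action on `g` plus a change of the factor `dx_j`.
Because membership is demanded for every `j`, that change is harmless and the condition on `g` alone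
is stable. -/
theorem X_mul_pd_mem_killEta (hm : ∀ (x : sl5) v, slU x • m v = m ⁅x, v⁆) {g : PS}
    (hg : g ∈ killEta m) {a p : Fin 5} (h : a ≠ p) :
    MvPowerSeries.X a * pd p g ∈ killEta m := by
  rw [mem_killEta] at *
  intro j
  rw [← sub_eq_of_eq_add (evenOddL_xdel_eta h g j)]
  refine sub_mem (evenOddL_slField_mem_killOdd hm _ (hg j)) ?_
  split_ifs
  exacts [hg a, zero_mem _]

theorem X_mul_pd_mem_killXi (hm : ∀ (x : sl5) v, slU x • m v = m ⁅x, v⁆) {g : PS}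
    (hg : g ∈ killXi m) {a p : Fin 5} (h : a ≠ p) :
    MvPowerSeries.X a * pd p g ∈ killXi m := by
  rw [mem_killXi] at *
  intro i j
  have e := evenEvenL_xdel_xi h g i j
  rw [sub_sub, eq_sub_iff_add_eq] at e
  rw [← e]
  refine add_mem (evenEvenL_slField_mem_killEven hm _ (hg i j)) (add_mem ?_ ?_) <;> split_ifs
  exacts [hg p j, zero_mem _, hg i p, zero_mem _]

end Annihilators

/-! ### Monomials from pure powers, and brackets of explicit elements -/

theorem mul_X_mem {S : Submodule ℂ PS}
    (hS : ∀ g ∈ S, ∀ a p : Fin 5, a ≠ p → MvPowerSeries.X a * pd p g ∈ S)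
    (h : ∀ p : Fin 5, MvPowerSeries.X p * MvPowerSeries.X p ∈ S) (a b : Fin 5) :
    MvPowerSeries.X a * MvPowerSeries.X b ∈ S := by
  by_cases hab : a = b
  · rw [hab]; exact h b
  · have h1 := hS _ (h b) a b hab
    have e : MvPowerSeries.X a * pd b (MvPowerSeries.X b * MvPowerSeries.X b) =
        (2 : ℂ) • (MvPowerSeries.X a * MvPowerSeries.X b : PS) := by
      simp only [Derivation.leibniz, pd_X_smul, if_true, smul_eq_mul, one_smul, mul_one, mul_add]
      module
    rw [e] at h1
    exact (Submodule.smul_mem_iff S two_ne_zero).mp h1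

/-- Polarization: `x_a ∂_p` turns `x_p^3` into `3 x_a x_p^2`, and a second such step separates the
remaining square. -/
theorem mul_X_mul_X_mem {S : Submodule ℂ PS}
    (hS : ∀ g ∈ S, ∀ a p : Fin 5, a ≠ p → MvPowerSeries.X a * pd p g ∈ S)
    (h : ∀ p : Fin 5, MvPowerSeries.X p * MvPowerSeries.X p * MvPowerSeries.X p ∈ S)
    (a b c : Fin 5) : MvPowerSeries.X a * MvPowerSeries.X b * MvPowerSeries.X c ∈ S := by
  have h2 : ∀ a p : Fin 5, MvPowerSeries.X a * MvPowerSeries.X p * MvPowerSeries.X p ∈ S := by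
    intro a p
    by_cases hap : a = p
    · rw [hap]; exact h p
    · have h1 := hS _ (h p) a p hap
      have e : MvPowerSeries.X a * pd p (MvPowerSeries.X p * MvPowerSeries.X p * MvPowerSeries.X p)
          = (3 : ℂ) • (MvPowerSeries.X a * MvPowerSeries.X p * MvPowerSeries.X p : PS) := by
        simp only [Derivation.leibniz, pd_X_smul, if_true, smul_eq_mul, one_smul, mul_one, mul_add,
          ← mul_assoc]
        module
      rw [e] at h1
      exact (Submodule.smul_mem_iff S three_ne_zero).mp h1
  by_cases hac : a = c
  · rw [hac, mul_comm (MvPowerSeries.X c), mul_assoc, ← mul_assoc]; exact h2 b c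
  · by_cases hbc : b = c
    · rw [hbc]; exact h2 a c
    · have h1 := hS _ (h2 b c) a c hac
      have e : MvPowerSeries.X a * pd c (MvPowerSeries.X b * MvPowerSeries.X c * MvPowerSeries.X c)
          = (2 : ℂ) • (MvPowerSeries.X a * MvPowerSeries.X b * MvPowerSeries.X c : PS) := by
        simp only [Derivation.leibniz, pd_X_smul, if_true, smul_eq_mul, one_smul, mul_one, mul_add,
          ← mul_assoc, if_neg (Ne.symm hbc), zero_smul, mul_zero, add_zero]
        rw [two_smul]
        ring
      rw [e] at h1
      exact (Submodule.smul_mem_iff S two_ne_zero).mp h1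

theorem eta_sq (p : Fin 5) : eta (MvPowerSeries.X p * MvPowerSeries.X p) p = 0 := by
  refine Subtype.ext (funext fun a => funext fun b => ?_)
  rw [eta_apply]
  simp only [Derivation.leibniz, pd_X]
  by_cases ha : a = p <;> by_cases hb : b = p <;> simp [ha, hb]

theorem eta_cube (p : Fin 5) :
    eta (MvPowerSeries.X p * MvPowerSeries.X p * MvPowerSeries.X p) p = 0 := by
  refine Subtype.ext (funext fun a => funext fun b => ?_)
  rw [eta_apply]
  simp only [Derivation.leibniz, pd_X]
  by_cases ha : a = p <;> by_cases hb : b = p <;> simp [ha, hb]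

theorem pd_X_cube (i p : Fin 5) :
    pd i (MvPowerSeries.X p * MvPowerSeries.X p * MvPowerSeries.X p : PS) =
      if i = p then (3 : ℂ) • (MvPowerSeries.X p * MvPowerSeries.X p) else 0 := by
  simp only [Derivation.leibniz, pd_X_smul, smul_eq_mul]
  split_ifs
  · have e : (3 : ℂ) • (MvPowerSeries.X p * MvPowerSeries.X p : PS) =
        MvPowerSeries.X p * MvPowerSeries.X p + MvPowerSeries.X p * MvPowerSeries.X p
          + MvPowerSeries.X p * MvPowerSeries.X p := by module
    rw [e, one_smul]
    ring
  · simp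

/-- The left side is `3 x_p^2 ∂_q`. In `[x_p d_{pk}, d(x_p x_n) ∧ dx_l]` the summand `x_n d_{pl}`
repeats `p` and drops out, so the bracket is `± x_p^2 ∂_q`. -/
theorem xiL_cube {p q k n l : Fin 5} (h : [p, q, k, n, l].Nodup) :
    xiL p q (MvPowerSeries.X p * MvPowerSeries.X p * MvPowerSeries.X p) =
      (3 * eps ![p, k, n, l, q] : ℂ) •
        oddOddL (zForm p k) (eta (MvPowerSeries.X p * MvPowerSeries.X n) l) := by
  refine Subtype.ext (funext fun t => ?_)
  have hn := h
  simp only [List.nodup_cons, List.mem_cons, not_or, List.not_mem_nil, not_false_eq_true,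
    List.nodup_nil, and_true] at hn
  obtain ⟨⟨hpq, hpk, hpn, hpl⟩, ⟨hqk, hqn, hql⟩, ⟨hkn, hkl⟩, hnl⟩ := hn
  have hn' : [p, k, n, l, q].Nodup := by
    refine (List.Perm.nodup_iff ?_).mp h
    exact (List.perm_append_comm (l₁ := [q]) (l₂ := [k, n, l])).cons p
  change _ = (3 * eps ![p, k, n, l, q] : ℂ) • (oddOddL (zForm p k) (eta _ l)).1 t
  rw [oddOddL_zForm_eta_apply, xiL_apply, pd_X_cube, pd_X_cube, if_pos rfl, if_neg (Ne.symm hpq),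
    ite_self, sub_zero]
  have e : ∑ i, (eps ![p, k, i, l, t] : PS) * pd i (MvPowerSeries.X p * MvPowerSeries.X n) =
      (eps ![p, k, n, l, t] : PS) * MvPowerSeries.X p := by
    simp only [Derivation.leibniz, pd_X, smul_eq_mul, mul_add, mul_ite, mul_one, mul_zero,
      Finset.sum_add_distrib, Finset.sum_ite_eq', Finset.mem_univ, if_true, eps_eq02, Int.cast_zero,
      zero_mul, add_zero]
  rw [e]
  split_ifs with ht
  · rw [ht, mul_left_comm, ← zsmul_eq_mul, ← Int.cast_smul_eq_zsmul ℂ, smul_smul, mul_assoc,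
      eps_sq hn', mul_one]
  · have h0 : eps ![p, k, n, l, t] = 0 := by
      have : t = p ∨ t = k ∨ t = n ∨ t = l := by
        by_contra hc
        simp only [not_or] at hc
        have h6 : [t, p, q, k, n, l].Nodup := by
          rw [List.nodup_cons]
          refine ⟨?_, h⟩
          simp [hc, ht]
        have := h6.length_le_card
        simp at this
      rcases this with rfl | rfl | rfl | rfl <;> simp
    rw [h0]
    simp

theorem xiL_swap (i j : Fin 5) (h : PS) : xiL j i h = -xiL i j h :=
  Subtype.ext (funext fun n => by
    change (xiL j i h).1 n = -(xiL i j h).1 n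
    rw [xiL_apply, xiL_apply, neg_sub])

/-! ### Annihilation of the low-degree components of `L_+` -/

section Annihilators

variable {M : Type*} [AddCommGroup M] [Module U M] {V : Type*} {m : V → M} [Bracket sl5 V]

/-- The hypothesis says that `d(x_p^2) ∧ dx_q`, twice `x_p d_{pq}`, annihilates; for `q = p` this
form is zero. The action of `L_0` then reaches all quadratic monomials. -/
theorem mul_X_mem_killEta (hm : ∀ (x : sl5) v, slU x • m v = m ⁅x, v⁆)
    (hz : ∀ p q : Fin 5, p ≠ q → ∀ v, ι (od (zForm p q)) • m v = 0) (a b : Fin 5) :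
    MvPowerSeries.X a * MvPowerSeries.X b ∈ killEta m := by
  refine mul_X_mem (fun g hg a p h => X_mul_pd_mem_killEta hm hg h) (fun p => ?_) a b
  rw [mem_killEta]
  intro q
  by_cases hpq : p = q
  · rw [hpq, eta_sq]
    exact zero_mem _
  · have h1 : zForm p q ∈ killOdd m := mem_killOdd.mpr (hz p q hpq)
    rw [zForm] at h1
    exact (Submodule.smul_mem_iff _ (by norm_num : (1 / 2 : ℂ) ≠ 0)).mp h1

/-- Cubes suffice. For `x_p^3` the field is nonzero only if one index is `p`, and then it is a
multiple of a bracket of two annihilating forms by `xiL_cube`. -/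
theorem mul_X_mul_X_mem_killXi (hm : ∀ (x : sl5) v, slU x • m v = m ⁅x, v⁆)
    (hz : ∀ p q : Fin 5, p ≠ q → ∀ v, ι (od (zForm p q)) • m v = 0) (a b c : Fin 5) :
    MvPowerSeries.X a * MvPowerSeries.X b * MvPowerSeries.X c ∈ killXi m := by
  refine mul_X_mul_X_mem (fun g hg a p h => X_mul_pd_mem_killXi hm hg h) (fun p => ?_) a b c
  have h1 : ∀ j, xiL p j (MvPowerSeries.X p * MvPowerSeries.X p * MvPowerSeries.X p) ∈
      killEven m := by
    intro j
    by_cases hpj : p = j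
    · rw [hpj]
      have : xiL j j (MvPowerSeries.X j * MvPowerSeries.X j * MvPowerSeries.X j) = 0 :=
        eq_zero_of_eq_neg (xiL_swap j j _)
      rw [this]
      exact zero_mem _
    · obtain ⟨k, n, l, h⟩ := exists_nodup hpj
      have hpk : p ≠ k := by rintro rfl; simp at h
      rw [xiL_cube h]
      exact Submodule.smul_mem _ _ (oddOddL_mem_killEven (mem_killOdd.mpr (hz p k hpk))
        (mem_killEta.mp (mul_X_mem_killEta hm hz p n) l))
  rw [mem_killXi]
  intro i j
  by_cases hi : i = p
  · rw [hi]; exact h1 j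
  · by_cases hj : j = p
    · rw [hj, xiL_swap]
      exact neg_mem (h1 i)
    · have : xiL i j (MvPowerSeries.X p * MvPowerSeries.X p * MvPowerSeries.X p) = 0 := by
        refine Subtype.ext (funext fun n => ?_)
        rw [xiL_apply, pd_X_cube, pd_X_cube, if_neg hi, if_neg hj, ite_self, ite_self, sub_zero]
        rfl
      rw [this]
      exact zero_mem _

/-- Again cubes suffice. With `r` different from `p` and `q`, the field `x_p^2 ∂_r` sends `d(x_p
x_r) ∧ dx_q` to `d(x_p^3) ∧ dx_q`, and both inputs already annihilate. -/
theorem mul_X_mul_X_mem_killEta (hm : ∀ (x : sl5) v, slU x • m v = m ⁅x, v⁆)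
    (hz : ∀ p q : Fin 5, p ≠ q → ∀ v, ι (od (zForm p q)) • m v = 0) (a b c : Fin 5) :
    MvPowerSeries.X a * MvPowerSeries.X b * MvPowerSeries.X c ∈ killEta m := by
  refine mul_X_mul_X_mem (fun g hg a p h => X_mul_pd_mem_killEta hm hg h) (fun p => ?_) a b c
  rw [mem_killEta]
  intro q
  by_cases hpq : p = q
  · rw [hpq, eta_cube]
    exact zero_mem _
  · obtain ⟨r, _, _, h⟩ := exists_nodup hpq
    simp only [List.nodup_cons, List.mem_cons, not_or] at h
    have hpr : p ≠ r := h.1.2.1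
    have hqr : q ≠ r := h.2.1.1
    have h1 := evenOddL_mem_killOdd
      (mem_killXi.mp (mul_X_mul_X_mem_killXi hm hz p p p) p r)
      (mem_killEta.mp (mul_X_mem_killEta hm hz p r) q)
    have e : evenOddL (xiL p r (MvPowerSeries.X p * MvPowerSeries.X p * MvPowerSeries.X p))
        (eta (MvPowerSeries.X p * MvPowerSeries.X r) q) =
        (3 : ℂ) • eta (MvPowerSeries.X p * MvPowerSeries.X p * MvPowerSeries.X p) q := by
      have hX : ∀ n, (xiL p r (MvPowerSeries.X p * MvPowerSeries.X p * MvPowerSeries.X p)).1 n =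
          if n = r then (3 : ℂ) • (MvPowerSeries.X p * MvPowerSeries.X p) else 0 := by
        intro n
        rw [xiL_apply, pd_X_cube, pd_X_cube, if_pos rfl, if_neg (Ne.symm hpr), ite_self, sub_zero]
      rw [← etaL_apply q (_ * _ * _), ← map_smul, etaL_apply]
      refine Subtype.ext (funext fun a => funext fun b => ?_)
      rw [evenOddL_eta_apply, hX q, if_neg hqr, map_zero, map_zero, mul_zero, mul_zero, sub_zero,
        add_zero]
      simp only [hX, ite_mul, zero_mul, Finset.sum_ite_eq', Finset.mem_univ, if_true,
        Derivation.leibniz, pd_X_smul, if_neg (Ne.symm hpr), one_smul, zero_smul,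
        smul_eq_mul, mul_one, mul_zero, add_zero, smul_mul_assoc]
    rw [e] at h1
    exact (Submodule.smul_mem_iff _ three_ne_zero).mp h1

/-- Subtracting exact forms with linear and then with quadratic coefficients, all of which
annihilate, leaves a form vanishing to order three. -/
theorem ι_od_smul_eq_zero (hm : ∀ (x : sl5) v, slU x • m v = m ⁅x, v⁆)
    (hz : ∀ p q : Fin 5, p ≠ q → ∀ v, ι (od (zForm p q)) • m v = 0)
    (hO : ∀ f, OddVanishes 3 f → ∀ v, ι (od f) • m v = 0) {f : OddPart} (hf : OddNonneg f) (v : V) :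
    ι (od f) • m v = 0 := by
  obtain ⟨α, hα⟩ := exists_quadratic_eta hf
  obtain ⟨β, hβ⟩ := exists_cubic_eta hα
  have h1 := mem_killOdd.mpr (hO _ hβ)
  refine mem_killOdd.mp ?_ v
  have s2 : ∑ s, ∑ j, α s j • etaL j (MvPowerSeries.X s.1 * MvPowerSeries.X s.2) ∈ killOdd m :=
    Submodule.sum_mem _ fun s _ => Submodule.sum_mem _ fun j _ => Submodule.smul_mem _ _
      (mem_killEta.mp (mul_X_mem_killEta hm hz s.1 s.2) j)
  have s3 : ∑ s, ∑ j, β s j • etaL j (MvPowerSeries.X s.1 * MvPowerSeries.X s.2.1 *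
      MvPowerSeries.X s.2.2) ∈ killOdd m :=
    Submodule.sum_mem _ fun s _ => Submodule.sum_mem _ fun j _ => Submodule.smul_mem _ _
      (mem_killEta.mp (mul_X_mul_X_mem_killEta hm hz s.1 s.2.1 s.2.2) j)
  rwa [Submodule.sub_mem_iff_left _ s3, Submodule.sub_mem_iff_left _ s2] at h1

theorem ι_ev_smul_eq (hm : ∀ (x : sl5) v, slU x • m v = m ⁅x, v⁆)
    (hz : ∀ p q : Fin 5, p ≠ q → ∀ v, ι (od (zForm p q)) • m v = 0)
    (hE : ∀ X, EvenVanishes 3 X → ∀ v, ι (ev X) • m v = 0) {X : EvenPart} (hX : EvenNonneg X)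
    (v : V) : ι (ev X) • m v = m ⁅linearPart X, v⁆ := by
  obtain ⟨α, hα⟩ := exists_cubic_xi (evenVanishes_sub_linear hX)
  have h1 := mem_killEven.mpr (hE _ hα)
  have s3 : ∑ s, ∑ i, ∑ j, α s j • xiL i j (MvPowerSeries.X i * MvPowerSeries.X s.1 *
      MvPowerSeries.X s.2) ∈ killEven m :=
    Submodule.sum_mem _ fun s _ => Submodule.sum_mem _ fun i _ => Submodule.sum_mem _ fun j _ =>
      Submodule.smul_mem _ _ (mem_killXi.mp (mul_X_mul_X_mem_killXi hm hz i s.1 s.2) i j)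
  rw [Submodule.sub_mem_iff_left _ s3] at h1
  have h2 : ιEven (X - slField (linearPart X)) • m v = 0 := h1 v
  rw [map_sub, sub_smul, sub_eq_zero] at h2
  exact h2.trans (hm _ v)

end Annihilators

/-! ## Elements of high degree annihilate `Φ(v)` -/

section HighDegree

variable {W : Type*} [AddCommGroup W] [Module ℂ W] [LieRingModule sl5 W] [LieModule ℂ sl5 W]

theorem EvenVanishes.of_succ {n : ℕ} {X : EvenPart} (h : EvenVanishes (n + 1) X) :
    EvenVanishes n X := fun i => (h i).of_succ

theorem OddVanishes.of_succ {n : ℕ} {f : OddPart} (h : OddVanishes (n + 1) f) :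
    OddVanishes n f := fun i j => (h i j).of_succ

/-- The start of a degree count. In the lemmas below, passing a factor `d_P` or `∂_t` leaves a
bracket term: one with `d_P` costs an even element one order of vanishing and an odd element none,
while one with `∂_t` costs one order in both cases. Three orders outlast all words that occur in
`Φ`. -/
theorem EvenVanishes.smul_vone {X : EvenPart} (h : EvenVanishes 2 X) (w : W) :
    ι (ev X) • vone w = 0 := by
  have h1 : linearPart X = 0 := Subtype.ext (Matrix.ext fun i j => by
    rw [linearPart_apply]
    exact ((h j).2 i).1)
  rw [ι_ev_smul_vone (fun i => (h i).1), h1, zero_lie, map_zero]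

theorem OddVanishes.smul_vone {f : OddPart} (h : OddVanishes 1 f) (w : W) :
    ι (od f) • vone w = 0 := ι_od_smul_vone (fun i j => (h i j).1) w

theorem ι_ev_smul_dd_smul (X : EvenPart) (P : Fin 5 × Fin 5) (m : Verma W) :
    ι (ev X) • dd P • m = dd P • ι (ev X) • m + ι (od (evenOddL X (dForm P))) • m := by
  rw [← mul_smul, ← mul_smul, ← add_smul, dd, ι_ev_mul_ι_od]

theorem ι_od_smul_dd_smul (f : OddPart) (P : Fin 5 × Fin 5) (m : Verma W) :
    ι (od f) • dd P • m = ι (ev (oddOddL f (dForm P))) • m - dd P • ι (od f) • m := by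
  rw [← mul_smul, ← mul_smul, ← sub_smul, dd, ← ι_od_mul_ι_od, add_sub_cancel_right]

theorem ι_ev_smul_del_smul (X : EvenPart) (t : Fin 5) (m : Verma W) :
    ι (ev X) • del t • m = del t • ι (ev X) • m + ι (ev (evenEvenL X (delField t))) • m := by
  rw [← mul_smul, ← mul_smul, ← add_smul, del, ι_ev_mul_ι_ev]

theorem ι_od_smul_del_smul (f : OddPart) (t : Fin 5) (m : Verma W) :
    ι (od f) • del t • m = del t • ι (od f) • m - ι (od (evenOddL (delField t) f)) • m := by
  rw [← mul_smul, ← mul_smul, ← sub_smul, del, ι_ev_mul_ι_od, add_sub_cancel_right]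

theorem EvenVanishes.smul_dd {X : EvenPart} (h : EvenVanishes 2 X) (P : Fin 5 × Fin 5) (w : W) :
    ι (ev X) • dd P • vone w = 0 := by
  rw [ι_ev_smul_dd_smul, h.smul_vone, (h.evenOddL_dForm P).smul_vone, smul_zero, add_zero]

theorem OddVanishes.smul_dd {f : OddPart} (h : OddVanishes 2 f) (P : Fin 5 × Fin 5) (w : W) :
    ι (od f) • dd P • vone w = 0 := by
  rw [ι_od_smul_dd_smul, h.of_succ.smul_vone, (h.oddOddL_dForm P).smul_vone, smul_zero, sub_zero]

theorem EvenVanishes.smul_dd_dd {X : EvenPart} (h : EvenVanishes 3 X) (P Q : Fin 5 × Fin 5)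
    (w : W) : ι (ev X) • dd P • dd Q • vone w = 0 := by
  rw [ι_ev_smul_dd_smul, h.of_succ.smul_dd, (h.evenOddL_dForm P).smul_dd, smul_zero, add_zero]

theorem OddVanishes.smul_dd_dd {f : OddPart} (h : OddVanishes 2 f) (P Q : Fin 5 × Fin 5) (w : W) :
    ι (od f) • dd P • dd Q • vone w = 0 := by
  rw [ι_od_smul_dd_smul, h.smul_dd, (h.oddOddL_dForm P).smul_dd, smul_zero, sub_zero]

theorem EvenVanishes.smul_dd_dd_dd {X : EvenPart} (h : EvenVanishes 3 X) (P Q R : Fin 5 × Fin 5)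
    (w : W) : ι (ev X) • dd P • dd Q • dd R • vone w = 0 := by
  rw [ι_ev_smul_dd_smul, h.smul_dd_dd, (h.evenOddL_dForm P).smul_dd_dd, smul_zero, add_zero]

theorem OddVanishes.smul_dd_dd_dd {f : OddPart} (h : OddVanishes 3 f) (P Q R : Fin 5 × Fin 5)
    (w : W) : ι (od f) • dd P • dd Q • dd R • vone w = 0 := by
  rw [ι_od_smul_dd_smul, h.of_succ.smul_dd_dd, (h.oddOddL_dForm P).smul_dd_dd, smul_zero, sub_zero]

theorem EvenVanishes.smul_del_dd {X : EvenPart} (h : EvenVanishes 3 X) (t : Fin 5)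
    (P : Fin 5 × Fin 5) (w : W) : ι (ev X) • del t • dd P • vone w = 0 := by
  rw [ι_ev_smul_del_smul, h.of_succ.smul_dd, (h.evenEvenL_delField t).smul_dd, smul_zero, add_zero]

theorem OddVanishes.smul_del_dd {f : OddPart} (h : OddVanishes 3 f) (t : Fin 5)
    (P : Fin 5 × Fin 5) (w : W) : ι (od f) • del t • dd P • vone w = 0 := by
  rw [ι_od_smul_del_smul, h.of_succ.smul_dd, (h.evenOddL_delField t).smul_dd, smul_zero, sub_zero]

variable {V : Type*} [AddCommGroup V] [Module ℂ V] [LieRingModule sl5 V] [LieModule ℂ sl5 V]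
variable {θ : Idx 3 → (V →ₗ[ℂ] W)} {θ' : Fin 5 → Idx 1 → (V →ₗ[ℂ] W)}

theorem smul_applyPhi_eq_zero (hθ : IsAlternating θ) (hθ' : ∀ t, IsAlternating (θ' t)) (u : U)
    (h3 : ∀ P Q R (w : W), u • dd P • dd Q • dd R • vone w = 0)
    (h1 : ∀ t P (w : W), u • del t • dd P • vone w = 0) (v : V) :
    u • applyPhi (Phi3 θ θ') v = 0 := by
  have h : u • phiSum θ θ' v = 0 := by
    simp only [phiSum, smul_add, Finset.smul_sum, h3, h1, Finset.sum_const_zero, add_zero]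
  rw [phiSum_eq hθ hθ', smul_comm u (48 : ℂ)] at h
  exact (smul_eq_zero_iff_right (by norm_num : (48 : ℂ) ≠ 0)).mp h

/-- Invariance of `Φ` supplies the compatibility with `L_0`, the hypothesis on `x_p d_{pq}` handles
the components of degree 1, 2 and 3, and the degree count handles the rest. -/
theorem Lplus_smul_applyPhi (hθ : IsAlternating θ) (hθ' : ∀ t, IsAlternating (θ' t))
    (hinv : ∀ x, L0act x (Phi3 θ θ') = 0)
    (hz : ∀ p q : Fin 5, p ≠ q → ∀ v : V, ι (od (zForm p q)) • applyPhi (Phi3 θ θ') v = 0) :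
    (∀ X, EvenNonneg X → ∀ v, ι (ev X) • applyPhi (Phi3 θ θ') v =
      applyPhi (Phi3 θ θ') ⁅linearPart X, v⁆) ∧
    ∀ f, OddNonneg f → ∀ v, ι (od f) • applyPhi (Phi3 θ θ') v = 0 := by
  have hm : ∀ (x : sl5) v, slU x • applyPhi (Phi3 θ θ') v = applyPhi (Phi3 θ θ') ⁅x, v⁆ := by
    intro x v
    have h := applyPhi_L0act x (Phi3 θ θ') v
    rw [hinv x] at h
    exact (sub_eq_zero.mp (h.symm.trans (by simp [applyPhi])))
  exact ⟨fun X hX v => ι_ev_smul_eq hm hz (fun X hX v => smul_applyPhi_eq_zero hθ hθ' _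
      hX.smul_dd_dd_dd hX.smul_del_dd v) hX v,
    fun f hf v => ι_od_smul_eq_zero hm hz (fun f hf v => smul_applyPhi_eq_zero hθ hθ' _
      hf.smul_dd_dd_dd hf.smul_del_dd v) hf v⟩

end HighDegree

/-! ## The morphism -/

section Morphism

variable {V : Type*} [AddCommGroup V] [Module ℂ V] [LieRingModule sl5 V] [LieModule ℂ sl5 V]
variable {W : Type*} [AddCommGroup W] [Module ℂ W] [LieRingModule sl5 W] [LieModule ℂ sl5 W]

/-- `v ↦ Φ(v)` as a linear map. -/
def applyPhiL (Φ : U ⊗[ℂ] (V →ₗ[ℂ] W)) : V →ₗ[ℂ] Verma W where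
  toFun := applyPhi Φ
  map_add' v v' := by
    simp only [applyPhi, map_add, LinearMap.lTensor_add, LinearMap.add_apply]
  map_smul' c v := by
    simp only [applyPhi, map_smul, LinearMap.lTensor_smul, LinearMap.smul_apply, RingHom.id_apply]
    exact ((vermaRel W).mkQ.restrictScalars ℂ).map_smul c _

/-- The `U`-linear map `M(V) → M(W)` determined by a vector annihilated by `L_+`. -/
def inducedMap (Φ : U ⊗[ℂ] (V →ₗ[ℂ] W))
    (hE : ∀ X, EvenNonneg X → ∀ v, ι (ev X) • applyPhi Φ v = applyPhi Φ ⁅linearPart X, v⁆)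
    (hO : ∀ f, OddNonneg f → ∀ v, ι (od f) • applyPhi Φ v = 0) : Verma V →ₗ[U] Verma W :=
  (vermaRel V).liftQ (TensorProduct.AlgebraTensorModule.lift
    ((LinearMap.toSpanSingleton U (V →ₗ[ℂ] Verma W) (applyPhiL Φ)))) <| by
    rw [vermaRel, Submodule.span_le]
    rintro _ (⟨X, v, hX, rfl⟩ | ⟨f, v, hf, rfl⟩)
    · rw [SetLike.mem_coe, LinearMap.mem_ker, map_sub, TensorProduct.AlgebraTensorModule.lift_tmul,
        TensorProduct.AlgebraTensorModule.lift_tmul, sub_eq_zero]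
      simp only [LinearMap.toSpanSingleton_apply, LinearMap.smul_apply, one_smul]
      exact hE X hX v
    · rw [SetLike.mem_coe, LinearMap.mem_ker, TensorProduct.AlgebraTensorModule.lift_tmul]
      exact hO f hf v

theorem inducedMap_smul_vone (Φ : U ⊗[ℂ] (V →ₗ[ℂ] W)) (hE) (hO) (u : U) (v : V) :
    inducedMap Φ hE hO (u • vone v) = u • applyPhi Φ v := by
  rw [← tmul_eq_smul_vone]
  rfl

theorem U_smul_mem {M : Type*} [AddCommGroup M] [Module ℂ M] [Module U M] [IsScalarTower ℂ U M]
    (S : Submodule ℂ M) (hE : ∀ X, ∀ m ∈ S, ι (ev X) • m ∈ S) (hO : ∀ f, ∀ m ∈ S, ι (od f) • m ∈ S)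
    (u : U) {m : M} (hm : m ∈ S) : u • m ∈ S := by
  obtain ⟨a, rfl⟩ : ∃ a, mkU a = u := RingQuot.mkAlgHom_surjective ℂ Rel u
  induction a using TensorAlgebra.induction generalizing m with
  | algebraMap c =>
    rw [AlgHom.commutes, algebraMap_smul]
    exact S.smul_mem c hm
  | ι z =>
    have h : mkU (TensorAlgebra.ι ℂ z) = ι (ev z.1) + ι (od z.2) := by
      rw [← map_add, Prod.mk_add_mk, add_zero, zero_add]
      rfl
    rw [h, add_smul]
    exact S.add_mem (hE _ m hm) (hO _ m hm)
  | mul a b ha hb =>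
    rw [map_mul, mul_smul]
    exact ha (hb hm)
  | add a b ha hb =>
    rw [map_add, add_smul]
    exact S.add_mem (ha hm) (hb hm)

theorem del_mem_Uminus (t : Fin 5) : del t ∈ Uminus :=
  Algebra.subset_adjoin (Or.inl ⟨t, rfl⟩)

theorem dd_mem_Uminus (P : Fin 5 × Fin 5) : dd P ∈ Uminus :=
  Algebra.subset_adjoin (Or.inr ⟨P, rfl⟩)

/-- This is the spanning half of the PBW theorem. It is enough that the span is stable under `L`,
since it contains the generating vectors. -/
theorem span_Uminus_eq_top :
    Submodule.span ℂ {m : Verma V | ∃ u ∈ Uminus, ∃ v, m = u • vone v} = ⊤ := by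
  set S := Submodule.span ℂ {m : Verma V | ∃ u ∈ Uminus, ∃ v, m = u • vone v} with hS
  have hS1 : ∀ v : V, vone v ∈ S := fun v =>
    Submodule.subset_span ⟨1, one_mem _, v, (one_smul _ _).symm⟩
  have hmul : ∀ u ∈ Uminus, ∀ m ∈ S, u • m ∈ S := by
    intro u hu m hm
    induction hm using Submodule.span_induction with
    | mem m h =>
      obtain ⟨u', hu', v, rfl⟩ := h
      rw [← mul_smul]
      exact Submodule.subset_span ⟨u * u', mul_mem hu hu', v, rfl⟩
    | zero => rw [smul_zero]; exact zero_mem S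
    | add m m' _ _ h h' => rw [smul_add]; exact add_mem h h'
    | smul c m _ h => rw [smul_comm]; exact S.smul_mem c h
  -- The property propagated along `U_-` is that all of `L` maps `m` into the span. Quantifying over
  -- all of `L` matters, because passing a generator replaces the element by a bracket.
  have hgen : ∀ u ∈ Uminus, ∀ m ∈ S, ((∀ X, ι (ev X) • m ∈ S) ∧ ∀ f, ι (od f) • m ∈ S) →
      (∀ X, ι (ev X) • u • m ∈ S) ∧ ∀ f, ι (od f) • u • m ∈ S := by
    intro u hu
    induction hu using Algebra.adjoin_induction with
    | mem u h =>
      rintro m - ⟨hX, hf⟩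
      rcases h with ⟨t, rfl⟩ | ⟨P, rfl⟩
      · refine ⟨fun X => ?_, fun f => ?_⟩
        · rw [ι_ev_smul_del_smul]
          exact add_mem (hmul _ (del_mem_Uminus t) _ (hX X)) (hX _)
        · rw [ι_od_smul_del_smul]
          exact sub_mem (hmul _ (del_mem_Uminus t) _ (hf f)) (hf _)
      · refine ⟨fun X => ?_, fun f => ?_⟩
        · rw [ι_ev_smul_dd_smul]
          exact add_mem (hmul _ (dd_mem_Uminus P) _ (hX X)) (hf _)
        · rw [ι_od_smul_dd_smul]
          exact sub_mem (hX _) (hmul _ (dd_mem_Uminus P) _ (hf f))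
    | algebraMap c =>
      rintro m - ⟨hX, hf⟩
      refine ⟨fun X => ?_, fun f => ?_⟩ <;> rw [algebraMap_smul, smul_comm]
      exacts [S.smul_mem c (hX X), S.smul_mem c (hf f)]
    | add u u' _ _ h h' =>
      intro m hm hXf
      refine ⟨fun X => ?_, fun f => ?_⟩ <;> rw [add_smul, smul_add]
      exacts [add_mem ((h m hm hXf).1 X) ((h' m hm hXf).1 X),
        add_mem ((h m hm hXf).2 f) ((h' m hm hXf).2 f)]
    | mul u u' _ hu' h h' =>
      intro m hm hXf
      rw [mul_smul]
      exact h _ (hmul u' hu' m hm) (h' m hm hXf)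
  have hvone : ∀ v : V, (∀ X, ι (ev X) • vone v ∈ S) ∧ ∀ f, ι (od f) • vone v ∈ S := by
    intro v
    refine ⟨fun X => ?_, fun f => ?_⟩
    · have h : ιEven X = ιEven (evenConst X) + ιEven (X - evenConst X) := by
        rw [← map_add, add_sub_cancel]
      rw [← ιEven_apply, h, add_smul, ιEven_apply (X - _),
        ι_ev_smul_vone (evenNonneg_sub_evenConst X)]
      refine add_mem ?_ (hS1 _)
      simp only [evenConst, map_sum, map_smul, Finset.sum_smul, smul_assoc]
      exact sum_mem fun t _ => S.smul_mem _ (hmul _ (del_mem_Uminus t) _ (hS1 v))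
    · have h : ιOdd f = ιOdd (oddConst f) + ιOdd (f - oddConst f) := by
        rw [← map_add, add_sub_cancel]
      rw [← ιOdd_apply, h, add_smul, ιOdd_apply (f - _),
        ι_od_smul_vone (oddNonneg_sub_oddConst f), add_zero]
      simp only [oddConst, map_sum, map_smul, Finset.sum_smul, smul_assoc]
      exact sum_mem fun P _ => S.smul_mem _ (S.smul_mem _ (hmul _ (dd_mem_Uminus P) _ (hS1 v)))
  have hL : (∀ X, ∀ m ∈ S, ι (ev X) • m ∈ S) ∧ ∀ f, ∀ m ∈ S, ι (od f) • m ∈ S := by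
    refine ⟨fun X m hm => ?_, fun f m hm => ?_⟩ <;>
    · induction hm using Submodule.span_induction with
      | mem m h =>
        obtain ⟨u, hu, v, rfl⟩ := h
        first
        | exact (hgen u hu _ (hS1 v) (hvone v)).1 X
        | exact (hgen u hu _ (hS1 v) (hvone v)).2 f
      | zero => rw [smul_zero]; exact zero_mem S
      | add m m' _ _ h h' => rw [smul_add]; exact add_mem h h'
      | smul c m _ h => rw [smul_comm]; exact S.smul_mem c h
  rw [eq_top_iff]
  rintro m -
  obtain ⟨x, rfl⟩ := (vermaRel V).mkQ_surjective m
  induction x with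
  | zero => rw [map_zero]; exact zero_mem S
  | add x y hx hy => rw [map_add]; exact add_mem hx hy
  | tmul u v =>
    change Verma.tmul u v ∈ S
    rw [tmul_eq_smul_vone]
    exact U_smul_mem S hL.1 hL.2 u (hS1 v)

/-- Frobenius reciprocity for the induced module `M(V)`: an `L_{≥0}`-equivariant assignment `v ↦
Φ(v)` extends to a `U`-linear map. -/
theorem isMorphism_iff {Φ : U ⊗[ℂ] (V →ₗ[ℂ] W)} {φ : Verma V →ₗ[ℂ] Verma W}
    (hφ : IsAssociated φ Φ) : IsMorphism φ ↔
    (∀ X, EvenNonneg X → ∀ v, ι (ev X) • applyPhi Φ v = applyPhi Φ ⁅linearPart X, v⁆) ∧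
      ∀ f, OddNonneg f → ∀ v, ι (od f) • applyPhi Φ v = 0 := by
  have h1 : ∀ v, φ (vone v) = applyPhi Φ v := fun v => by
    have := hφ 1 (one_mem _) v
    rwa [one_smul] at this
  constructor
  · intro h
    refine ⟨fun X hX v => ?_, fun f hf v => ?_⟩
    · rw [← h1, ← h, ι_ev_smul_vone hX, h1]
    · rw [← h1, ← h, ι_od_smul_vone hf, map_zero]
  · rintro ⟨hE, hO⟩
    -- The map `φ` is prescribed only on `U_- ⊗ V`, so it is identified with the `U`-linear
    -- extension by comparing the two on a spanning set.
    have h2 : φ = (inducedMap Φ hE hO).restrictScalars ℂ := by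
      refine LinearMap.ext_on span_Uminus_eq_top ?_
      rintro _ ⟨u, hu, v, rfl⟩
      rw [LinearMap.restrictScalars_apply, inducedMap_smul_vone, ← tmul_eq_smul_vone, hφ u hu]
    intro z m
    rw [h2, LinearMap.restrictScalars_apply, LinearMap.restrictScalars_apply, map_smul]

end Morphism

end

end E510

theorem mainTheorem8
    {V : Type*} [AddCommGroup V] [Module ℂ V] [LieRingModule E510.sl5 V] [LieModule ℂ E510.sl5 V]
    {W : Type*} [AddCommGroup W] [Module ℂ W] [LieRingModule E510.sl5 W] [LieModule ℂ E510.sl5 W]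
    (θ : E510.Idx 3 → (V →ₗ[ℂ] W)) (θ' : Fin 5 → E510.Idx 1 → (V →ₗ[ℂ] W))
    (hθ : E510.IsAlternating θ) (hθ' : ∀ t, E510.IsAlternating (θ' t))
    (hinv : ∀ x : E510.sl5, E510.L0act x (E510.Phi3 θ θ') = 0)
    (φ : E510.Verma V →ₗ[ℂ] E510.Verma W) (hφ : E510.IsAssociated φ (E510.Phi3 θ θ')) :
    E510.IsMorphism φ ↔
      ∀ (H L : Fin 5 × Fin 5) (p q a b c : Fin 5), [p, q, a, b, c].Nodup → ∀ v : V,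
        (E510.chi (p, q) L • θ' p ![H] v - E510.chi (p, q) H • θ' p ![L] v
          + ((1 / 2 : ℂ) * E510.eps ![p, q, a, b, c]) • ∑ s ∈ E510.cyc a b c,
              (-(⁅E510.xdel p s.2.2, θ ![(s.1, s.2.1), H, L]⁆ v)
                + (2 : ℂ) • ⁅E510.xdel p s.2.2, θ ![(s.1, s.2.1), H, L] v⁆) = 0) ∧
        ((1 / 4 : ℂ) • θ ![(a, b), (b, c), (c, q)] v
          + (1 / 4 : ℂ) • θ ![(a, c), (c, b), (b, q)] v
          + ((1 / 2 : ℂ) * E510.eps ![p, q, a, b, c]) • ∑ s ∈ E510.cyc a b c,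
              (-(⁅E510.xdel p s.2.2, θ' a ![(s.1, s.2.1)]⁆ v)
                + (2 : ℂ) • ⁅E510.xdel p s.2.2, θ' a ![(s.1, s.2.1)] v⁆) = 0) ∧
        (∑ s ∈ E510.cyc a b c, ⁅E510.xdel p s.2.2, θ' p ![(s.1, s.2.1)] v⁆ = 0) ∧
        ((E510.eps ![p, q, a, b, c] : ℂ) • ∑ s ∈ E510.cyc a b c,
              ⁅E510.xdel p s.2.2, θ' q ![(s.1, s.2.1)] v⁆
          - (1 / 2 : ℂ) • θ ![(a, b), (b, c), (c, a)] v = 0) := by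
  rw [E510.isMorphism_iff hφ, ← E510.zForm_smul_applyPhi_iff hθ hθ' hinv]
  -- The forms `x_p d_{pq}` vanish at the origin, which gives one direction; the other is the
  -- reduction of `L_+` to these forms.
  exact ⟨fun h p q _ v => h.2 _ (E510.oddNonneg_zForm p q) v,
    fun h => E510.Lplus_smul_applyPhi hθ hθ' hinv h⟩
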